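/- **Setting.** Let $N\ge1$. Configurations of $N$ fermions on $\mathbb Z$ are the points of the positive sector $\mathcal Z^{(N)}_>=\{x=(x_1,\dots,x_N)\in\mathbb Z^N:\ x_1>\dots>x_N\}$, with the graph structure inherited from $\mathbb Z^N$ ($x\sim y$ iff $\sum_j|x_j-y_j|=1$), the max-distance $\rho(x,y)=\max_j|x_j-y_j|$ and the balls $B_L(u)=\{y\in\mathcal Z^{(N)}_>:\rho(u,y)\le L\}$. Consider $$H(\omega)=-\Delta+g\sum_{j=1}^N V(x_j;\omega)+\sum_{i\ne j}U(|x_i-x_j|),\qquad(-\Delta f)(x)=\sum_{y\sim x}(f(x)-f(y)),$$ where $g\in\mathbb R$, $U$ is real-valued and has finite range ($U(r)=0$ for all $r\ge r_0$), and let $H_{B}$ be the restriction of $H$ to a ball $B$ with Dirichlet boundary conditions outside $B$. The random field $V:\mathbb Z\times\Omega\to\mathbb R$ on a probability space $(\Omega,\mathfrak F,\mathbb P)$ satisfies: * (W1) for some $\kappa>0$, $C<\infty$ and every $s>0$: almost surely, for all $x\in\mathbb Z$ and $a\in\mathbb R$, $\ \mathbb P\{a<V(x)\le a+s\mid V(y),\,y\ne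 x\}\le C s^\kappa$; * (W2) for some $C>0$: $|\mathbb P(\mathcal E'\cap\mathcal E'')-\mathbb P(\mathcal E')\mathbb P(\mathcal E'')|\le e^{-C\ln^2L}$ for all integers $L\ge1$, all $A',A''\subset\mathbb Z$ with $\operatorname{dist}(A',A'')\ge L$ and all events $\mathcal E'\in\sigma(V(x),x\in A')$, $\mathcal E''\in\sigma(V(x),x\in A'')$; * (W3) for a finite interval $Q\subset\mathbb Z$ let $\xi_Q=|Q|^{-1}\sum_{x\in Q}V(x)$, let $F_\xi(\cdot\mid\mathfrak F_{V,Q})$ be the conditional distribution function of $\xi_Q$ given $\{V(x)-\xi_Q,\ x\in Q\}\cup\{V(y),\ y\notin Q\}$, and let $\nu_Q(s)=\sup_t|F_\xi(t+s\mid\mathfrak F_{V,Q})-F_\xi(t\mid\mathfrak F_{V,Q})|$; there are $C',C'',A',A'',b',b''\in(0,\infty)$ such that $\mathbb P\{\nu_Q(s)\ge C'R^{A'}s^{b'}\}\le C''R^{A''}s^{b''}$ for all integers $R\ge1$, all $Q$ of diameter at most $R$ and all $s\in(0,1]$. Put $\alpha=4/3$ and $L_{k+1}=\lceil L_k^{\alpha}\rceil$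 for $k\ge0$. For $m>0$ set $\gamma(m,L)=m(1+L^{-1/8})$. The ball $B_L(u)$ is called *$m$-localized* if every normalized eigenfunction $\Psi$ of $H_{B_L(u)}$ satisfies $|\Psi(x)\Psi(y)|\le e^{-\gamma(m,L)\rho(x,y)}$ for all $x,y\in B_L(u)$ with $\rho(x,y)\ge L^{7/8}$. **Theorem (Localization at any scale).** Let $p>\frac{2\alpha^2}{2-\alpha^2}N$. There is $L_{\min}$ such that for every integer $L_0\ge L_{\min}$ and every $m\ge1$ there is $g_0\in(0,\infty)$ with the following property. If $|g|\ge g_0$, then for every $b>0$ with $$3b\le\min\Big\{\frac{2-\alpha^2}{\alpha^2}-\frac{2N}{p},\ \sqrt2-1\Big\},$$ every $k\ge0$ and every $u\in\mathcal Z^{(N)}_>$, $$\mathbb P\{B_{L_k}(u)\text{ is not }m\text{-localized}\}\le\tfrac14\,L_k^{-p(1+b)^k}.$$ -/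

import Mathlib

open MeasureTheory ProbabilityTheory

noncomputable section

namespace FermionLoc

/-- Configurations of `N` fermions in `ℤ`: the positive sector
`{(x₁, …, x_N) : x₁ > x₂ > ⋯ > x_N}` of `ℤ^N`. -/
def Conf (N : ℕ) : Type := {x : Fin N → ℤ // StrictAnti x}

/-- The max-distance `ρ(x, y) = max_j |x_j - y_j|`. -/
def rho {N : ℕ} (x y : Conf N) : ℕ :=
  Finset.univ.sup fun j => (x.1 j - y.1 j).natAbs

/-- The graph structure which the positive sector inherits from `ℤ^N`: two configurations are
nearest neighbours iff `|x - y|₁ = 1`. -/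
def confGraph (N : ℕ) : SimpleGraph (Conf N) where
  Adj x y := ∑ j, |x.1 j - y.1 j| = 1
  symm := ⟨fun x y h => by simpa only [abs_sub_comm] using h⟩
  loopless := ⟨fun x h => by simp at h⟩

theorem finite_ball {N : ℕ} (u : Conf N) (L : ℕ) : {y : Conf N | rho u y ≤ L}.Finite := by
  have hfin : (Set.univ.pi fun j : Fin N => Set.Icc (u.1 j - L) (u.1 j + L)).Finite :=
    Set.Finite.pi fun j => Set.finite_Icc _ _
  refine (hfin.preimage (f := fun y : Conf N => y.1)
    (fun a _ b _ h => Subtype.ext h)).subset ?_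
  intro y hy j _
  have h : (u.1 j - y.1 j).natAbs ≤ L :=
    le_trans (Finset.le_sup (f := fun j => (u.1 j - y.1 j).natAbs) (Finset.mem_univ j)) hy
  constructor <;> dsimp only <;> omega

theorem finite_neighborSet {N : ℕ} (x : Conf N) : ((confGraph N).neighborSet x).Finite := by
  refine (finite_ball x 1).subset ?_
  intro y hy
  have hy' : ∑ j, |x.1 j - y.1 j| = 1 := hy
  refine Finset.sup_le (f := fun j => (x.1 j - y.1 j).natAbs) fun j _ => ?_
  have h := Finset.single_le_sum (f := fun j => |x.1 j - y.1 j|)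
    (fun i _ => abs_nonneg _) (Finset.mem_univ j)
  rw [hy', Int.abs_eq_natAbs] at h
  omega

instance (N : ℕ) : (confGraph N).LocallyFinite := fun x => (finite_neighborSet x).fintype

/-- The ball `{y : ρ(u, y) ≤ L}` in the positive sector. -/
def ball {N : ℕ} (u : Conf N) (L : ℕ) : Finset (Conf N) := (finite_ball u L).toFinset

/-- The external potential energy `V(x₁) + ⋯ + V(x_N)` of a configuration, for a sample `v` of the
one-particle potential. -/
def extPotential {N : ℕ} (v : ℤ → ℝ) (x : Conf N) : ℝ := ∑ j, v (x.1 j)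

/-- The interaction energy `∑_{i ≠ j} U(|x_i - x_j|)`. -/
def interaction {N : ℕ} (U : ℕ → ℝ) (x : Conf N) : ℝ :=
  ∑ i, ∑ j, if i ≠ j then U (x.1 i - x.1 j).natAbs else 0

open Classical in
/-- The restriction `H_Λ` of `H = -Δ + g V + U` to a finite set `Λ` of configurations, with
Dirichlet boundary conditions outside `Λ`, as a matrix in the basis of delta-functions.
Here `(-Δ f)(x) = ∑_{y ~ x} (f x - f y)` is the graph Laplacian of the positive sector; hence the
diagonal contains the coordination number of `x` in the whole graph. -/
def hamiltonian {N : ℕ} (U : ℕ → ℝ) (g : ℝ) (v : ℤ → ℝ) (Λ : Finset (Conf N)) :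
    Matrix Λ Λ ℂ := fun x y =>
  (if x = y then
      ((((confGraph N).degree x.1 : ℝ) + g * extPotential v x.1 + interaction U x.1 : ℝ) : ℂ)
    else 0)
  - (if (confGraph N).Adj x.1 y.1 then 1 else 0)

/-- The scale exponent `α`. -/
def alpha : ℝ := 4 / 3

/-- The parameter `ϱ = (α - 1) / 2 = 1/6`, so that `(1 + ϱ) / α = 7/8`. -/
def varrho : ℝ := (alpha - 1) / 2

/-- The decay exponent `γ(m, L) = m (1 + L^{-τ})` with `τ = 1/8`. -/
def gammaExp (m : ℝ) (L : ℕ) : ℝ := m * (1 + (L : ℝ) ^ (-(1 / 8) : ℝ))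

open Classical in
/-- The ball of radius `L` centered at `u` is `m`-localized, for the sample `v` of the potential:
every normalized eigenfunction `ψ` of the Hamiltonian in the ball satisfies
`|ψ(x) ψ(y)| ≤ exp(-γ(m, L) ρ(x, y))` whenever `ρ(x, y) ≥ L^{(1 + ϱ)/α} = L^{7/8}`. -/
def IsLocalized {N : ℕ} (U : ℕ → ℝ) (g : ℝ) (v : ℤ → ℝ) (m : ℝ) (u : Conf N) (L : ℕ) : Prop :=
  ∀ (E : ℝ) (ψ : EuclideanSpace ℂ (ball u L)), ‖ψ‖ = 1 →
    Module.End.HasEigenvector (Matrix.toEuclideanLin (hamiltonian U g v (ball u L))) (E : ℂ) ψ →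
    ∀ x y : ball u L, (L : ℝ) ^ ((1 + varrho) / alpha) ≤ (rho x.1 y.1 : ℝ) →
      ‖ψ x * ψ y‖ ≤ Real.exp (-(gammaExp m L * (rho x.1 y.1 : ℝ)))

/-- The sequence of scales `L_{k+1} = ⌈L_k^α⌉`. -/
def scale (L₀ : ℕ) : ℕ → ℕ
  | 0 => L₀
  | k + 1 => ⌈((scale L₀ k : ℕ) : ℝ) ^ alpha⌉₊

section Field

variable {Ω : Type*} [MeasurableSpace Ω]

/-- Uniform Hölder continuity of the conditional distribution functions of the single values
`V(x; ·)` given all other values of the field. -/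
def HolderContinuousCDF (P : Measure Ω) [IsFiniteMeasure P] (V : ℤ → Ω → ℝ) : Prop :=
  ∃ κ : ℝ, 0 < κ ∧ ∃ C : ℝ, ∀ s : ℝ, 0 < s → ∀ᵐ ω ∂P, ∀ x : ℤ, ∀ a : ℝ,
    (condDistrib (V x) (fun ω' (y : {y : ℤ // y ≠ x}) => V y.1 ω') P
      (fun y => V y.1 ω)).real (Set.Ioc a (a + s)) ≤ C * s ^ κ

/-- The sigma-algebra generated by the values of the field in `A`. -/
@[reducible]
def fieldSigma (V : ℤ → Ω → ℝ) (A : Set ℤ) : MeasurableSpace Ω :=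
  ⨆ x ∈ A, MeasurableSpace.comap (V x) inferInstance

/-- Rosenblatt strong mixing with rate `exp(-C ln² L)`. -/
def StrongMixing (P : Measure Ω) (V : ℤ → Ω → ℝ) : Prop :=
  ∃ C : ℝ, 0 < C ∧ ∀ (L : ℕ) (A B : Set ℤ), (∀ a ∈ A, ∀ b ∈ B, (L : ℤ) ≤ |a - b|) →
    ∀ S T : Set Ω, MeasurableSet[fieldSigma V A] S → MeasurableSet[fieldSigma V B] T →
      |P.real (S ∩ T) - P.real S * P.real T| ≤ Real.exp (-C * Real.log L ^ 2)

/-- The sample mean `ξ_Q` of the field over a finite set `Q`. -/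
def sampleMean (V : ℤ → Ω → ℝ) (Q : Finset ℤ) (ω : Ω) : ℝ :=
  (∑ x ∈ Q, V x ω) / (Q.card : ℝ)

/-- The family `{η_x, V_y : x ∈ Q, y ∉ Q}` of the fluctuations `η_x = V_x - ξ_Q` in `Q`
and of the values of the field outside `Q`. -/
def fluctuations (V : ℤ → Ω → ℝ) (Q : Finset ℤ) (ω : Ω) : ℤ → ℝ := fun y =>
  if y ∈ Q then V y ω - sampleMean V Q ω else V y ω

/-- The conditional distribution function `F_ξ(t | 𝔉_{V,Q})` of the sample mean, given the
sigma-algebra generated by `fluctuations V Q`. -/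
def meanCDF (P : Measure Ω) [IsFiniteMeasure P] (V : ℤ → Ω → ℝ) (Q : Finset ℤ) (ω : Ω)
    (t : ℝ) : ℝ :=
  (condDistrib (sampleMean V Q) (fluctuations V Q) P (fluctuations V Q ω)).real (Set.Iic t)

/-- The continuity modulus `ν(s; ω) = sup_t |F_ξ(t + s | 𝔉_{V,Q}) - F_ξ(t | 𝔉_{V,Q})|`. -/
def meanModulus (P : Measure Ω) [IsFiniteMeasure P] (V : ℤ → Ω → ℝ) (Q : Finset ℤ) (s : ℝ)
    (ω : Ω) : ℝ :=
  ⨆ t : ℝ, |meanCDF P V Q ω (t + s) - meanCDF P V Q ω t|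

/-- Regularity of the conditional distribution of the sample mean: with constants independent of
`R ≥ 1`, of the interval `Q` of diameter at most `R` and of `s ∈ (0, 1]`,
`P{ν(s; ω) ≥ C' R^{A'} s^{b'}} ≤ C'' R^{A''} s^{b''}`. -/
def RegularSampleMean (P : Measure Ω) [IsFiniteMeasure P] (V : ℤ → Ω → ℝ) : Prop :=
  ∃ C' C'' A' A'' b' b'' : ℝ,
    0 < C' ∧ 0 < C'' ∧ 0 < A' ∧ 0 < A'' ∧ 0 < b' ∧ 0 < b'' ∧
    ∀ R : ℕ, 1 ≤ R → ∀ c d : ℤ, c ≤ d → d - c ≤ R → ∀ s : ℝ, 0 < s → s ≤ 1 →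
      P.real {ω | C' * (R : ℝ) ^ A' * s ^ b' ≤ meanModulus P V (Finset.Icc c d) s ω}
        ≤ C'' * (R : ℝ) ^ A'' * s ^ b''

end Field

end FermionLoc

end

/-!
The proof is a multi-scale analysis performed directly on eigenfunctions. It is an induction in the
number `N` of particles, with `p > 16 N` arbitrary, and for each `N` an induction in the scale
`L_k`. The assumptions on `b` imply `b ≤ 1/24`.

*Initial scale* (`exists_disorder`). For different configurations `x ≠ y` some site is occupied in
exactly one of them, so by (W1) the energies of all pairs in a ball of a fixed radius differ by
at least some `δ` with high probability. If `|g| δ` is large, every eigenfunction is concentrated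
at one point.

*Deterministic step* (`isLocalized_of_clusters`). Let `l = L_k`, `L = L_{k+1}`, and let `ψ` be an
eigenfunction with energy `E` in the ball of radius `L`. Suppose that the non-localized balls of
radius `l` lie in one cluster of size `O(l)`, and that so do the balls of radius `O(l)` with an
eigenvalue within `exp (-l ^ (1/2))` of `E`. Expanding `ψ` in a smaller ball over an eigenbasis of
this ball (`EigBasis.norm_le`) bounds `ψ` at a point by its values at the exit points, with a gain
`exp (-γ ρ)` if the smaller ball is localized. A maximum principle for `|ψ| exp (γ' δ)`, where `δ`
is the distance to the resonant cluster with the non-localized cluster collapsed to a point, shows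
that `ψ` decays from the resonant cluster alone. The loss in the rate of decay is of the relative
order `l / L ^ (7/8) = l ^ (-1/6)`, smaller than the allowed one `l ^ (-1/8)`.

*Probability* (`real_not_isLocalized_le`). There are three ways in which this may fail.
* A ball whose centre splits into two distant clusters of particles is not localized. The
  interaction has finite range, so the ball is a product and the Hamiltonian is
  `H' ⊗ 1 + 1 ⊗ H''`. Products of the eigenfunctions of the factors are a decaying eigenbasis
  (`Gapped.decayBasis`); since the deterministic step needs only such a basis, multiple
  eigenvalues do no harm. The probability is bounded by the result for fewer particles, with the
  exponent `3 p`.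
* Two distant balls without such a splitting are not localized. They depend on the potential in
  distant intervals, so by (W2) the probability is almost squared.
* Two distant balls have close eigenvalues. As the particles are ordered, some interval of
  polynomial length contains different numbers of particles for the two balls (`exists_interval`).
  Changing the sample mean over this interval shifts the two spectra with different constant
  speeds, and (W3) bounds the probability by a power of `exp (-l ^ (1/2))`
  (`real_eigenvalues_close_le`).

Non-localization and closeness of spectra are Borel conditions on the potential because unit
spheres are compact (`isClosed_exists_large`, `isClosed_exists_pair`).
-/

noncomputable section

namespace FermionLoc

/-! ### Eigenfunctions of a symmetric kernel on a finite set -/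

section Spectral

variable {X : Type*}

/-- `f` is a normalized eigenfunction, with the eigenvalue `E`, of the restriction of the kernel
`h` to the finite set `Λ`. The values of `f` outside `Λ` are irrelevant. -/
structure UnitEig (h : X → X → ℝ) (Λ : Finset X) (E : ℝ) (f : X → ℂ) : Prop where
  unit : ∑ x ∈ Λ, ‖f x‖ ^ 2 = 1
  eig : ∀ x ∈ Λ, ∑ y ∈ Λ, (h x y : ℂ) * f y = E * f x

open Classical in
/-- A complete system of normalized eigenfunctions of the restriction of `h` to `Λ`. Orthogonality
is encoded in the resolution of the identity `complete`. -/
structure EigBasis (h : X → X → ℝ) (Λ : Finset X) {ι : Type*} [Fintype ι]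
    (φ : ι → X → ℂ) (lam : ι → ℝ) : Prop where
  card : Fintype.card ι = Λ.card
  eig : ∀ a, UnitEig h Λ (lam a) (φ a)
  complete : ∀ x ∈ Λ, ∀ y ∈ Λ, ∑ a, φ a x * star (φ a y) = if x = y then 1 else 0

theorem UnitEig.norm_le_one {h : X → X → ℝ} {Λ : Finset X} {E : ℝ} {f : X → ℂ}
    (hf : UnitEig h Λ E f) {x : X} (hx : x ∈ Λ) : ‖f x‖ ≤ 1 := by
  have h1 : ‖f x‖ ^ 2 ≤ 1 := by
    rw [← hf.unit]
    exact Finset.single_le_sum (f := fun x => ‖f x‖ ^ 2) (fun _ _ => sq_nonneg _) hx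
  nlinarith [norm_nonneg (f x)]

theorem UnitEig.congr {h : X → X → ℝ} {Λ : Finset X} {E : ℝ} {f f' : X → ℂ}
    (hf : UnitEig h Λ E f) (h' : ∀ x ∈ Λ, f x = f' x) : UnitEig h Λ E f' := by
  refine ⟨?_, fun x hx => ?_⟩
  · rw [← hf.unit]
    exact Finset.sum_congr rfl fun x hx => by rw [h' x hx]
  · rw [← h' x hx, ← hf.eig x hx]
    exact Finset.sum_congr rfl fun y hy => by rw [h' y hy]

theorem UnitEig.congr_kernel {h h' : X → X → ℝ} {Λ : Finset X} {E : ℝ} {f : X → ℂ}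
    (hf : UnitEig h Λ E f) (hh : ∀ x ∈ Λ, ∀ y ∈ Λ, h x y = h' x y) : UnitEig h' Λ E f := by
  refine ⟨hf.unit, fun x hx => ?_⟩
  rw [← hf.eig x hx]
  exact Finset.sum_congr rfl fun y hy => by rw [hh x hx y hy]

theorem exists_eigBasis {h : X → X → ℝ} (hs : ∀ x y, h x y = h y x) (Λ : Finset X) :
    ∃ (φ : Λ → X → ℂ) (lam : Λ → ℝ), EigBasis h Λ φ lam := by
  classical
  set A : Matrix Λ Λ ℂ := fun x y => (h x.1 y.1 : ℂ) with hAdef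
  have hA : A.IsHermitian := by
    ext x y
    rw [Matrix.conjTranspose_apply]
    simp [hAdef, hs x.1 y.1]
  set b := hA.eigenvectorBasis with hb
  refine ⟨fun a x => if hx : x ∈ Λ then (b a).ofLp ⟨x, hx⟩ else 0, hA.eigenvalues, ?_, ?_, ?_⟩
  · simp
  · intro a
    have hval : ∀ x : Λ, (if hx : x.1 ∈ Λ then (b a).ofLp ⟨x.1, hx⟩ else 0) = (b a).ofLp x := by
      intro x; simp
    refine ⟨?_, ?_⟩
    · rw [← Finset.sum_coe_sort Λ]
      simp only [hval]
      rw [← EuclideanSpace.norm_sq_eq]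
      simp [b.orthonormal.1 a]
    · intro x hx
      rw [← Finset.sum_coe_sort Λ]
      simp only [hval]
      have := congrFun (hA.mulVec_eigenvectorBasis a) ⟨x, hx⟩
      simp only [Matrix.mulVec, dotProduct, hAdef] at this
      rw [hb, this]
      simp [hx]
  · intro x hx y hy
    have h1 := b.sum_inner_mul_inner (EuclideanSpace.single ⟨x, hx⟩ (1 : ℂ))
      (EuclideanSpace.single ⟨y, hy⟩ (1 : ℂ))
    simp only [EuclideanSpace.inner_single_left, EuclideanSpace.inner_single_right] at h1
    simp only [hx, hy, dif_pos]
    simpa [Pi.single_apply, eq_comm (a := y)] using h1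

/-- The expansion coefficients of a function solving the eigenvalue equation in `Λ` (with sources
in `B \ Λ`) over an eigenfunction of the restriction to `Λ`. -/
theorem UnitEig.coeff_mul {h : X → X → ℝ} (hs : ∀ x y, h x y = h y x) {Λ B : Finset X}
    [DecidableEq X] (hΛ : Λ ⊆ B) {lam E : ℝ} {φ ψ : X → ℂ} (hφ : UnitEig h Λ lam φ)
    (hψ : ∀ x ∈ Λ, ∑ y ∈ B, (h x y : ℂ) * ψ y = E * ψ x) :
    ((lam - E : ℝ) : ℂ) * ∑ y ∈ Λ, star (φ y) * ψ y
      = -∑ y ∈ Λ, ∑ z ∈ B \ Λ, star (φ y) * ((h y z : ℂ) * ψ z) := by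
  have e1 : (lam : ℂ) * ∑ y ∈ Λ, star (φ y) * ψ y
      = ∑ y ∈ Λ, ∑ z ∈ Λ, star (φ y) * ((h y z : ℂ) * ψ z) := by
    have : ∀ z ∈ Λ, (lam : ℂ) * (star (φ z) * ψ z)
        = ∑ y ∈ Λ, star (φ y) * ((h y z : ℂ) * ψ z) := by
      intro z hz
      have := congrArg star (hφ.eig z hz)
      rw [star_sum, star_mul'] at this
      simp only [star_mul'] at this
      have h2 : (lam : ℂ) * star (φ z) = ∑ y ∈ Λ, (h y z : ℂ) * star (φ y) := by
        rw [show (lam : ℂ) = star (lam : ℂ) by simp, ← this]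
        refine Finset.sum_congr rfl fun y _ => ?_
        rw [hs z y]; simp
      rw [← mul_assoc, h2, Finset.sum_mul]
      exact Finset.sum_congr rfl fun y _ => by ring
    rw [Finset.mul_sum, Finset.sum_congr rfl this, Finset.sum_comm]
  have e2 : (E : ℂ) * ∑ y ∈ Λ, star (φ y) * ψ y
      = ∑ y ∈ Λ, ∑ z ∈ B, star (φ y) * ((h y z : ℂ) * ψ z) := by
    rw [Finset.mul_sum]
    refine Finset.sum_congr rfl fun y hy => ?_
    rw [← Finset.mul_sum, hψ y hy]; ring
  push_cast
  rw [sub_mul, e1, e2, ← Finset.sum_sub_distrib, ← Finset.sum_neg_distrib]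
  refine Finset.sum_congr rfl fun y _ => ?_
  rw [← Finset.sum_sdiff hΛ]
  ring

theorem EigBasis.expand {h : X → X → ℝ} {Λ : Finset X} {ι : Type*} [Fintype ι]
    {φ : ι → X → ℂ} {lam : ι → ℝ} (hb : EigBasis h Λ φ lam) (ψ : X → ℂ) {x : X} (hx : x ∈ Λ) :
    ψ x = ∑ a, φ a x * ∑ y ∈ Λ, star (φ a y) * ψ y := by
  classical
  have : ∑ a, φ a x * ∑ y ∈ Λ, star (φ a y) * ψ y
      = ∑ y ∈ Λ, (∑ a, φ a x * star (φ a y)) * ψ y := by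
    simp_rw [Finset.mul_sum, Finset.sum_mul]
    rw [Finset.sum_comm]
    exact Finset.sum_congr rfl fun _ _ => Finset.sum_congr rfl fun _ _ => by ring
  rw [this, Finset.sum_congr rfl fun y hy => by rw [hb.complete x hx y hy]]
  simp [hx]

/-- An eigenbasis exhausts the spectrum. -/
theorem EigBasis.exists_eq {h : X → X → ℝ} (hs : ∀ x y, h x y = h y x) {Λ : Finset X}
    {ι : Type*} [Fintype ι] {φ : ι → X → ℂ} {lam : ι → ℝ} (hb : EigBasis h Λ φ lam)
    {E : ℝ} {f : X → ℂ} (hf : UnitEig h Λ E f) : ∃ a, lam a = E := by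
  classical
  by_contra! hne
  have hc : ∀ a, ∑ y ∈ Λ, star (φ a y) * f y = 0 := by
    intro a
    have := (hb.eig a).coeff_mul hs (Finset.Subset.refl Λ) hf.eig
    simp only [Finset.sdiff_self, Finset.sum_empty, Finset.sum_const_zero, neg_zero] at this
    rcases mul_eq_zero.1 this with h0 | h0
    · exact absurd (by exact_mod_cast h0 : lam a - E = 0) (sub_ne_zero.2 (hne a))
    · exact h0
  have h0 : ∀ x ∈ Λ, f x = 0 := fun x hx => by
    rw [hb.expand f hx]; simp only [hc, mul_zero, Finset.sum_const_zero]
  have := hf.unit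
  rw [Finset.sum_congr rfl fun x hx => by rw [h0 x hx]] at this
  simp at this

/-- Geometric resolvent bound: inside a subset `Λ` whose eigenvalues stay at distance at least `s`
from `E`, a solution of the eigenvalue equation is controlled by the products of the values of the
eigenfunctions in `Λ` and of the values of the solution at the exit points from `Λ`. -/
theorem EigBasis.norm_le {h : X → X → ℝ} (hs : ∀ x y, h x y = h y x) {Λ B : Finset X}
    (hΛ : Λ ⊆ B) {ι : Type*} [Fintype ι] {φ : ι → X → ℂ} {lam : ι → ℝ}
    (hb : EigBasis h Λ φ lam) {E s T n : ℝ} {ψ : X → ℂ}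
    (hψ : ∀ x ∈ Λ, ∑ y ∈ B, (h x y : ℂ) * ψ y = E * ψ x)
    (hsp : 0 < s) (hres : ∀ a, s ≤ |lam a - E|) (hn : (B.card : ℝ) ≤ n) {x : X} (hx : x ∈ Λ)
    (hT0 : 0 ≤ T)
    (hT : ∀ a, ∀ y ∈ Λ, ∀ z ∈ B, z ∉ Λ → h y z ≠ 0 →
      ‖φ a x * φ a y‖ * (|h y z| * ‖ψ z‖) ≤ T) :
    ‖ψ x‖ ≤ n ^ 3 * s⁻¹ * T := by
  classical
  have hterm : ∀ a, ‖φ a x * ∑ y ∈ Λ, star (φ a y) * ψ y‖ ≤ s⁻¹ * (n ^ 2 * T) := by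
    intro a
    have h1 := (hb.eig a).coeff_mul hs hΛ hψ
    have hpos : 0 < |lam a - E| := hsp.trans_le (hres a)
    have h2 : |lam a - E| * ‖φ a x * ∑ y ∈ Λ, star (φ a y) * ψ y‖ ≤ n ^ 2 * T := by
      have : |lam a - E| * ‖φ a x * ∑ y ∈ Λ, star (φ a y) * ψ y‖
          = ‖φ a x * (((lam a - E : ℝ) : ℂ) * ∑ y ∈ Λ, star (φ a y) * ψ y)‖ := by
        rw [norm_mul, norm_mul, norm_mul, Complex.norm_real, Real.norm_eq_abs]; ring
      rw [this, h1, mul_neg, norm_neg, Finset.mul_sum]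
      have hcardΛ : (Λ.card : ℝ) ≤ n :=
        le_trans (by exact_mod_cast Finset.card_le_card hΛ) hn
      have hcardD : ((B \ Λ).card : ℝ) ≤ n :=
        le_trans (by exact_mod_cast Finset.card_le_card Finset.sdiff_subset) hn
      have hin : ∀ y ∈ Λ, ‖φ a x * ∑ z ∈ B \ Λ, star (φ a y) * ((h y z : ℂ) * ψ z)‖
          ≤ n * T := by
        intro y hy
        rw [Finset.mul_sum]
        refine (norm_sum_le _ _).trans ?_
        refine (Finset.sum_le_card_nsmul _ _ T fun z hz => ?_).trans ?_
        · obtain ⟨hzB, hzΛ⟩ := Finset.mem_sdiff.1 hz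
          by_cases h0 : h y z = 0
          · simp [h0, hT0]
          · refine le_of_eq_of_le ?_ (hT a y hy z hzB hzΛ h0)
            simp only [norm_mul, norm_star, Complex.norm_real, Real.norm_eq_abs]; ring
        · rw [nsmul_eq_mul]; gcongr
      refine (norm_sum_le _ _).trans ((Finset.sum_le_card_nsmul _ _ _ hin).trans ?_)
      rw [nsmul_eq_mul, pow_two, mul_assoc]
      have : 0 ≤ n := le_trans (Nat.cast_nonneg _) hn
      gcongr
    rw [← div_eq_inv_mul, le_div_iff₀ hsp, mul_comm]
    exact le_trans (mul_le_mul_of_nonneg_right (hres a) (norm_nonneg _)) h2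
  rw [hb.expand ψ hx]
  refine (norm_sum_le _ _).trans ((Finset.sum_le_card_nsmul _ _ _ fun a _ => hterm a).trans ?_)
  rw [nsmul_eq_mul, Finset.card_univ, hb.card]
  have hcardΛ : (Λ.card : ℝ) ≤ n :=
    le_trans (by exact_mod_cast Finset.card_le_card hΛ) hn
  have hn0 : 0 ≤ n := le_trans (Nat.cast_nonneg _) hn
  calc (Λ.card : ℝ) * (s⁻¹ * (n ^ 2 * T)) ≤ n * (s⁻¹ * (n ^ 2 * T)) := by gcongr
    _ = n ^ 3 * s⁻¹ * T := by ring

/-- The quadratic form of the restriction of `h` to `Λ`: the eigenvalue of a normalized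
eigenfunction as a continuous function of the eigenfunction and of the kernel. -/
def rayleigh (h : X → X → ℝ) (Λ : Finset X) (f : X → ℂ) : ℝ :=
  (∑ x ∈ Λ, star (f x) * ∑ y ∈ Λ, (h x y : ℂ) * f y).re

theorem UnitEig.eq_rayleigh {h : X → X → ℝ} {Λ : Finset X} {E : ℝ} {f : X → ℂ}
    (hf : UnitEig h Λ E f) : E = rayleigh h Λ f := by
  unfold rayleigh
  rw [Finset.sum_congr rfl fun x hx => by rw [hf.eig x hx]]
  have : ∑ x ∈ Λ, star (f x) * ((E : ℂ) * f x) = ((E * ∑ x ∈ Λ, ‖f x‖ ^ 2 : ℝ) : ℂ) := by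
    push_cast
    rw [Finset.mul_sum]
    refine Finset.sum_congr rfl fun x _ => ?_
    rw [← Complex.conj_mul' (f x), Complex.star_def]; ring
  rw [this, hf.unit]; simp

/-- The compact set of functions with values in the closed unit disc. -/
def discFun (X : Type*) : Set (X → ℂ) := Set.pi Set.univ fun _ => Metric.closedBall 0 1

theorem isCompact_discFun : IsCompact (discFun X) :=
  isCompact_univ_pi fun _ => isCompact_closedBall _ _

theorem UnitEig.exists_disc {h : X → X → ℝ} {Λ : Finset X} {E : ℝ} {f : X → ℂ}
    (hf : UnitEig h Λ E f) : ∃ f' ∈ discFun X, UnitEig h Λ E f' ∧ ∀ x ∈ Λ, f' x = f x := by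
  classical
  have hcg : ∀ x ∈ Λ, (if x ∈ Λ then f x else 0) = f x := fun x hx => by simp [hx]
  refine ⟨fun x => if x ∈ Λ then f x else 0, fun x _ => ?_,
    hf.congr fun x hx => (hcg x hx).symm, hcg⟩
  by_cases hx : x ∈ Λ
  · simpa [hx] using hf.norm_le_one hx
  · simp [hx]

section Topology

variable {T : Type*} [TopologicalSpace T]

theorem continuous_rayleigh {k : T → X → X → ℝ} (hk : ∀ x y, Continuous fun t => k t x y)
    (Λ : Finset X) : Continuous fun q : T × (X → ℂ) => rayleigh (k q.1) Λ q.2 := by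
  unfold rayleigh
  refine Complex.continuous_re.comp (continuous_finsetSum _ fun x _ => ?_)
  refine Continuous.mul (continuous_star.comp ((continuous_apply x).comp continuous_snd)) ?_
  refine continuous_finsetSum _ fun y _ => ?_
  exact (Complex.continuous_ofReal.comp ((hk x y).comp continuous_fst)).mul
    ((continuous_apply y).comp continuous_snd)

theorem isClosed_unitEig {k : T → X → X → ℝ} (hk : ∀ x y, Continuous fun t => k t x y)
    (Λ : Finset X) :
    IsClosed {q : T × (X → ℂ) | UnitEig (k q.1) Λ (rayleigh (k q.1) Λ q.2) q.2} := by
  have : {q : T × (X → ℂ) | UnitEig (k q.1) Λ (rayleigh (k q.1) Λ q.2) q.2}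
      = {q | ∑ x ∈ Λ, ‖q.2 x‖ ^ 2 = 1} ∩ ⋂ x ∈ Λ,
        {q | ∑ y ∈ Λ, (k q.1 x y : ℂ) * q.2 y = (rayleigh (k q.1) Λ q.2 : ℝ) * q.2 x} := by
    ext q
    simp only [Set.mem_ofPred_eq, Set.mem_inter_iff, Set.mem_iInter]
    exact ⟨fun h => ⟨h.1, h.2⟩, fun h => ⟨h.1, h.2⟩⟩
  rw [this]
  have hap : ∀ x, Continuous fun q : T × (X → ℂ) => q.2 x := fun x =>
    (continuous_apply x).comp continuous_snd
  refine IsClosed.inter (isClosed_eq (continuous_finsetSum _ fun x _ => (hap x).norm.pow 2)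
    continuous_const) (isClosed_biInter fun x _ => isClosed_eq ?_ ?_)
  · exact continuous_finsetSum _ fun y _ =>
      (Complex.continuous_ofReal.comp ((hk x y).comp continuous_fst)).mul (hap y)
  · exact (Complex.continuous_ofReal.comp (continuous_rayleigh hk Λ)).mul (hap x)

theorem isClosed_exists_compact {Y : Type*} [TopologicalSpace Y] {K : Set Y} (hK : IsCompact K)
    {S : Set (T × Y)} (hS : IsClosed S) : IsClosed {t | ∃ y ∈ K, (t, y) ∈ S} := by
  have := isCompact_iff_compactSpace.1 hK
  have hS' : IsClosed {q : T × K | (q.1, q.2.1) ∈ S} :=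
    hS.preimage (continuous_fst.prodMk (continuous_subtype_val.comp continuous_snd))
  have := isClosedMap_fst_of_compactSpace _ hS'
  convert this using 1
  ext t
  simp

/-- The parameters for which some normalized eigenfunction is large at a pair of points form a
closed set, since the unit sphere is compact. -/
theorem isClosed_exists_large {k : T → X → X → ℝ} (hk : ∀ x y, Continuous fun t => k t x y)
    (Λ : Finset X) {x y : X} (hx : x ∈ Λ) (hy : y ∈ Λ) (c : ℝ) :
    IsClosed {t | ∃ E f, UnitEig (k t) Λ E f ∧ c ≤ ‖f x * f y‖} := by
  have hcl : IsClosed {q : T × (X → ℂ) | UnitEig (k q.1) Λ (rayleigh (k q.1) Λ q.2) q.2 ∧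
      c ≤ ‖q.2 x * q.2 y‖} :=
    (isClosed_unitEig hk Λ).inter (isClosed_le continuous_const
      (((continuous_apply x).comp continuous_snd).mul
        ((continuous_apply y).comp continuous_snd)).norm)
  convert isClosed_exists_compact isCompact_discFun hcl using 1
  ext t
  constructor
  · rintro ⟨E, f, hf, hc⟩
    obtain ⟨f', hd, hf', hcg⟩ := hf.exists_disc
    refine ⟨f', hd, ?_, ?_⟩
    · simpa only [← hf'.eq_rayleigh] using hf'
    · simpa only [hcg x hx, hcg y hy] using hc
  · rintro ⟨f, -, hf, hc⟩
    exact ⟨_, f, hf, hc⟩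

/-- The parameters for which two restrictions have eigenvalues related by a closed condition form
a closed set. -/
theorem isClosed_exists_pair {k : T → X → X → ℝ} (hk : ∀ x y, Continuous fun t => k t x y)
    (Λ₁ Λ₂ : Finset X) {r : T → ℝ → ℝ → ℝ}
    (hr : Continuous fun q : T × ℝ × ℝ => r q.1 q.2.1 q.2.2) (c : ℝ) :
    IsClosed {t | ∃ E₁ f₁ E₂ f₂, UnitEig (k t) Λ₁ E₁ f₁ ∧ UnitEig (k t) Λ₂ E₂ f₂ ∧
      r t E₁ E₂ ≤ c} := by
  have p1 : Continuous fun q : T × (X → ℂ) × (X → ℂ) => (q.1, q.2.1) := by fun_prop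
  have p2 : Continuous fun q : T × (X → ℂ) × (X → ℂ) => (q.1, q.2.2) := by fun_prop
  have hcl : IsClosed {q : T × (X → ℂ) × (X → ℂ) |
      UnitEig (k q.1) Λ₁ (rayleigh (k q.1) Λ₁ q.2.1) q.2.1 ∧
      UnitEig (k q.1) Λ₂ (rayleigh (k q.1) Λ₂ q.2.2) q.2.2 ∧
      r q.1 (rayleigh (k q.1) Λ₁ q.2.1) (rayleigh (k q.1) Λ₂ q.2.2) ≤ c} := by
    refine IsClosed.and ((isClosed_unitEig hk Λ₁).preimage p1)
      (IsClosed.and ((isClosed_unitEig hk Λ₂).preimage p2) (isClosed_le ?_ continuous_const))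
    exact hr.comp (continuous_fst.prodMk (((continuous_rayleigh hk Λ₁).comp p1).prodMk
      ((continuous_rayleigh hk Λ₂).comp p2)))
  convert isClosed_exists_compact (isCompact_discFun.prod isCompact_discFun) hcl using 1
  ext t
  constructor
  · rintro ⟨E₁, f₁, E₂, f₂, h₁, h₂, hc⟩
    obtain ⟨f₁', hd₁, hf₁, -⟩ := h₁.exists_disc
    obtain ⟨f₂', hd₂, hf₂, -⟩ := h₂.exists_disc
    refine ⟨(f₁', f₂'), ⟨hd₁, hd₂⟩, ?_, ?_, ?_⟩
    · simpa only [← hf₁.eq_rayleigh] using hf₁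
    · simpa only [← hf₂.eq_rayleigh] using hf₂
    · simpa only [← hf₁.eq_rayleigh, ← hf₂.eq_rayleigh] using hc
  · rintro ⟨⟨f₁, f₂⟩, -, h₁, h₂, hc⟩
    exact ⟨_, f₁, _, f₂, h₁, h₂, hc⟩

end Topology

end Spectral

/-! ### Geometry of the positive sector -/

section Geometry

variable {N : ℕ}

theorem rho_le_iff {x y : Conf N} {r : ℕ} : rho x y ≤ r ↔ ∀ j, (x.1 j - y.1 j).natAbs ≤ r := by
  simp [rho, Finset.sup_le_iff]

theorem natAbs_le_rho (x y : Conf N) (j : Fin N) : (x.1 j - y.1 j).natAbs ≤ rho x y :=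
  rho_le_iff.1 le_rfl j

theorem lt_rho_iff {x y : Conf N} {r : ℕ} : r < rho x y ↔ ∃ j, r < (x.1 j - y.1 j).natAbs := by
  rw [← not_le, rho_le_iff]; push Not; rfl

theorem rho_self (x : Conf N) : rho x x = 0 := by
  rw [← Nat.le_zero, rho_le_iff]; simp

theorem rho_comm (x y : Conf N) : rho x y = rho y x := by
  unfold rho
  congr 1
  funext j
  omega

theorem rho_triangle (x y z : Conf N) : rho x z ≤ rho x y + rho y z := by
  rw [rho_le_iff]
  intro j
  have h1 := natAbs_le_rho x y j
  have h2 := natAbs_le_rho y z j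
  omega

theorem mem_ball {u y : Conf N} {L : ℕ} : y ∈ ball u L ↔ rho u y ≤ L := by
  simp [ball]

theorem mem_ball_iff {u y : Conf N} {L : ℕ} :
    y ∈ ball u L ↔ ∀ j, (u.1 j - y.1 j).natAbs ≤ L := by
  rw [mem_ball, rho_le_iff]

theorem card_ball_le (u : Conf N) (L : ℕ) : (ball u L).card ≤ (2 * L + 1) ^ N := by
  have h := Finset.card_le_card_of_injOn (s := ball u L)
    (t := Fintype.piFinset fun j : Fin N => Finset.Icc (u.1 j - L) (u.1 j + L))
    (fun y => y.1) (fun y hy => by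
      rw [Finset.mem_coe, mem_ball_iff] at hy
      simp only [Finset.mem_coe, Fintype.mem_piFinset, Finset.mem_Icc]
      intro j
      have := hy j
      omega) (fun a _ b _ h => Subtype.ext h)
  refine h.trans (le_of_eq ?_)
  rw [Fintype.card_piFinset]
  have : ∀ j : Fin N, (Finset.Icc (u.1 j - L) (u.1 j + L)).card = 2 * L + 1 := by
    intro j; rw [Int.card_Icc]; omega
  simp [this]

theorem rho_le_one_of_adj {x y : Conf N} (h : (confGraph N).Adj x y) : rho x y ≤ 1 := by
  have h' : ∑ j, |x.1 j - y.1 j| = 1 := h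
  rw [rho_le_iff]
  intro j
  have h1 := Finset.single_le_sum (f := fun j => |x.1 j - y.1 j|)
    (fun i _ => abs_nonneg _) (Finset.mem_univ j)
  rw [h', Int.abs_eq_natAbs] at h1
  omega

/-- The configuration obtained from `w` by projecting every coordinate to the interval
`[u_j - r, u_j + r]`. -/
def clamp (u : Conf N) (r : ℕ) (w : Conf N) : Conf N :=
  ⟨fun j => max (u.1 j - r) (min (w.1 j) (u.1 j + r)), fun i j hij => by
    have h1 := u.2 hij
    have h2 := w.2 hij
    dsimp only
    omega⟩

theorem clamp_apply (u : Conf N) (r : ℕ) (w : Conf N) (j : Fin N) :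
    (clamp u r w).1 j = max (u.1 j - r) (min (w.1 j) (u.1 j + r)) := rfl

theorem clamp_mem_ball (u : Conf N) (r : ℕ) (w : Conf N) : clamp u r w ∈ ball u r := by
  rw [mem_ball_iff]
  intro j
  rw [clamp_apply]
  omega

theorem ball_clamp_subset (u : Conf N) {r L : ℕ} (h : r ≤ L) (w : Conf N) :
    ball (clamp u (L - r) w) r ⊆ ball u L := by
  intro y hy
  have hc := mem_ball.1 (clamp_mem_ball u (L - r) w)
  have := rho_triangle u (clamp u (L - r) w) y
  rw [mem_ball] at hy ⊢
  omega

theorem mem_ball_clamp {u w x : Conf N} {r L : ℕ} (h : r ≤ L) (hw : w ∈ ball u L)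
    (hx : x ∈ ball u L) (hwx : rho w x ≤ r) : x ∈ ball (clamp u (L - r) w) r := by
  rw [rho_le_iff] at hwx
  rw [mem_ball_iff] at hw hx ⊢
  intro j
  have h1 := hwx j
  have h2 := hw j
  have h3 := hx j
  rw [clamp_apply]
  omega

/-- Points of the large ball outside of the small ball around the clamped centre are far from the
original point. -/
theorem lt_rho_of_notMem_ball_clamp {u w z : Conf N} {r L : ℕ} (h : r ≤ L)
    (hw : w ∈ ball u L) (hz : z ∈ ball u L) (hzc : z ∉ ball (clamp u (L - r) w) r) :
    r < rho w z := by
  rw [mem_ball, not_le, lt_rho_iff] at hzc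
  obtain ⟨j, hj⟩ := hzc
  rw [mem_ball_iff] at hw hz
  refine lt_rho_iff.2 ⟨j, ?_⟩
  have h2 := hw j
  have h3 := hz j
  rw [clamp_apply] at hj
  omega

/-- A configuration is tight, with gap `G`, if consecutive particles are at distance at most
`G`. -/
def Tight (G : ℕ) (c : Conf N) : Prop :=
  ∀ i j : Fin N, (j : ℕ) = i + 1 → c.1 i - c.1 j ≤ G

theorem Tight.diam {G : ℕ} {c : Conf N} (hc : Tight G c) (i j : Fin N) :
    c.1 i - c.1 j ≤ N * G := by
  have key : ∀ d : ℕ, ∀ i j : Fin N, (j : ℕ) = i + d → c.1 i - c.1 j ≤ d * G := by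
    intro d
    induction d with
    | zero => intro i j h; have : i = j := Fin.ext (by omega); subst this; simp
    | succ d ih =>
      intro i j h
      have h1 := ih i ⟨i + d, by omega⟩ rfl
      have h2 := hc ⟨i + d, by omega⟩ j (by simp only; omega)
      push_cast
      linarith
  rcases le_total i j with hij | hij
  · obtain ⟨d, hd⟩ := Nat.exists_eq_add_of_le (show (i : ℕ) ≤ j from hij)
    refine (key d i j hd).trans ?_
    have : (d : ℤ) ≤ N := by have := j.2; omega
    gcongr
  · have : c.1 i ≤ c.1 j := c.2.antitone hij
    have : (0 : ℤ) ≤ N * G := by positivity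
    linarith

theorem not_tight {G : ℕ} {c : Conf N} (hc : ¬ Tight G c) :
    ∃ a b : ℕ, 0 < a ∧ 0 < b ∧ N = a + b ∧
      ∀ i j : Fin N, (i : ℕ) < a → a ≤ j → (G : ℤ) < c.1 i - c.1 j := by
  unfold Tight at hc
  push Not at hc
  obtain ⟨i, j, hij, hg⟩ := hc
  refine ⟨j, N - j, by omega, by omega, by omega, fun i' j' hi hj => ?_⟩
  have h1 : c.1 i ≤ c.1 i' := c.2.antitone (show (i' : ℕ) ≤ i by omega)
  have h2 : c.1 j' ≤ c.1 j := c.2.antitone (show (j : ℕ) ≤ j' from hj)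
  linarith

/-- The sites visited by the configurations of a ball. -/
def sites (c : Conf N) (r : ℕ) : Set ℤ := {z | ∃ x ∈ ball c r, ∃ i, x.1 i = z}

theorem dist_sites {G r l D : ℕ} {c₁ c₂ : Conf N} (h₁ : Tight G c₁) (h₂ : Tight G c₂)
    (hD : 2 * (N * G) + 2 * r + l ≤ D) (hfar : D < rho c₁ c₂) :
    ∀ a ∈ sites c₁ r, ∀ b ∈ sites c₂ r, (l : ℤ) ≤ |a - b| := by
  rintro a ⟨x, hx, i, rfl⟩ b ⟨y, hy, i', rfl⟩
  obtain ⟨j, hj⟩ := lt_rho_iff.1 hfar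
  rw [mem_ball_iff] at hx hy
  have hx := hx i
  have hy := hy i'
  have e1 := h₁.diam i j
  have e2 := h₁.diam j i
  have e3 := h₂.diam i' j
  have e4 := h₂.diam j i'
  rw [Int.abs_eq_natAbs]
  have hD' : 2 * ((N : ℤ) * G) + 2 * r + l ≤ D := by exact_mod_cast hD
  generalize (N : ℤ) * G = M at *
  omega

/-- Pigeonhole: an interval of length exceeding `2 r n` contains a threshold at distance `r` from
all of `n` given points. -/
theorem exists_threshold {ι : Type*} [Fintype ι] (q : ι → ℤ) (r : ℕ) {a b : ℤ}
    (hab : (Fintype.card ι : ℤ) * (2 * r) < b - a) :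
    ∃ t, a < t ∧ t ≤ b ∧ ∀ i, t + r ≤ q i ∨ q i < t - r := by
  classical
  set bad := Finset.univ.biUnion fun i => Finset.Ioc (q i - r) (q i + r) with hbad
  have hcard : bad.card < (Finset.Ioc a b).card := by
    have : bad.card ≤ Fintype.card ι * (2 * r) := by
      refine Finset.card_biUnion_le_card_mul _ _ _ fun i _ => ?_
      rw [Int.card_Ioc]; omega
    rw [Int.card_Ioc]
    have h2 : ((Fintype.card ι * (2 * r) : ℕ) : ℤ) < b - a := by push_cast; exact hab
    omega
  obtain ⟨t, ht, htb⟩ := Finset.exists_mem_notMem_of_card_lt_card hcard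
  rw [Finset.mem_Ioc] at ht
  refine ⟨t, ht.1, ht.2, fun i => ?_⟩
  by_contra! hcon
  refine htb (Finset.mem_biUnion.2 ⟨i, Finset.mem_univ _, Finset.mem_Ioc.2 ⟨?_, ?_⟩⟩) <;> omega

/-- The number of particles of a configuration in an interval. -/
def occupation (a b : ℤ) (x : Conf N) : ℕ :=
  (Finset.univ.filter fun j => x.1 j ∈ Finset.Icc a b).card

theorem exists_interval_of_lt {u c₁ c₂ : Conf N} {L r : ℕ} (h₁ : c₁ ∈ ball u L)
    (h₂ : c₂ ∈ ball u L) {j : Fin N} (hj : ((4 * N * r : ℕ) : ℤ) < c₁.1 j - c₂.1 j) :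
    ∃ (a b : ℤ) (n₁ n₂ : ℕ), a ≤ b ∧ b - a ≤ ((2 * N * (L + r) : ℕ) : ℤ) ∧ n₂ < n₁ ∧
      (∀ x ∈ ball c₁ r, occupation a b x = n₁) ∧ ∀ x ∈ ball c₂ r, occupation a b x = n₂ := by
  -- The lower end `t` lies between the `j`-th particles of `c₁` and `c₂`, and no particle of a
  -- configuration from the two balls crosses it.
  obtain ⟨t, ht1, ht2, ht⟩ := exists_threshold (Sum.elim c₁.1 c₂.1) r (a := c₂.1 j)
    (b := c₁.1 j) (by simp only [Fintype.card_sum, Fintype.card_fin]; push_cast at hj ⊢; linarith)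
  have htc1 := fun i => ht (Sum.inl i)
  have htc2 := fun i => ht (Sum.inr i)
  simp only [Sum.elim_inl, Sum.elim_inr] at htc1 htc2
  -- The upper end `T` is not crossed by any particle of a configuration at distance at most `L + r`
  -- from `u`, so the same particles of `c₁` and `c₂` are above it.
  obtain ⟨T, hT1, hT2, hT⟩ := exists_threshold u.1 (L + r) (a := t)
    (b := t + ((2 * N * (L + r) : ℕ) : ℤ) + 1)
    (by simp only [Fintype.card_fin]; push_cast; linarith)
  rw [mem_ball_iff] at h₁ h₂
  have hocc : ∀ c : Conf N, (∀ i, (u.1 i - c.1 i).natAbs ≤ L) →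
      (∀ i, t + r ≤ c.1 i ∨ c.1 i < t - r) → ∀ x ∈ ball c r,
      occupation t (T - 1) x = occupation t (T - 1) c := by
    intro c hc htc x hx
    unfold occupation
    congr 1
    ext i
    rw [mem_ball_iff] at hx
    have e1 := hx i
    have e2 := hc i
    have e3 := htc i
    have e4 := hT i
    simp only [Finset.mem_filter, Finset.mem_univ, true_and, Finset.mem_Icc]
    push_cast at e4
    omega
  refine ⟨t, T - 1, _, _, by omega, by omega, ?_, hocc c₁ h₁ htc1, hocc c₂ h₂ htc2⟩
  refine Finset.card_lt_card (Finset.ssubset_iff_of_subset ?_ |>.2 ⟨j, ?_, ?_⟩)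
  · intro i hi
    simp only [Finset.mem_filter, Finset.mem_univ, true_and, Finset.mem_Icc] at hi ⊢
    have hij : i < j := by
      by_contra! hcon
      have := c₂.2.antitone hcon
      omega
    have e1 := c₁.2.antitone hij.le
    have e2 := hT i
    have e3 := h₁ i
    have e4 := h₂ i
    push_cast at e2
    omega
  · simp only [Finset.mem_filter, Finset.mem_univ, true_and, Finset.mem_Icc]
    have e2 := hT j
    have e3 := h₁ j
    have e4 := h₂ j
    push_cast at e2
    omega
  · simp only [Finset.mem_filter, Finset.mem_univ, true_and, Finset.mem_Icc]
    omega

/-- Weak separation: two sufficiently distant balls in the positive sector are distinguished by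
the number of particles in some interval. This is where the order of the particles is used. -/
theorem exists_interval {u c₁ c₂ : Conf N} {L r : ℕ} (h₁ : c₁ ∈ ball u L)
    (h₂ : c₂ ∈ ball u L) (hfar : 4 * N * r < rho c₁ c₂) :
    ∃ (a b : ℤ) (n₁ n₂ : ℕ), a ≤ b ∧ b - a ≤ ((2 * N * (L + r) : ℕ) : ℤ) ∧ n₁ ≠ n₂ ∧
      (∀ x ∈ ball c₁ r, occupation a b x = n₁) ∧ ∀ x ∈ ball c₂ r, occupation a b x = n₂ := by
  obtain ⟨j, hj⟩ := lt_rho_iff.1 hfar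
  rcases le_total (c₂.1 j) (c₁.1 j) with h | h
  · obtain ⟨a, b, n₁, n₂, hab, hR, hn, e₁, e₂⟩ := exists_interval_of_lt h₁ h₂
      (show ((4 * N * r : ℕ) : ℤ) < c₁.1 j - c₂.1 j by
        generalize 4 * N * r = M at *; omega)
    exact ⟨a, b, n₁, n₂, hab, hR, hn.ne', e₁, e₂⟩
  · obtain ⟨a, b, n₁, n₂, hab, hR, hn, e₁, e₂⟩ := exists_interval_of_lt h₂ h₁
      (show ((4 * N * r : ℕ) : ℤ) < c₂.1 j - c₁.1 j by
        generalize 4 * N * r = M at *; omega)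
    exact ⟨a, b, n₂, n₁, hab, hR, hn.ne, e₂, e₁⟩

end Geometry

/-! ### The kernel of the Hamiltonian -/

section Kernel

variable {N : ℕ}

open Classical in
/-- The matrix elements of the Hamiltonian on the whole positive sector. -/
def kern (U : ℕ → ℝ) (g : ℝ) (v : ℤ → ℝ) (x y : Conf N) : ℝ :=
  (if x = y then ((confGraph N).degree x : ℝ) + g * extPotential v x + interaction U x else 0)
    - if (confGraph N).Adj x y then 1 else 0

theorem kern_symm (U : ℕ → ℝ) (g : ℝ) (v : ℤ → ℝ) (x y : Conf N) :
    kern U g v x y = kern U g v y x := by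
  unfold kern
  rw [(confGraph N).adj_comm x y]
  by_cases h : x = y
  · subst h; rfl
  · rw [if_neg h, if_neg (Ne.symm h)]

theorem kern_of_ne (U : ℕ → ℝ) (g : ℝ) (v : ℤ → ℝ) {x y : Conf N} (h : x ≠ y)
    (h0 : kern U g v x y ≠ 0) : (confGraph N).Adj x y ∧ |kern U g v x y| = 1 := by
  unfold kern at h0 ⊢
  rw [if_neg h] at h0 ⊢
  by_cases ha : (confGraph N).Adj x y
  · simp [ha]
  · simp [ha] at h0

theorem hamiltonian_apply (U : ℕ → ℝ) (g : ℝ) (v : ℤ → ℝ) (Λ : Finset (Conf N)) (x y : Λ) :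
    hamiltonian U g v Λ x y = (kern U g v x.1 y.1 : ℂ) := by
  unfold hamiltonian kern
  by_cases h : x = y
  · subst h; push_cast; simp
  · have h' : x.1 ≠ y.1 := fun e => h (Subtype.ext e)
    rw [if_neg h, if_neg h']
    push_cast
    split_ifs <;> simp

theorem exponent_eq : (1 + varrho) / alpha = 7 / 8 := by
  norm_num [varrho, alpha]

theorem isLocalized_iff {U : ℕ → ℝ} {g : ℝ} {v : ℤ → ℝ} {m : ℝ} {u : Conf N} {L : ℕ} :
    IsLocalized U g v m u L ↔ ∀ E f, UnitEig (kern U g v) (ball u L) E f →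
      ∀ x ∈ ball u L, ∀ y ∈ ball u L, (L : ℝ) ^ (7 / 8 : ℝ) ≤ (rho x y : ℝ) →
        ‖f x * f y‖ ≤ Real.exp (-(gammaExp m L * (rho x y : ℝ))) := by
  classical
  unfold IsLocalized
  rw [exponent_eq]
  have hmul : ∀ (f : ball u L → ℂ) (x : ball u L), (hamiltonian U g v (ball u L)).mulVec f x
      = ∑ y : ball u L, (kern U g v x.1 y.1 : ℂ) * f y := by
    intro f x
    simp only [Matrix.mulVec, dotProduct, hamiltonian_apply]
  constructor
  · intro h E f hf x hx y hy hxy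
    set ψ : EuclideanSpace ℂ (ball u L) := WithLp.toLp 2 fun x => f x.1 with hψ
    have hn : ‖ψ‖ = 1 := by
      rw [← sq_eq_sq₀ (norm_nonneg _) zero_le_one, EuclideanSpace.norm_sq_eq, one_pow]
      rw [← hf.unit, ← Finset.sum_coe_sort (ball u L)]
    refine h E ψ hn ?_ ⟨x, hx⟩ ⟨y, hy⟩ hxy
    rw [Module.End.hasEigenvector_iff, Module.End.mem_eigenspace_iff]
    refine ⟨?_, fun h0 => by rw [h0, norm_zero] at hn; exact zero_ne_one hn⟩
    ext z
    have := hf.eig z.1 z.2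
    rw [← Finset.sum_coe_sort (ball u L)] at this
    change (hamiltonian U g v (ball u L)).mulVec ψ.ofLp z = (E : ℂ) * ψ.ofLp z
    rw [hmul]
    exact this
  · intro h E ψ hn hψ x y hxy
    have hcg : ∀ z : ball u L,
        (if hz : z.1 ∈ ball u L then ψ.ofLp ⟨z.1, hz⟩ else 0) = ψ.ofLp z := by
      intro z; simp
    have := h E (fun z => if hz : z ∈ ball u L then ψ.ofLp ⟨z, hz⟩ else 0) ⟨?_, ?_⟩
      x.1 x.2 y.1 y.2 hxy
    · simpa only [hcg] using this
    · rw [← Finset.sum_coe_sort (ball u L)]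
      simp only [hcg]
      rw [← EuclideanSpace.norm_sq_eq, hn, one_pow]
    · intro z hz
      rw [← Finset.sum_coe_sort (ball u L)]
      simp only [hcg]
      rw [Module.End.hasEigenvector_iff, Module.End.mem_eigenspace_iff] at hψ
      have h2 := congrArg (fun f : EuclideanSpace ℂ (ball u L) => f.ofLp ⟨z, hz⟩) hψ.1
      change (hamiltonian U g v (ball u L)).mulVec ψ.ofLp ⟨z, hz⟩
        = (E : ℂ) * ψ.ofLp ⟨z, hz⟩ at h2
      rw [hmul] at h2
      rw [h2]
      simp [hz]

theorem continuous_kern (U : ℕ → ℝ) (g : ℝ) (x y : Conf N) :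
    Continuous fun v : ℤ → ℝ => kern U g v x y := by
  unfold kern extPotential
  refine Continuous.sub ?_ continuous_const
  split_ifs
  · fun_prop
  · exact continuous_const

theorem kern_congr (U : ℕ → ℝ) (g : ℝ) {v v' : ℤ → ℝ} {x : Conf N} (y : Conf N)
    (h : ∀ i, v (x.1 i) = v' (x.1 i)) : kern U g v x y = kern U g v' x y := by
  have : extPotential v x = extPotential v' x := Finset.sum_congr rfl fun i _ => h i
  unfold kern
  rw [this]

/-- The eigenfunctions form an orthonormal basis of the functions on `Λ`, and each of them decays
with rate `γ` at distances not smaller than `t`. Unlike `IsLocalized`, this is not affected by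
degeneracies of the spectrum. -/
def DecayBasis (h : Conf N → Conf N → ℝ) (Λ : Finset (Conf N)) (γ t : ℝ) : Prop :=
  ∃ (ι : Type) (_ : Fintype ι) (φ : ι → Conf N → ℂ) (lam : ι → ℝ), EigBasis h Λ φ lam ∧
    ∀ a, ∀ x ∈ Λ, ∀ y ∈ Λ, t ≤ (rho x y : ℝ) →
      ‖φ a x * φ a y‖ ≤ Real.exp (-(γ * (rho x y : ℝ)))

theorem IsLocalized.decayBasis {U : ℕ → ℝ} {g : ℝ} {v : ℤ → ℝ} {m : ℝ} {u : Conf N} {L : ℕ}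
    (h : IsLocalized U g v m u L) :
    DecayBasis (kern U g v) (ball u L) (gammaExp m L) ((L : ℝ) ^ (7 / 8 : ℝ)) := by
  obtain ⟨φ, lam, hb⟩ := exists_eigBasis (kern_symm U g v) (ball u L)
  exact ⟨_, _, φ, lam, hb, fun a => isLocalized_iff.1 h _ _ (hb.eig a)⟩

end Kernel

/-! ### Decomposition of non-tight balls into non-interacting clusters -/

section Product

variable {a b : ℕ}

/-- The first `a` particles of a configuration of `a + b` particles. -/
def left (c : Conf (a + b)) : Conf a :=
  ⟨fun i => c.1 (Fin.castAdd b i), fun _ _ h => c.2 h⟩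

/-- The last `b` particles of a configuration of `a + b` particles. -/
def right (c : Conf (a + b)) : Conf b :=
  ⟨fun j => c.1 (Fin.natAdd a j), fun _ _ h => c.2 ((Fin.natAdd_lt_natAdd_iff a).2 h)⟩

theorem left_apply (c : Conf (a + b)) (i : Fin a) : (left c).1 i = c.1 (Fin.castAdd b i) := rfl

theorem right_apply (c : Conf (a + b)) (j : Fin b) : (right c).1 j = c.1 (Fin.natAdd a j) := rfl

theorem eq_iff_left_right {x y : Conf (a + b)} : x = y ↔ left x = left y ∧ right x = right y := by
  constructor
  · rintro rfl; exact ⟨rfl, rfl⟩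
  · rintro ⟨h1, h2⟩
    apply Subtype.ext
    funext i
    refine Fin.addCases (fun i => ?_) (fun j => ?_) i
    · exact congrFun (congrArg Subtype.val h1) i
    · exact congrFun (congrArg Subtype.val h2) j

theorem rho_eq_max (x y : Conf (a + b)) :
    rho x y = max (rho (left x) (left y)) (rho (right x) (right y)) := by
  apply le_antisymm
  · rw [rho_le_iff]
    intro i
    refine Fin.addCases (fun i => ?_) (fun j => ?_) i
    · exact le_max_of_le_left (natAbs_le_rho (left x) (left y) i)
    · exact le_max_of_le_right (natAbs_le_rho (right x) (right y) j)
  · refine max_le (rho_le_iff.2 fun i => ?_) (rho_le_iff.2 fun j => ?_)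
    · exact natAbs_le_rho x y (Fin.castAdd b i)
    · exact natAbs_le_rho x y (Fin.natAdd a j)

theorem mem_ball_iff_left_right {c x : Conf (a + b)} {r : ℕ} :
    x ∈ ball c r ↔ left x ∈ ball (left c) r ∧ right x ∈ ball (right c) r := by
  simp only [mem_ball, rho_eq_max, max_le_iff]

theorem adj_iff_left_right {x y : Conf (a + b)} : (confGraph (a + b)).Adj x y ↔
    ((confGraph a).Adj (left x) (left y) ∧ right x = right y) ∨
      (left x = left y ∧ (confGraph b).Adj (right x) (right y)) := by
  have hzero : ∀ {n : ℕ} (p q : Conf n), ∑ j, |p.1 j - q.1 j| = 0 ↔ p = q := by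
    intro n p q
    rw [Finset.sum_eq_zero_iff_of_nonneg fun _ _ => abs_nonneg _]
    constructor
    · intro h
      exact Subtype.ext (funext fun j => sub_eq_zero.1 (abs_eq_zero.1 (h j (Finset.mem_univ j))))
    · rintro rfl; simp
  rw [← hzero (right x), ← hzero (left x)]
  change ∑ j, |x.1 j - y.1 j| = 1 ↔ (∑ j, |(left x).1 j - (left y).1 j| = 1 ∧ _) ∨
    (_ ∧ ∑ j, |(right x).1 j - (right y).1 j| = 1)
  rw [Fin.sum_univ_add]
  simp only [left_apply, right_apply]
  have h1 : 0 ≤ ∑ j : Fin a, |x.1 (Fin.castAdd b j) - y.1 (Fin.castAdd b j)| :=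
    Finset.sum_nonneg fun _ _ => abs_nonneg _
  have h2 : 0 ≤ ∑ j : Fin b, |x.1 (Fin.natAdd a j) - y.1 (Fin.natAdd a j)| :=
    Finset.sum_nonneg fun _ _ => abs_nonneg _
  omega

/-- The first `a` particles are to the right of the last `b` particles, and the distance between
the two clusters exceeds `G`. -/
def Gapped (G : ℕ) (c : Conf (a + b)) : Prop :=
  ∀ (i : Fin a) (j : Fin b), (G : ℤ) < (left c).1 i - (right c).1 j

theorem Gapped.of_mem_ball {G r : ℕ} {c x : Conf (a + b)} (h : Gapped (G + 2 * r) c)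
    (hx : x ∈ ball c r) : Gapped G x := by
  intro i j
  rw [mem_ball_iff_left_right, mem_ball_iff, mem_ball_iff] at hx
  have h1 := hx.1 i
  have h2 := hx.2 j
  have h3 := h i j
  omega

theorem Gapped.mono {G G' : ℕ} (hG : G ≤ G') {c : Conf (a + b)} (h : Gapped G' c) :
    Gapped G c := by
  intro i j
  have := h i j
  omega

/-- A ball around a gapped configuration is a product of two balls. -/
theorem Gapped.sum_ball {M : Type*} [AddCommMonoid M] {c : Conf (a + b)} {r : ℕ}
    (h : Gapped (2 * r) c) (F : Conf a → Conf b → M) :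
    ∑ y ∈ ball c r, F (left y) (right y)
      = ∑ y ∈ ball (left c) r, ∑ z ∈ ball (right c) r, F y z := by
  rw [← Finset.sum_product']
  refine Finset.sum_nbij (fun y => (left y, right y)) ?_ ?_ ?_ fun _ _ => rfl
  · intro y hy
    rw [Finset.mem_product]
    exact mem_ball_iff_left_right.1 hy
  · intro y _ z _ hyz
    rw [Prod.mk.injEq] at hyz
    exact eq_iff_left_right.2 hyz
  · rintro ⟨y, z⟩ hyz
    rw [Finset.mem_coe, Finset.mem_product] at hyz
    obtain ⟨hy, hz⟩ := hyz
    have hanti : StrictAnti (Fin.append y.1 z.1) := by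
      intro i j
      refine Fin.addCases (fun i => ?_) (fun i => ?_) i <;>
        refine Fin.addCases (fun j => ?_) (fun j => ?_) j <;> intro hij
      · rw [Fin.append_left, Fin.append_left]
        exact y.2 hij
      · rw [Fin.append_left, Fin.append_right]
        have h1 := mem_ball_iff.1 hy i
        have h2 := mem_ball_iff.1 hz j
        have h3 := h i j
        push_cast at h3
        dsimp only at h1 h2
        omega
      · exfalso
        rw [Fin.lt_def] at hij
        simp at hij
        omega
      · rw [Fin.append_right, Fin.append_right]
        exact z.2 ((Fin.natAdd_lt_natAdd_iff a).1 hij)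
    obtain ⟨w, hw⟩ : ∃ w : Conf (a + b), w.1 = Fin.append y.1 z.1 := ⟨⟨_, hanti⟩, rfl⟩
    have hl : left w = y := by
      apply Subtype.ext; funext i; rw [left_apply, hw]; exact Fin.append_left _ _ i
    have hr : right w = z := by
      apply Subtype.ext; funext i; rw [right_apply, hw]; exact Fin.append_right _ _ i
    refine ⟨w, ?_, ?_⟩
    · rw [Finset.mem_coe, mem_ball_iff_left_right, hl, hr]
      exact ⟨hy, hz⟩
    · simp only [hl, hr]

open Classical in
theorem degree_eq_sum {n : ℕ} (x : Conf n) :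
    (confGraph n).degree x = ∑ y ∈ ball x 1, if (confGraph n).Adj x y then 1 else 0 := by
  rw [← SimpleGraph.card_neighborFinset_eq_degree, ← Finset.card_filter]
  congr 1
  ext y
  simp only [SimpleGraph.mem_neighborFinset, Finset.mem_filter, mem_ball]
  exact ⟨fun h => ⟨rho_le_one_of_adj h, h⟩, fun h => h.2⟩

open Classical in
theorem adj_indicator {M : Type*} [AddMonoidWithOne M] (x y : Conf (a + b)) :
    (if (confGraph (a + b)).Adj x y then (1 : M) else 0)
      = (if (confGraph a).Adj (left x) (left y) then (if right x = right y then 1 else 0) else 0)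
        + if left x = left y then (if (confGraph b).Adj (right x) (right y) then 1 else 0)
          else 0 := by
  rw [if_congr adj_iff_left_right rfl rfl]
  by_cases h1 : left x = left y
  · have h2 : ¬ (confGraph a).Adj (left x) (left y) := by rw [h1]; exact (confGraph a).irrefl
    simp [h1]
  · simp [h1, ite_and]

theorem Gapped.degree {x : Conf (a + b)} (h : Gapped 2 x) :
    (confGraph (a + b)).degree x
      = (confGraph a).degree (left x) + (confGraph b).degree (right x) := by
  classical
  rw [degree_eq_sum, Finset.sum_congr rfl fun y _ => adj_indicator x y,
    (show Gapped (2 * 1) x from h).sum_ball (fun y z =>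
      (if (confGraph a).Adj (left x) y then (if right x = z then 1 else 0) else 0)
        + if left x = y then (if (confGraph b).Adj (right x) z then 1 else 0) else 0)]
  simp_rw [Finset.sum_add_distrib]
  congr 1
  · rw [degree_eq_sum]
    refine Finset.sum_congr rfl fun y _ => ?_
    split_ifs
    · rw [Finset.sum_ite_eq, if_pos (mem_ball.2 (by simp [rho_self]))]
    · simp
  · rw [Finset.sum_comm, degree_eq_sum]
    refine Finset.sum_congr rfl fun y _ => ?_
    rw [Finset.sum_ite_eq, if_pos (mem_ball.2 (by simp [rho_self]))]

theorem extPotential_eq_add (v : ℤ → ℝ) (x : Conf (a + b)) :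
    extPotential v x = extPotential v (left x) + extPotential v (right x) := by
  unfold extPotential
  rw [Fin.sum_univ_add]
  rfl

theorem Gapped.interaction {U : ℕ → ℝ} {r₀ : ℕ} (hU : ∀ r, r₀ ≤ r → U r = 0)
    {x : Conf (a + b)} (h : Gapped r₀ x) :
    interaction U x = interaction U (left x) + interaction U (right x) := by
  unfold FermionLoc.interaction
  rw [Fin.sum_univ_add]
  congr 1
  · refine Finset.sum_congr rfl fun i _ => ?_
    rw [Fin.sum_univ_add]
    have : ∀ j : Fin b, (if Fin.castAdd b i ≠ Fin.natAdd a j then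
        U (x.1 (Fin.castAdd b i) - x.1 (Fin.natAdd a j)).natAbs else 0) = 0 := by
      intro j
      have h1 := h i j
      rw [left_apply, right_apply] at h1
      rw [hU _ (by omega), ite_self]
    rw [Finset.sum_congr rfl fun j _ => this j, Finset.sum_const_zero, add_zero]
    refine Finset.sum_congr rfl fun j _ => ?_
    simp [left_apply]
  · refine Finset.sum_congr rfl fun i _ => ?_
    rw [Fin.sum_univ_add]
    have : ∀ j : Fin a, (if Fin.natAdd a i ≠ Fin.castAdd b j then
        U (x.1 (Fin.natAdd a i) - x.1 (Fin.castAdd b j)).natAbs else 0) = 0 := by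
      intro j
      have h1 := h j i
      rw [left_apply, right_apply] at h1
      rw [hU _ (by omega), ite_self]
    rw [Finset.sum_congr rfl fun j _ => this j, Finset.sum_const_zero, zero_add]
    refine Finset.sum_congr rfl fun j _ => ?_
    simp [right_apply]

open Classical in
/-- For distant clusters `H = H' ⊗ 1 + 1 ⊗ H''`. -/
theorem Gapped.kern {U : ℕ → ℝ} {r₀ : ℕ} (hU : ∀ r, r₀ ≤ r → U r = 0) (g : ℝ) (v : ℤ → ℝ)
    {x : Conf (a + b)} (h₁ : Gapped r₀ x) (h₂ : Gapped 2 x) (y : Conf (a + b)) :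
    kern U g v x y = (if right x = right y then kern U g v (left x) (left y) else 0)
      + if left x = left y then kern U g v (right x) (right y) else 0 := by
  unfold FermionLoc.kern
  rw [adj_indicator, if_congr eq_iff_left_right rfl rfl, h₂.degree, extPotential_eq_add,
    h₁.interaction hU]
  push_cast
  by_cases e1 : left x = left y <;> by_cases e2 : right x = right y
  · have n1 : ¬ (confGraph a).Adj (left x) (left y) := by rw [e1]; exact (confGraph a).irrefl
    have n2 : ¬ (confGraph b).Adj (right x) (right y) := by rw [e2]; exact (confGraph b).irrefl
    simp only [e1, e2, and_self, if_true, SimpleGraph.irrefl, if_false]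
    ring
  · simp [e1, e2]
  · simp [e1, e2]
  · simp [e1, e2]

/-- Products of decaying eigenbases of the two clusters form a decaying eigenbasis. -/
theorem Gapped.decayBasis {U : ℕ → ℝ} {r₀ : ℕ} (hU : ∀ r, r₀ ≤ r → U r = 0) {g : ℝ} {v : ℤ → ℝ}
    {c : Conf (a + b)} {r : ℕ} (hc : Gapped (r₀ + 2 + 2 * r) c) {γ t : ℝ}
    (h₁ : DecayBasis (FermionLoc.kern U g v) (ball (left c) r) γ t)
    (h₂ : DecayBasis (FermionLoc.kern U g v) (ball (right c) r) γ t) :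
    DecayBasis (FermionLoc.kern U g v) (ball c r) γ t := by
  classical
  obtain ⟨ι₁, _, φ₁, lam₁, hb₁, hd₁⟩ := h₁
  obtain ⟨ι₂, _, φ₂, lam₂, hb₂, hd₂⟩ := h₂
  have hgap : Gapped (2 * r) c := hc.mono (by omega)
  refine ⟨ι₁ × ι₂, inferInstance, fun p x => φ₁ p.1 (left x) * φ₂ p.2 (right x),
    fun p => lam₁ p.1 + lam₂ p.2, ⟨?_, fun p => ⟨?_, fun x hx => ?_⟩, ?_⟩, ?_⟩
  · have h := hgap.sum_ball (fun _ _ => 1)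
    simp only [Finset.sum_const, smul_eq_mul, mul_one] at h
    rw [Fintype.card_prod, hb₁.card, hb₂.card, h]
  · have h := hgap.sum_ball (fun y z => ‖φ₁ p.1 y * φ₂ p.2 z‖ ^ 2)
    rw [h]
    simp only [norm_mul, mul_pow, ← Finset.mul_sum]
    simp only [(hb₂.eig p.2).unit, mul_one, (hb₁.eig p.1).unit]
  · have hx2 := hc.of_mem_ball hx
    have hxl := (mem_ball_iff_left_right.1 hx).1
    have hxr := (mem_ball_iff_left_right.1 hx).2
    simp only [(hx2.mono (show r₀ ≤ r₀ + 2 by omega)).kern hU g v (hx2.mono (by omega))]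
    rw [hgap.sum_ball (fun y z => (((if right x = z then FermionLoc.kern U g v (left x) y else 0)
      + if left x = y then FermionLoc.kern U g v (right x) z else 0 : ℝ) : ℂ)
      * (φ₁ p.1 y * φ₂ p.2 z))]
    have e : ∀ y z, (((if right x = z then FermionLoc.kern U g v (left x) y else 0)
      + if left x = y then FermionLoc.kern U g v (right x) z else 0 : ℝ) : ℂ)
      * (φ₁ p.1 y * φ₂ p.2 z)
      = (if right x = z then (FermionLoc.kern U g v (left x) y : ℂ) * φ₁ p.1 y * φ₂ p.2 z else 0)
      + if left x = y then (FermionLoc.kern U g v (right x) z : ℂ) * φ₂ p.2 z * φ₁ p.1 y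
        else 0 := by
      intro y z
      split_ifs <;> push_cast <;> ring
    simp_rw [e, Finset.sum_add_distrib]
    rw [Finset.sum_comm (s := ball (left c) r) (t := ball (right c) r)
      (f := fun y z => if left x = y then
        (FermionLoc.kern U g v (right x) z : ℂ) * φ₂ p.2 z * φ₁ p.1 y else 0)]
    simp only [Finset.sum_ite_eq, hxl, hxr, if_true]
    rw [← Finset.sum_mul, ← Finset.sum_mul, (hb₁.eig p.1).eig _ hxl, (hb₂.eig p.2).eig _ hxr]
    push_cast
    ring
  · intro x hx y hy
    have hx' := mem_ball_iff_left_right.1 hx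
    have hy' := mem_ball_iff_left_right.1 hy
    rw [Fintype.sum_prod_type]
    have e : ∀ p q, φ₁ p (left x) * φ₂ q (right x) * star (φ₁ p (left y) * φ₂ q (right y))
        = φ₁ p (left x) * star (φ₁ p (left y)) * (φ₂ q (right x) * star (φ₂ q (right y))) := by
      intro p q
      rw [star_mul']; ring
    simp only [e, ← Finset.mul_sum, hb₂.complete _ hx'.2 _ hy'.2, ← Finset.sum_mul,
      hb₁.complete _ hx'.1 _ hy'.1]
    rw [if_congr eq_iff_left_right rfl rfl, ite_and]
    split_ifs <;> simp
  · intro p x hx y hy hxy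
    have hx' := mem_ball_iff_left_right.1 hx
    have hy' := mem_ball_iff_left_right.1 hy
    have e : ‖φ₁ p.1 (left x) * φ₂ p.2 (right x) * (φ₁ p.1 (left y) * φ₂ p.2 (right y))‖
        = ‖φ₁ p.1 (left x) * φ₁ p.1 (left y)‖ * ‖φ₂ p.2 (right x) * φ₂ p.2 (right y)‖ := by
      rw [← norm_mul]; congr 1; ring
    have n1 : ‖φ₁ p.1 (left x) * φ₁ p.1 (left y)‖ ≤ 1 := by
      rw [norm_mul]
      exact mul_le_one₀ ((hb₁.eig p.1).norm_le_one hx'.1) (norm_nonneg _)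
        ((hb₁.eig p.1).norm_le_one hy'.1)
    have n2 : ‖φ₂ p.2 (right x) * φ₂ p.2 (right y)‖ ≤ 1 := by
      rw [norm_mul]
      exact mul_le_one₀ ((hb₂.eig p.2).norm_le_one hx'.2) (norm_nonneg _)
        ((hb₂.eig p.2).norm_le_one hy'.2)
    rw [e]
    rw [rho_eq_max] at hxy ⊢
    rcases le_total (rho (left x) (left y)) (rho (right x) (right y)) with h | h
    · rw [max_eq_right h] at hxy ⊢
      calc _ ≤ 1 * _ := mul_le_mul n1 (hd₂ p.2 _ hx'.2 _ hy'.2 hxy) (norm_nonneg _) zero_le_one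
        _ = _ := one_mul _
    · rw [max_eq_left h] at hxy ⊢
      calc _ ≤ _ * 1 := mul_le_mul (hd₁ p.1 _ hx'.1 _ hy'.1 hxy) n2 (norm_nonneg _)
            (Real.exp_pos _).le
        _ = _ := mul_one _

end Product

/-! ### Decay of eigenfunctions in the next scale -/

section Deterministic

variable {N : ℕ}

/-- `E` is at distance less than `s` from the spectrum of the ball of radius `r` around `c`. -/
def Resonant (h : Conf N → Conf N → ℝ) (s E : ℝ) (c : Conf N) (r : ℕ) : Prop :=
  ∃ lam f, UnitEig h (ball c r) lam f ∧ |lam - E| < s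

theorem eig_of_subset {h : Conf N → Conf N → ℝ} {Λ B : Finset (Conf N)} {E : ℝ} {ψ : Conf N → ℂ}
    (hψ : UnitEig h B E ψ) (hΛ : Λ ⊆ B) : ∀ x ∈ Λ, ∑ y ∈ B, (h x y : ℂ) * ψ y = E * ψ x :=
  fun x hx => hψ.eig x (hΛ hx)

/-- The bound at a point whose ball has a decaying eigenbasis and is not resonant. The weight `δ`
is a Lipschitz function, and `M` bounds the weighted eigenfunction. -/
theorem weighted_le_of_decayBasis {U : ℕ → ℝ} {g : ℝ} {v : ℤ → ℝ} {u : Conf N} {L l : ℕ}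
    (hlL : l ≤ L) {E s n γ γ' M : ℝ} {ψ : Conf N → ℂ}
    (hψ : UnitEig (kern U g v) (ball u L) E ψ) (hn : ((ball u L).card : ℝ) ≤ n) (hs : 0 < s)
    (hγ' : 0 ≤ γ') (hγ : γ' ≤ γ) {δ : Conf N → ℝ}
    (hδ : ∀ x y, δ x ≤ δ y + rho x y) (hM0 : 0 ≤ M)
    (hM : ∀ z ∈ ball u L, ‖ψ z‖ ≤ M * Real.exp (-(γ' * δ z))) {x : Conf N}
    (hx : x ∈ ball u L)
    (hdec : DecayBasis (kern U g v) (ball (clamp u (L - l) x) l) γ ((l : ℝ) ^ (7 / 8 : ℝ)))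
    (hres : ¬ Resonant (kern U g v) s E (clamp u (L - l) x) l) :
    ‖ψ x‖ ≤ n ^ 3 * s⁻¹ * Real.exp (-((γ - γ') * (l + 1)) + γ)
      * (M * Real.exp (-(γ' * δ x))) := by
  obtain ⟨ι, _, φ, lam, hb, hd⟩ := hdec
  have hΛ := ball_clamp_subset u hlL x
  have hxc : x ∈ ball (clamp u (L - l) x) l :=
    mem_ball_clamp hlL hx hx (by rw [rho_self]; exact Nat.zero_le _)
  rw [mul_assoc]
  refine hb.norm_le (kern_symm U g v) hΛ (eig_of_subset hψ hΛ) hs ?_ hn hxc (by positivity) ?_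
  · intro a
    by_contra! hlt
    exact hres ⟨_, _, hb.eig a, hlt⟩
  · intro a y hy z hz hzn h0
    have hyz : y ≠ z := fun e => hzn (e ▸ hy)
    obtain ⟨hadj, h1⟩ := kern_of_ne U g v hyz h0
    have hxz : l < rho x z := lt_rho_of_notMem_ball_clamp hlL hx hz hzn
    have hyz1 := rho_le_one_of_adj hadj
    have htri := rho_triangle x y z
    have hly : l ≤ rho x y := by omega
    have hpow : (l : ℝ) ^ (7 / 8 : ℝ) ≤ (rho x y : ℝ) := by
      rcases Nat.eq_zero_or_pos l with h | h
      · rw [h, Nat.cast_zero, Real.zero_rpow (by norm_num)]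
        positivity
      · calc (l : ℝ) ^ (7 / 8 : ℝ) ≤ (l : ℝ) ^ (1 : ℝ) :=
              Real.rpow_le_rpow_of_exponent_le (by exact_mod_cast h) (by norm_num)
          _ = l := Real.rpow_one _
          _ ≤ _ := by exact_mod_cast hly
    rw [h1, one_mul]
    refine (mul_le_mul (hd a x hxc y hy hpow) (hM z hz) (norm_nonneg _)
      (Real.exp_pos _).le).trans ?_
    rw [mul_left_comm, mul_left_comm _ M, ← Real.exp_add, ← Real.exp_add]
    refine mul_le_mul_of_nonneg_left (Real.exp_le_exp.2 ?_) hM0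
    have c1 : (rho x z : ℝ) ≤ rho x y + 1 := by exact_mod_cast (by omega : rho x z ≤ rho x y + 1)
    have c2 : (l : ℝ) + 1 ≤ rho x z := by exact_mod_cast hxz
    have c3 := hδ x z
    have d1 : γ * rho x z ≤ γ * (rho x y + 1) := mul_le_mul_of_nonneg_left c1 (hγ'.trans hγ)
    have d2 : (γ - γ') * (l + 1) ≤ (γ - γ') * rho x z :=
      mul_le_mul_of_nonneg_left c2 (by linarith)
    have d3 : γ' * δ x ≤ γ' * (δ z + rho x z) := mul_le_mul_of_nonneg_left c3 hγ'
    nlinarith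

/-- A distance to `w'` in which the ball of radius `R` around `w` is collapsed to a point. -/
def collapsedDist (w w' : Conf N) (R : ℕ) (x : Conf N) : ℝ :=
  min (rho x w' : ℝ) (max ((rho x w : ℝ) - R) 0 + max ((rho w w' : ℝ) - R) 0)

section Collapsed

variable (w w' : Conf N) (R : ℕ)

theorem rho_triangle_real (x y z : Conf N) : (rho x z : ℝ) ≤ rho x y + rho y z := by
  exact_mod_cast rho_triangle x y z

theorem collapsedDist_lipschitz (x y : Conf N) :
    collapsedDist w w' R x ≤ collapsedDist w w' R y + rho x y := by
  unfold collapsedDist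
  rw [← min_add_add_right]
  have h0 : (0 : ℝ) ≤ rho x y := Nat.cast_nonneg _
  refine min_le_min ?_ ?_
  · linarith [rho_triangle_real x y w']
  · have : max ((rho x w : ℝ) - R) 0 ≤ max ((rho y w : ℝ) - R) 0 + rho x y := by
      refine max_le ?_ ?_
      · linarith [rho_triangle_real x y w, le_max_left ((rho y w : ℝ) - R) 0]
      · linarith [le_max_right ((rho y w : ℝ) - R) 0]
    linarith

theorem collapsedDist_le (x : Conf N) : collapsedDist w w' R x ≤ rho x w' := min_le_left _ _

theorem le_collapsedDist (x : Conf N) : (rho x w' : ℝ) - 2 * R ≤ collapsedDist w w' R x := by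
  refine le_min ?_ ?_
  · have : (0 : ℝ) ≤ R := Nat.cast_nonneg _
    linarith
  · linarith [le_max_left ((rho x w : ℝ) - R) 0, le_max_left ((rho w w' : ℝ) - R) 0,
      rho_triangle_real x w w']

theorem collapsedDist_eq {x : Conf N} (hx : rho x w ≤ R) :
    collapsedDist w w' R x = max ((rho w w' : ℝ) - R) 0 := by
  have hx' : (rho x w : ℝ) ≤ R := by exact_mod_cast hx
  unfold collapsedDist
  rw [max_eq_right (by linarith : (rho x w : ℝ) - R ≤ 0), zero_add]
  refine min_eq_right (max_le ?_ (Nat.cast_nonneg _))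
  have := rho_triangle_real w x w'
  rw [rho_comm w x] at this
  linarith

end Collapsed

/-- Decay of an eigenfunction from the resonant region. All points whose balls have no decaying
eigenbasis lie within distance `q` of `w`, and the resonant centres lie within distance `d` of
`w'`. The proof is a maximum principle for the eigenfunction with the weight `exp (γ' δ)`, where
`δ` is the distance to `w'` with a neighbourhood of `w` collapsed: a maximum can only be attained
close to `w'`. -/
theorem norm_le_exp_of_clusters {U : ℕ → ℝ} {g : ℝ} {v : ℤ → ℝ} {u : Conf N} {L l q d : ℕ}
    (hlL : l ≤ L) (hqL : q ≤ L) {E s n γ γ' : ℝ} {ψ : Conf N → ℂ}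
    (hψ : UnitEig (kern U g v) (ball u L) E ψ) (hn : ((ball u L).card : ℝ) ≤ n) (hn1 : 1 ≤ n)
    (hs : 0 < s) (hs1 : s ≤ 1) (hγ' : 0 ≤ γ') (hγ : γ' ≤ γ)
    (hsmall : (n ^ 3 * s⁻¹) ^ 2 * Real.exp (-((γ - γ') * (l + 1)) + γ) ≤ 1 / 2)
    {w w' : Conf N} (hw : w ∈ ball u L)
    (hsing : ∀ x ∈ ball u L,
      ¬ DecayBasis (kern U g v) (ball (clamp u (L - l) x) l) γ ((l : ℝ) ^ (7 / 8 : ℝ)) →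
        rho w x ≤ q)
    (hres : ∀ x ∈ ball u L, Resonant (kern U g v) s E (clamp u (L - l) x) l → rho x w' ≤ d)
    (hresw : Resonant (kern U g v) s E (clamp u (L - q) w) q → rho w w' ≤ d) :
    ∀ x ∈ ball u L, ‖ψ x‖ ≤ Real.exp (-(γ' * ((rho x w' : ℝ) - (d + 6 * q + 3)))) := by
  set B := ball u L with hB
  set R := 2 * q + 1 with hR
  set δ := collapsedDist w w' R with hδdef
  have hδ := collapsedDist_lipschitz w w' R
  have hne : B.Nonempty := ⟨w, hw⟩
  obtain ⟨x₀, hx₀, hmax⟩ := B.exists_max_image (fun x => ‖ψ x‖ * Real.exp (γ' * δ x)) hne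
  set M := ‖ψ x₀‖ * Real.exp (γ' * δ x₀) with hMdef
  have hM0 : 0 ≤ M := by positivity
  have hM : ∀ z ∈ B, ‖ψ z‖ ≤ M * Real.exp (-(γ' * δ z)) := by
    intro z hz
    rw [Real.exp_neg, ← div_eq_mul_inv, le_div_iff₀ (Real.exp_pos _)]
    exact hmax z hz
  have hMpos : 0 < M := by
    refine lt_of_le_of_ne hM0 fun h0 => ?_
    have hz : ∀ z ∈ B, ‖ψ z‖ ^ 2 = 0 := by
      intro z hz
      have := hM z hz
      rw [← h0, zero_mul] at this
      rw [le_antisymm this (norm_nonneg _)]; norm_num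
    have := hψ.unit
    rw [Finset.sum_congr rfl hz] at this
    simp at this
  set K := n ^ 3 * s⁻¹ with hK
  set θ := Real.exp (-((γ - γ') * (l + 1)) + γ) with hθ
  have hK1 : 1 ≤ K := by
    have h1 : (1 : ℝ) ≤ n ^ 3 := one_le_pow₀ hn1
    have h2 : 1 ≤ s⁻¹ := (one_le_inv₀ hs).2 hs1
    nlinarith
  have hθ0 : 0 < θ := Real.exp_pos _
  have hgood : ∀ x ∈ B,
      DecayBasis (kern U g v) (ball (clamp u (L - l) x) l) γ ((l : ℝ) ^ (7 / 8 : ℝ)) →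
      d < rho x w' → ‖ψ x‖ ≤ K * θ * (M * Real.exp (-(γ' * δ x))) := by
    intro x hx hdec hfar
    exact weighted_le_of_decayBasis hlL hψ hn hs hγ' hγ hδ hM0 hM hx hdec
      (fun h => absurd (hres x hx h) (not_le.2 hfar))
  -- A point of maximum of the weighted eigenfunction lies close to the resonant region: elsewhere
  -- the maximum would be at most half of itself.
  have hbad : rho x₀ w' ≤ d + 2 * q + 1 := by
    by_contra! hfar
    suffices h : M ≤ 1 / 2 * M by linarith
    suffices h : ‖ψ x₀‖ ≤ 1 / 2 * (M * Real.exp (-(γ' * δ x₀))) by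
      calc M ≤ 1 / 2 * (M * Real.exp (-(γ' * δ x₀))) * Real.exp (γ' * δ x₀) :=
            mul_le_mul_of_nonneg_right h (Real.exp_pos _).le
        _ = 1 / 2 * M * (Real.exp (-(γ' * δ x₀)) * Real.exp (γ' * δ x₀)) := by ring
        _ = 1 / 2 * M := by rw [← Real.exp_add]; simp
    by_cases hdec : DecayBasis (kern U g v) (ball (clamp u (L - l) x₀) l) γ
        ((l : ℝ) ^ (7 / 8 : ℝ))
    · refine (hgood x₀ hx₀ hdec (by omega)).trans (mul_le_mul_of_nonneg_right ?_ (by positivity))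
      nlinarith [mul_pos (zero_lt_one.trans_le hK1) hθ0]
    · -- The ball of `x₀` has no decaying eigenbasis. One exits from a non-resonant ball of radius
      -- `q` around `w` to points `z` where `hgood` applies and the weight is the same as at `x₀`;
      -- this costs the factor `K`, which is why `hsmall` contains `K ^ 2`.
      have hwx := hsing x₀ hx₀ hdec
      have hΛ := ball_clamp_subset u hqL w
      have hxc := mem_ball_clamp hqL hw hx₀ hwx
      obtain ⟨φ, lam, hb⟩ := exists_eigBasis (kern_symm U g v) (ball (clamp u (L - q) w) q)
      have hww : d < rho w w' := by
        have := rho_triangle x₀ w w'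
        rw [rho_comm x₀ w] at this
        omega
      have hwc : w ∈ ball (clamp u (L - q) w) q :=
        mem_ball_clamp hqL hw hw (by rw [rho_self]; exact Nat.zero_le _)
      have hδ₀ : δ x₀ = max ((rho w w' : ℝ) - R) 0 :=
        collapsedDist_eq w w' R (by rw [rho_comm]; omega)
      have := hb.norm_le (kern_symm U g v) hΛ (eig_of_subset hψ hΛ) hs (fun a => ?_) hn hxc
        (T := K * θ * (M * Real.exp (-(γ' * δ x₀)))) (by positivity) (fun a y hy z hz hzn h0 => ?_)
      · refine this.trans ?_
        rw [← hK]
        calc K * (K * θ * (M * Real.exp (-(γ' * δ x₀))))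
            = K ^ 2 * θ * (M * Real.exp (-(γ' * δ x₀))) := by ring
          _ ≤ _ := mul_le_mul_of_nonneg_right hsmall (by positivity)
      · by_contra! hlt
        exact absurd (hresw ⟨_, _, hb.eig a, hlt⟩) (not_le.2 hww)
      · have hyz : y ≠ z := fun e => hzn (e ▸ hy)
        obtain ⟨hadj, h1⟩ := kern_of_ne U g v hyz h0
        have hwz : q < rho w z := lt_rho_of_notMem_ball_clamp hqL hw hz hzn
        have hyz1 := rho_le_one_of_adj hadj
        rw [mem_ball] at hy hxc hwc
        have t1 := rho_triangle (clamp u (L - q) w) y z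
        have t2 := rho_triangle z (clamp u (L - q) w) w
        have t3 := rho_triangle x₀ (clamp u (L - q) w) z
        have t4 := rho_triangle x₀ z w'
        rw [rho_comm z (clamp u (L - q) w)] at t2
        rw [rho_comm x₀ (clamp u (L - q) w)] at t3
        have hδz : δ z = max ((rho w w' : ℝ) - R) 0 := collapsedDist_eq w w' R (by omega)
        have hdecz : DecayBasis (kern U g v) (ball (clamp u (L - l) z) l) γ
            ((l : ℝ) ^ (7 / 8 : ℝ)) := by
          by_contra hcon
          exact absurd (hsing z hz hcon) (not_le.2 hwz)
        have hz' := hgood z hz hdecz (by omega)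
        rw [h1, one_mul, hδ₀, ← hδz]
        have n1 : ‖φ a x₀ * φ a y‖ ≤ 1 := by
          rw [norm_mul]
          exact mul_le_one₀ ((hb.eig a).norm_le_one (mem_ball.2 hxc)) (norm_nonneg _)
            ((hb.eig a).norm_le_one (mem_ball.2 hy))
        calc ‖φ a x₀ * φ a y‖ * ‖ψ z‖ ≤ 1 * ‖ψ z‖ :=
              mul_le_mul_of_nonneg_right n1 (norm_nonneg _)
          _ ≤ _ := by rw [one_mul]; exact hz'
  have hMle : M ≤ Real.exp (γ' * (d + 2 * q + 1)) := by
    have h1 : ‖ψ x₀‖ ≤ 1 := hψ.norm_le_one hx₀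
    have h2 : δ x₀ ≤ (d + 2 * q + 1 : ℝ) :=
      (collapsedDist_le w w' R x₀).trans (by exact_mod_cast hbad)
    calc M ≤ 1 * Real.exp (γ' * (d + 2 * q + 1)) :=
          mul_le_mul h1 (Real.exp_le_exp.2 (mul_le_mul_of_nonneg_left h2 hγ'))
            (Real.exp_pos _).le zero_le_one
      _ = _ := one_mul _
  intro x hx
  refine (hM x hx).trans ((mul_le_mul_of_nonneg_right hMle (Real.exp_pos _).le).trans ?_)
  rw [← Real.exp_add]
  refine Real.exp_le_exp.2 ?_
  have h1 := le_collapsedDist w w' R x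
  have h2 : γ' * ((rho x w' : ℝ) - 2 * R) ≤ γ' * δ x := mul_le_mul_of_nonneg_left h1 hγ'
  have h3 : (R : ℝ) = 2 * q + 1 := by rw [hR]; push_cast; ring
  rw [h3] at h2
  nlinarith

/-- The deterministic part of the scale induction. -/
theorem isLocalized_of_clusters {U : ℕ → ℝ} {g : ℝ} {v : ℤ → ℝ} {u : Conf N} {L l q d : ℕ}
    (hlL : l ≤ L) (hqL : q ≤ L) {s n m γ γ' : ℝ} (hn : ((ball u L).card : ℝ) ≤ n) (hn1 : 1 ≤ n)
    (hs : 0 < s) (hs1 : s ≤ 1) (hγ' : 0 ≤ γ') (hγ : γ' ≤ γ)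
    (hsmall : (n ^ 3 * s⁻¹) ^ 2 * Real.exp (-((γ - γ') * (l + 1)) + γ) ≤ 1 / 2)
    (hrate : ∀ r : ℝ, (L : ℝ) ^ (7 / 8 : ℝ) ≤ r →
      gammaExp m L * r ≤ γ' * (r - 2 * (d + 6 * q + 3)))
    {w : Conf N} (hw : w ∈ ball u L)
    (hsing : ∀ x ∈ ball u L,
      ¬ DecayBasis (kern U g v) (ball (clamp u (L - l) x) l) γ ((l : ℝ) ^ (7 / 8 : ℝ)) →
        rho w x ≤ q)
    (hres : ∀ E, ∃ w', (∀ x ∈ ball u L,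
        Resonant (kern U g v) s E (clamp u (L - l) x) l → rho x w' ≤ d) ∧
      (Resonant (kern U g v) s E (clamp u (L - q) w) q → rho w w' ≤ d)) :
    IsLocalized U g v m u L := by
  rw [isLocalized_iff]
  intro E ψ hψ x hx y hy hxy
  obtain ⟨w', h1, h2⟩ := hres E
  have key := norm_le_exp_of_clusters hlL hqL hψ hn hn1 hs hs1 hγ' hγ hsmall hw hsing h1 h2
  rw [norm_mul]
  refine (mul_le_mul (key x hx) (key y hy) (norm_nonneg _) (Real.exp_pos _).le).trans ?_
  rw [← Real.exp_add]
  refine Real.exp_le_exp.2 ?_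
  have htri := rho_triangle_real x w' y
  rw [rho_comm w' y] at htri
  have h3 := hrate _ hxy
  have h4 : γ' * (rho x y : ℝ) ≤ γ' * (rho x w' + rho y w') := mul_le_mul_of_nonneg_left htri hγ'
  nlinarith

end Deterministic

/-! ### Eigenvalue concentration -/

section Probability

variable {Ω : Type*} [MeasurableSpace Ω] {P : Measure Ω} [IsProbabilityMeasure P]

/-- Bounding a probability by a conditional probability outside an exceptional set `T`. -/
theorem real_le_of_condDistrib_le {β : Type*} [MeasurableSpace β] {X : Ω → β} {Y : Ω → ℝ}
    (hX : Measurable X) (hY : Measurable Y) {S : Set (β × ℝ)} (hS : MeasurableSet S) {c : ℝ}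
    (hc : 0 ≤ c) (T : Set Ω)
    (h : ∀ᵐ ω ∂P, ω ∉ T → (condDistrib Y X P (X ω)).real {y | (X ω, y) ∈ S} ≤ c) :
    P.real {ω | (X ω, Y ω) ∈ S} ≤ c + P.real T := by
  have e1 : P {ω | (X ω, Y ω) ∈ S} = ∫⁻ ω, condDistrib Y X P (X ω) {y | (X ω, y) ∈ S} ∂P := by
    have h1 : P {ω | (X ω, Y ω) ∈ S} = (P.map fun a => (X a, Y a)) S :=
      (Measure.map_apply (hX.prodMk hY) hS).symm
    rw [h1, ← compProd_map_condDistrib hY.aemeasurable, Measure.compProd_apply hS,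
      lintegral_map (Kernel.measurable_kernel_prodMk_left hS) hX]
    rfl
  have e2 : P {ω | (X ω, Y ω) ∈ S} ≤ ENNReal.ofReal c + P T := by
    rw [e1, ← measure_toMeasurable T]
    calc ∫⁻ ω, condDistrib Y X P (X ω) {y | (X ω, y) ∈ S} ∂P
        ≤ ∫⁻ ω, (ENNReal.ofReal c + (toMeasurable P T).indicator 1 ω) ∂P := by
          refine lintegral_mono_ae ?_
          filter_upwards [h] with ω hω
          by_cases hT : ω ∈ toMeasurable P T
          · rw [Set.indicator_of_mem hT]
            exact prob_le_one.trans (by simp)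
          · rw [Set.indicator_of_notMem hT, add_zero]
            have := hω fun hcon => hT (subset_toMeasurable P T hcon)
            rw [measureReal_def] at this
            exact (ENNReal.le_ofReal_iff_toReal_le (measure_ne_top _ _) hc).2 this
      _ = ENNReal.ofReal c + P (toMeasurable P T) := by
          rw [lintegral_add_left measurable_const, lintegral_const, measure_univ, mul_one,
            lintegral_indicator_one (measurableSet_toMeasurable P T)]
  rw [measureReal_def, measureReal_def]
  refine (ENNReal.toReal_mono (by finiteness) e2).trans ?_
  rw [ENNReal.toReal_add (by finiteness) (by finiteness), ENNReal.toReal_ofReal hc]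

theorem exists_notMem_range {N : ℕ} {x y : Conf N} (h : x ≠ y) : ∃ j, ∀ i, y.1 i ≠ x.1 j := by
  by_contra! hcon
  refine h (Subtype.ext ?_)
  have hsub : Finset.univ.image x.1 ⊆ Finset.univ.image y.1 := by
    intro z hz
    obtain ⟨j, -, rfl⟩ := Finset.mem_image.1 hz
    obtain ⟨i, hi⟩ := hcon j
    exact Finset.mem_image.2 ⟨i, Finset.mem_univ _, hi⟩
  have heq := Finset.eq_of_subset_of_card_le hsub (by
    rw [Finset.card_image_of_injective _ x.2.injective,
      Finset.card_image_of_injective _ y.2.injective])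
  have hr : Set.range x.1 = Set.range y.1 := by
    have := congrArg (fun s : Finset ℤ => (s : Set ℤ)) heq
    simpa using this
  exact (StrictAnti.range_inj x.2 y.2).1 hr

/-- Energies of different configurations are unlikely to be close. -/
theorem real_extPotential_close_le {V : ℤ → Ω → ℝ} (hV : ∀ x, Measurable (V x)) {κ C : ℝ}
    (hC : 0 ≤ C)
    (hW : ∀ s : ℝ, 0 < s → ∀ᵐ ω ∂P, ∀ x : ℤ, ∀ a : ℝ,
      (condDistrib (V x) (fun ω' (y : {y : ℤ // y ≠ x}) => V y.1 ω') P
        (fun y => V y.1 ω)).real (Set.Ioc a (a + s)) ≤ C * s ^ κ)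
    {N : ℕ} {x y : Conf N} (hxy : x ≠ y) {δ : ℝ} (hδ : 0 < δ) :
    P.real {ω | |extPotential (fun z => V z ω) x - extPotential (fun z => V z ω) y| ≤ δ}
      ≤ C * (3 * δ) ^ κ := by
  classical
  obtain ⟨j, hj⟩ := exists_notMem_range hxy
  set z := x.1 j with hz
  set X : Ω → ({y : ℤ // y ≠ z} → ℝ) := fun ω' y => V y.1 ω' with hX
  have hXm : Measurable X := measurable_pi_iff.2 fun y => hV y.1
  set F : ({y : ℤ // y ≠ z} → ℝ) → ℝ := fun o =>
    (∑ i ∈ Finset.univ.erase j, if h : x.1 i ≠ z then o ⟨x.1 i, h⟩ else 0)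
      - ∑ i, o ⟨y.1 i, hj i⟩ with hF
  have hFm : Measurable F := by
    refine Measurable.sub (Finset.measurable_fun_sum _ fun i _ => ?_)
      (Finset.measurable_fun_sum _ fun i _ => measurable_pi_apply _)
    split_ifs
    · exact measurable_pi_apply _
    · exact measurable_const
  have hSm : MeasurableSet {q : ({y : ℤ // y ≠ z} → ℝ) × ℝ | |q.2 + F q.1| ≤ δ} :=
    measurableSet_le (measurable_snd.add (hFm.comp measurable_fst)).abs measurable_const
  have hval : ∀ ω, extPotential (fun z => V z ω) x - extPotential (fun z => V z ω) y
      = V z ω + F (X ω) := by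
    intro ω
    unfold extPotential
    rw [← Finset.add_sum_erase _ _ (Finset.mem_univ j), hF]
    have : ∀ i ∈ Finset.univ.erase j, (if h : x.1 i ≠ z then X ω ⟨x.1 i, h⟩ else 0)
        = V (x.1 i) ω := by
      intro i hi
      have : x.1 i ≠ z := fun e => (Finset.mem_erase.1 hi).1 (x.2.injective e)
      rw [dif_pos this]
    dsimp only
    rw [Finset.sum_congr rfl this]
    simp only [hX]
    ring
  have key := real_le_of_condDistrib_le (P := P) hXm (hV z) hSm
    (c := C * (3 * δ) ^ κ) (by positivity) ∅ (by
      filter_upwards [hW (3 * δ) (by positivity)] with ω hω _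
      refine (measureReal_mono ?_ (by finiteness)).trans (hω z (-F (X ω) - 2 * δ))
      intro t ht
      have ht' : |t + F (X ω)| ≤ δ := ht
      rw [abs_le] at ht'
      constructor <;> linarith)
  simp only [measureReal_empty, add_zero] at key
  refine le_of_eq_of_le ?_ key
  congr 1
  ext ω
  change |_| ≤ δ ↔ |_| ≤ δ
  rw [hval]

theorem extPotential_shift {N : ℕ} (φ : ℤ → ℝ) (t : ℝ) (a b : ℤ) (x : Conf N) :
    extPotential (fun z => φ z + if z ∈ Finset.Icc a b then t else 0) x
      = extPotential φ x + occupation a b x * t := by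
  unfold extPotential occupation
  rw [Finset.sum_add_distrib, ← Finset.sum_filter, Finset.sum_const, nsmul_eq_mul]

/-- Adding a constant to the potential in an interval shifts the energies by a multiple of the
number of particles in it. -/
theorem UnitEig.shift {N : ℕ} {U : ℕ → ℝ} {g : ℝ} {φ : ℤ → ℝ} {t : ℝ} {a b : ℤ}
    {Λ : Finset (Conf N)} {n : ℕ} (hn : ∀ x ∈ Λ, occupation a b x = n) {E : ℝ}
    {f : Conf N → ℂ}
    (hf : UnitEig (kern U g fun z => φ z + if z ∈ Finset.Icc a b then t else 0) Λ E f) :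
    UnitEig (kern U g φ) Λ (E - n * (g * t)) f := by
  classical
  refine ⟨hf.unit, fun x hx => ?_⟩
  have h1 := hf.eig x hx
  have h2 : ∀ y ∈ Λ, (kern U g φ x y : ℂ) * f y
      = (kern U g (fun z => φ z + if z ∈ Finset.Icc a b then t else 0) x y : ℂ) * f y
        - if x = y then ((n * (g * t) : ℝ) : ℂ) * f x else 0 := by
    intro y _
    unfold kern
    rw [extPotential_shift, hn x hx]
    by_cases h : x = y
    · subst h; simp only [if_true]; push_cast; ring
    · simp [h]
  rw [Finset.sum_congr rfl h2, Finset.sum_sub_distrib, h1, Finset.sum_ite_eq, if_pos hx]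
  push_cast
  ring

theorem real_Icc_le_meanModulus (V : ℤ → Ω → ℝ) (Q : Finset ℤ) (ω : Ω) {s t : ℝ} (hs : 0 < s) :
    (condDistrib (sampleMean V Q) (fluctuations V Q) P (fluctuations V Q ω)).real
      (Set.Icc (t - s) (t + s)) ≤ meanModulus P V Q (3 * s) ω := by
  set μ := condDistrib (sampleMean V Q) (fluctuations V Q) P (fluctuations V Q ω) with hμ
  have hF : ∀ t, meanCDF P V Q ω t = μ.real (Set.Iic t) := fun t => rfl
  have h0 : ∀ t, 0 ≤ meanCDF P V Q ω t := fun t => by rw [hF]; exact measureReal_nonneg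
  have h1 : ∀ t, meanCDF P V Q ω t ≤ 1 := fun t => by rw [hF]; exact measureReal_le_one
  have hbdd :
      BddAbove (Set.range fun t => |meanCDF P V Q ω (t + 3 * s) - meanCDF P V Q ω t|) := by
    refine ⟨1, ?_⟩
    rintro _ ⟨t, rfl⟩
    rw [abs_le]
    constructor <;> linarith [h0 t, h0 (t + 3 * s), h1 t, h1 (t + 3 * s)]
  have h2 := le_ciSup hbdd (t - 2 * s)
  refine le_trans ?_ h2
  refine le_trans ?_ (le_abs_self _)
  -- The closed interval is contained in the half-open interval `(t - 2 s, t + s]`.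
  rw [hF, hF, ← measureReal_sdiff (Set.Iic_subset_Iic.2 (by linarith)) measurableSet_Iic]
  refine measureReal_mono ?_ (by finiteness)
  intro r hr
  rw [Set.mem_Icc] at hr
  rw [Set.mem_sdiff, Set.mem_Iic, Set.mem_Iic]
  constructor <;> linarith

/-- Eigenvalue concentration: if the configurations of `Λ₁` and of `Λ₂` have different numbers of
particles in an interval `Q`, the sample mean of the potential over `Q` moves the eigenvalues in
`Λ₁` and `Λ₂` with different constant speeds. -/
theorem real_eigenvalues_close_le {V : ℤ → Ω → ℝ} (hV : ∀ x, Measurable (V x))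
    {N : ℕ} (U : ℕ → ℝ) {g : ℝ} (hg : 1 ≤ |g|) {Λ₁ Λ₂ : Finset (Conf N)} {a b : ℤ} {n₁ n₂ : ℕ}
    (hn : n₁ ≠ n₂) (h₁ : ∀ x ∈ Λ₁, occupation a b x = n₁) (h₂ : ∀ x ∈ Λ₂, occupation a b x = n₂)
    {s K ε : ℝ} (hs : 0 < s) (hK : 0 ≤ K)
    (hreg : P.real {ω | K ≤ meanModulus P V (Finset.Icc a b) (3 * s) ω} ≤ ε) :
    P.real {ω | ∃ E₁ f₁ E₂ f₂, UnitEig (kern U g fun z => V z ω) Λ₁ E₁ f₁ ∧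
      UnitEig (kern U g fun z => V z ω) Λ₂ E₂ f₂ ∧ |E₁ - E₂| ≤ s}
      ≤ Λ₁.card * Λ₂.card * K + ε := by
  set Q := Finset.Icc a b with hQ
  have hXm : Measurable (fluctuations V Q) := by
    refine measurable_pi_iff.2 fun y => ?_
    unfold fluctuations sampleMean
    split_ifs
    · exact (hV y).sub ((Finset.measurable_fun_sum _ fun i _ => hV i).div_const _)
    · exact hV y
  have hYm : Measurable (sampleMean V Q) :=
    (Finset.measurable_fun_sum _ fun i _ => hV i).div_const _
  set k : (ℤ → ℝ) × ℝ → Conf N → Conf N → ℝ := fun q =>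
    kern U g fun z => q.1 z + if z ∈ Q then q.2 else 0 with hk
  have hkc : ∀ x y, Continuous fun q => k q x y := by
    intro x y
    refine (continuous_kern U g x y).comp (continuous_pi fun z => ?_)
    refine ((continuous_apply z).comp continuous_fst).add ?_
    split_ifs
    · exact continuous_snd
    · exact continuous_const
  have hcl := isClosed_exists_pair hkc Λ₁ Λ₂ (r := fun _ E₁ E₂ => |E₁ - E₂|)
    (by fun_prop) s
  have hVk : ∀ ω, k (fluctuations V Q ω, sampleMean V Q ω) = kern U g fun z => V z ω := by
    intro ω
    simp only [hk]
    congr 1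
    funext z
    unfold fluctuations
    split_ifs <;> ring
  have key := real_le_of_condDistrib_le (P := P) hXm hYm hcl.measurableSet
    (c := Λ₁.card * Λ₂.card * K) (by positivity)
    {ω | K ≤ meanModulus P V Q (3 * s) ω} (by
      refine Filter.Eventually.of_forall fun ω hω => ?_
      have hω' : meanModulus P V Q (3 * s) ω < K := not_le.1 hω
      set φ := fluctuations V Q ω with hφ
      obtain ⟨φ₁, lam₁, hb₁⟩ := exists_eigBasis (kern_symm U g φ) Λ₁
      obtain ⟨φ₂, lam₂, hb₂⟩ := exists_eigBasis (kern_symm U g φ) Λ₂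
      have hd : ((n₁ : ℝ) - n₂) * g ≠ 0 := by
        refine mul_ne_zero (sub_ne_zero.2 (by exact_mod_cast hn)) fun h0 => ?_
        rw [h0] at hg; norm_num at hg
      have hd1 : 1 ≤ |((n₁ : ℝ) - n₂) * g| := by
        rw [abs_mul]
        have : (1 : ℝ) ≤ |(n₁ : ℝ) - n₂| := by
          have : (1 : ℤ) ≤ |(n₁ : ℤ) - n₂| := Int.one_le_abs (by omega)
          exact_mod_cast this
        nlinarith
      -- Given the fluctuations, each pair of eigenvalues meets only for `ξ` in a short interval.
      set I : Λ₁ × Λ₂ → Set ℝ := fun p =>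
        Set.Icc (-(lam₁ p.1 - lam₂ p.2) / (((n₁ : ℝ) - n₂) * g) - s)
          (-(lam₁ p.1 - lam₂ p.2) / (((n₁ : ℝ) - n₂) * g) + s) with hI
      have hsub : {t | (φ, t) ∈ {q : (ℤ → ℝ) × ℝ | ∃ E₁ f₁ E₂ f₂, UnitEig (k q) Λ₁ E₁ f₁ ∧
          UnitEig (k q) Λ₂ E₂ f₂ ∧ |E₁ - E₂| ≤ s}} ⊆ ⋃ p ∈ Finset.univ, I p := by
        rintro t ⟨E₁, f₁, E₂, f₂, hf₁, hf₂, hE⟩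
        obtain ⟨p, hp⟩ := hb₁.exists_eq (kern_symm U g φ) (UnitEig.shift h₁ hf₁)
        obtain ⟨r, hr⟩ := hb₂.exists_eq (kern_symm U g φ) (UnitEig.shift h₂ hf₂)
        refine Set.mem_iUnion₂.2 ⟨(p, r), Finset.mem_univ _, ?_⟩
        have e : |(t - -(lam₁ p - lam₂ r) / (((n₁ : ℝ) - n₂) * g))|
            * |((n₁ : ℝ) - n₂) * g| ≤ s := by
          rw [← abs_mul]
          refine le_of_eq_of_le (congrArg abs ?_) hE
          rw [sub_mul, div_mul_cancel₀ _ hd, hp, hr]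
          ring
        have e2 : |(t - -(lam₁ p - lam₂ r) / (((n₁ : ℝ) - n₂) * g))| ≤ s :=
          (le_mul_of_one_le_right (abs_nonneg _) hd1).trans e
        rw [abs_le] at e2
        rw [hI]
        constructor <;> linarith [e2.1, e2.2]
      refine (measureReal_mono hsub (measure_ne_top _ _)).trans ?_
      refine (measureReal_biUnion_finset_le _ _).trans ?_
      refine (Finset.sum_le_card_nsmul _ _ K fun p _ =>
        (real_Icc_le_meanModulus V Q ω hs).trans hω'.le).trans ?_
      rw [nsmul_eq_mul, Finset.card_univ, Fintype.card_prod, Fintype.card_coe, Fintype.card_coe]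
      push_cast
      exact le_rfl)
  refine le_trans (le_of_eq ?_) (key.trans (add_le_add_right hreg _))
  congr 1
  ext ω
  simp only [Set.mem_ofPred_eq, hVk]

end Probability

/-! ### Asymptotic independence of distant tight balls -/

section Mixing

theorem measurableSet_not_isLocalized {N : ℕ} (U : ℕ → ℝ) (g m : ℝ) (c : Conf N) (l : ℕ) :
    MeasurableSet {v : ℤ → ℝ | ¬ IsLocalized U g v m c l} := by
  have : {v : ℤ → ℝ | ¬ IsLocalized U g v m c l} = ⋃ x ∈ ball c l, ⋃ y ∈ ball c l,
      ⋃ (_ : (l : ℝ) ^ (7 / 8 : ℝ) ≤ (rho x y : ℝ)), ⋃ n : ℕ,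
        {v | ∃ E f, UnitEig (kern U g v) (ball c l) E f ∧
          Real.exp (-(gammaExp m l * (rho x y : ℝ))) + 1 / ((n : ℝ) + 1) ≤ ‖f x * f y‖} := by
    ext v
    simp only [Set.mem_ofPred_eq, isLocalized_iff, Set.mem_iUnion]
    push Not
    constructor
    · rintro ⟨E, f, hf, x, hx, y, hy, hxy, hlt⟩
      obtain ⟨n, hn⟩ := exists_nat_one_div_lt (sub_pos.2 hlt)
      exact ⟨x, hx, y, hy, hxy, n, E, f, hf, by linarith⟩
    · rintro ⟨x, hx, y, hy, hxy, n, E, f, hf, hle⟩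
      refine ⟨E, f, hf, x, hx, y, hy, hxy, lt_of_lt_of_le ?_ hle⟩
      exact lt_add_of_pos_right _ Nat.one_div_pos_of_nat
  rw [this]
  refine Finset.measurableSet_biUnion _ fun x hx => Finset.measurableSet_biUnion _ fun y hy =>
    MeasurableSet.iUnion fun _ => MeasurableSet.iUnion fun n => ?_
  exact (isClosed_exists_large (fun x y => continuous_kern U g x y) _ hx hy _).measurableSet

theorem isLocalized_congr {N : ℕ} {U : ℕ → ℝ} {g m : ℝ} {c : Conf N} {l : ℕ} {v v' : ℤ → ℝ}
    (h : ∀ z ∈ sites c l, v z = v' z) (hv : IsLocalized U g v m c l) :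
    IsLocalized U g v' m c l := by
  rw [isLocalized_iff] at hv ⊢
  intro E f hf
  refine hv E f (hf.congr_kernel fun x hx y _ => ?_)
  exact kern_congr U g y fun i => (h _ ⟨x, hx, i, rfl⟩).symm

theorem measurableSet_fieldSigma_not_isLocalized {Ω : Type*} {N : ℕ} (V : ℤ → Ω → ℝ)
    (U : ℕ → ℝ) (g m : ℝ) (c : Conf N) (l : ℕ) :
    MeasurableSet[fieldSigma V (sites c l)]
      {ω | ¬ IsLocalized U g (fun x => V x ω) m c l} := by
  classical
  set X : Ω → ℤ → ℝ := fun ω z => if z ∈ sites c l then V z ω else 0 with hX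
  have hXm : Measurable[fieldSigma V (sites c l)] X := by
    refine @measurable_pi_iff _ _ _ (fieldSigma V (sites c l)) _ _ |>.2 fun z => ?_
    by_cases hz : z ∈ sites c l
    · simp only [hX, if_pos hz]
      exact Measurable.mono (comap_measurable (V z))
        (le_iSup₂_of_le (f := fun x (_ : x ∈ sites c l) =>
          MeasurableSpace.comap (V x) inferInstance) z hz le_rfl) le_rfl
    · simp only [hX, if_neg hz]
      exact measurable_const
  have : {ω | ¬ IsLocalized U g (fun x => V x ω) m c l}
      = X ⁻¹' {v | ¬ IsLocalized U g v m c l} := by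
    ext ω
    refine not_congr ⟨isLocalized_congr fun z hz => ?_, isLocalized_congr fun z hz => ?_⟩ <;>
      simp [hX, hz]
  rw [this]
  exact hXm (measurableSet_not_isLocalized U g m c l)

theorem real_inter_not_isLocalized_le {Ω : Type*} [MeasurableSpace Ω] {P : Measure Ω}
    {V : ℤ → Ω → ℝ} {C : ℝ}
    (hmix : ∀ (L : ℕ) (A B : Set ℤ), (∀ a ∈ A, ∀ b ∈ B, (L : ℤ) ≤ |a - b|) →
      ∀ S T : Set Ω, MeasurableSet[fieldSigma V A] S → MeasurableSet[fieldSigma V B] T →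
        |P.real (S ∩ T) - P.real S * P.real T| ≤ Real.exp (-C * Real.log L ^ 2))
    {N : ℕ} (U : ℕ → ℝ) (g m : ℝ) {G l D : ℕ} {c₁ c₂ : Conf N} (h₁ : Tight G c₁)
    (h₂ : Tight G c₂) (hD : 2 * (N * G) + 2 * l + l ≤ D) (hfar : D < rho c₁ c₂) {ε : ℝ}
    (hε₁ : P.real {ω | ¬ IsLocalized U g (fun x => V x ω) m c₁ l} ≤ ε)
    (hε₂ : P.real {ω | ¬ IsLocalized U g (fun x => V x ω) m c₂ l} ≤ ε) :
    P.real ({ω | ¬ IsLocalized U g (fun x => V x ω) m c₁ l} ∩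
      {ω | ¬ IsLocalized U g (fun x => V x ω) m c₂ l})
      ≤ ε ^ 2 + Real.exp (-C * Real.log l ^ 2) := by
  have h := hmix l _ _ (dist_sites h₁ h₂ hD hfar) _ _
    (measurableSet_fieldSigma_not_isLocalized V U g m c₁ l)
    (measurableSet_fieldSigma_not_isLocalized V U g m c₂ l)
  have h3 := (abs_le.1 h).2
  have h4 := mul_le_mul hε₁ hε₂ measureReal_nonneg (measureReal_nonneg.trans hε₁)
  rw [pow_two]
  linarith

end Mixing

/-! ### The initial scale -/

section Initial

variable {N : ℕ}

theorem kern_diag (U : ℕ → ℝ) (g : ℝ) (v : ℤ → ℝ) (x : Conf N) :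
    kern U g v x x = ((confGraph N).degree x : ℝ) + g * extPotential v x + interaction U x := by
  simp [kern]

/-- If the diagonal entries of the kernel are far from each other, every eigenfunction is
localized at a single point. -/
theorem isLocalized_of_separated {U : ℕ → ℝ} {g : ℝ} {v : ℤ → ℝ} {m : ℝ} {u : Conf N} {L : ℕ}
    {n K : ℝ} (hΓ : 0 ≤ gammaExp m L) (hn : ((ball u L).card : ℝ) ≤ n)
    (hK : n * Real.exp (gammaExp m L) < K)
    (hsep : ∀ x ∈ ball u L, ∀ y ∈ ball u L, x ≠ y →
      2 * K ≤ |kern U g v x x - kern U g v y y|) :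
    IsLocalized U g v m u L := by
  classical
  rw [isLocalized_iff]
  intro E ψ hψ
  set B := ball u L with hB
  set Γ := gammaExp m L with hΓdef
  have hn0 : 0 ≤ n := le_trans (Nat.cast_nonneg _) hn
  have hK0 : 0 < K := lt_of_le_of_lt (by positivity) hK
  have hu : u ∈ B := mem_ball.2 (by rw [rho_self]; exact Nat.zero_le _)
  obtain ⟨x₀, hx₀, hfar⟩ : ∃ x₀ ∈ B, ∀ x ∈ B, x ≠ x₀ → K ≤ |kern U g v x x - E| := by
    by_cases h : ∃ x₀ ∈ B, |kern U g v x₀ x₀ - E| < K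
    · obtain ⟨x₀, hx₀, hlt⟩ := h
      refine ⟨x₀, hx₀, fun x hx hne => ?_⟩
      have h1 := hsep x hx x₀ hx₀ hne
      have h2 := abs_sub_le (kern U g v x x) E (kern U g v x₀ x₀)
      rw [abs_sub_comm E] at h2
      linarith
    · push Not at h
      exact ⟨u, hu, fun x hx _ => h x hx⟩
  obtain ⟨x₁, hx₁, hmax⟩ :=
    B.exists_max_image (fun x => ‖ψ x‖ * Real.exp (Γ * rho x x₀)) ⟨u, hu⟩
  set M := ‖ψ x₁‖ * Real.exp (Γ * rho x₁ x₀) with hMdef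
  have hM0 : 0 ≤ M := by positivity
  have hM : ∀ z ∈ B, ‖ψ z‖ ≤ M * Real.exp (-(Γ * rho z x₀)) := by
    intro z hz
    rw [Real.exp_neg, ← div_eq_mul_inv, le_div_iff₀ (Real.exp_pos _)]
    exact hmax z hz
  have hM1 : M ≤ 1 := by
    by_cases hx : x₁ = x₀
    · rw [hMdef, hx, rho_self]
      simpa using hψ.norm_le_one hx₀
    · by_contra! hgt
      have hMpos : 0 < M := by linarith
      have heig := hψ.eig x₁ hx₁
      rw [← Finset.add_sum_erase _ _ hx₁] at heig
      have heq : ((kern U g v x₁ x₁ - E : ℝ) : ℂ) * ψ x₁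
          = -∑ y ∈ B.erase x₁, (kern U g v x₁ y : ℂ) * ψ y := by
        push_cast
        linear_combination heig
      have hbd : ‖∑ y ∈ B.erase x₁, (kern U g v x₁ y : ℂ) * ψ y‖
          ≤ n * (M * Real.exp (-(Γ * rho x₁ x₀) + Γ)) := by
        refine (norm_sum_le _ _).trans ((Finset.sum_le_card_nsmul _ _
          (M * Real.exp (-(Γ * rho x₁ x₀) + Γ)) fun y hy => ?_).trans ?_)
        · obtain ⟨hne, hy⟩ := Finset.mem_erase.1 hy
          by_cases h0 : kern U g v x₁ y = 0
          · rw [h0]; simp; positivity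
          · obtain ⟨hadj, h1⟩ := kern_of_ne U g v hne.symm h0
            rw [norm_mul, Complex.norm_real, Real.norm_eq_abs, h1, one_mul]
            refine (hM y hy).trans (mul_le_mul_of_nonneg_left (Real.exp_le_exp.2 ?_) hM0)
            have t := rho_triangle_real x₁ y x₀
            have t2 : (rho x₁ y : ℝ) ≤ 1 := by exact_mod_cast rho_le_one_of_adj hadj
            nlinarith
        · rw [nsmul_eq_mul]
          refine mul_le_mul_of_nonneg_right (le_trans ?_ hn) (by positivity)
          exact_mod_cast Finset.card_le_card (Finset.erase_subset _ _)
      have h1 : K * ‖ψ x₁‖ ≤ n * (M * Real.exp (-(Γ * rho x₁ x₀) + Γ)) := by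
        refine (mul_le_mul_of_nonneg_right (hfar x₁ hx₁ hx) (norm_nonneg _)).trans ?_
        rw [← norm_neg, ← heq, norm_mul, Complex.norm_real, Real.norm_eq_abs] at hbd
        exact hbd
      have h2 : K * M ≤ n * Real.exp Γ * M := by
        calc K * M = K * ‖ψ x₁‖ * Real.exp (Γ * rho x₁ x₀) := by rw [hMdef]; ring
          _ ≤ n * (M * Real.exp (-(Γ * rho x₁ x₀) + Γ)) * Real.exp (Γ * rho x₁ x₀) :=
              mul_le_mul_of_nonneg_right h1 (Real.exp_pos _).le
          _ = n * M * Real.exp Γ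
                * (Real.exp (-(Γ * rho x₁ x₀)) * Real.exp (Γ * rho x₁ x₀)) := by
              rw [Real.exp_add]; ring
          _ = n * Real.exp Γ * M := by rw [← Real.exp_add]; simp; ring
      nlinarith
  have key : ∀ z ∈ B, ‖ψ z‖ ≤ Real.exp (-(Γ * rho z x₀)) := fun z hz =>
    (hM z hz).trans (mul_le_of_le_one_left (Real.exp_pos _).le hM1)
  intro x hx y hy _
  rw [norm_mul]
  refine (mul_le_mul (key x hx) (key y hy) (norm_nonneg _) (Real.exp_pos _).le).trans ?_
  rw [← Real.exp_add]
  refine Real.exp_le_exp.2 ?_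
  have htri := rho_triangle_real x x₀ y
  rw [rho_comm x₀ y] at htri
  have := mul_le_mul_of_nonneg_left htri hΓ
  linarith

theorem degree_le (x : Conf N) : (confGraph N).degree x ≤ 3 ^ N := by
  classical
  rw [degree_eq_sum, ← Finset.card_filter]
  exact (Finset.card_filter_le _ _).trans (card_ball_le x 1)

theorem abs_interaction_le {U : ℕ → ℝ} {W : ℝ} (hW : ∀ r, |U r| ≤ W) (x : Conf N) :
    |interaction U x| ≤ N * (N * W) := by
  have hW0 : 0 ≤ W := (abs_nonneg _).trans (hW 0)
  unfold interaction
  refine (Finset.abs_sum_le_sum_abs _ _).trans ((Finset.sum_le_card_nsmul _ _ (N * W)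
    fun i _ => ?_).trans (by simp))
  refine (Finset.abs_sum_le_sum_abs _ _).trans ((Finset.sum_le_card_nsmul _ _ W
    fun j _ => ?_).trans (by simp))
  split_ifs
  · exact hW _
  · simpa using hW0

theorem exists_bound_of_finite_range {U : ℕ → ℝ} {r₀ : ℕ} (hU : ∀ r, r₀ ≤ r → U r = 0) :
    ∃ W, ∀ r, |U r| ≤ W := by
  refine ⟨∑ i ∈ Finset.range r₀, |U i|, fun r => ?_⟩
  rcases lt_or_ge r r₀ with h | h
  · exact Finset.single_le_sum (f := fun i => |U i|) (fun _ _ => abs_nonneg _)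
      (Finset.mem_range.2 h)
  · rw [hU r h, abs_zero]
    exact Finset.sum_nonneg fun _ _ => abs_nonneg _

/-- Localization in balls of a fixed radius at large disorder. -/
theorem exists_disorder {Ω : Type*} [MeasurableSpace Ω] {P : Measure Ω} [IsProbabilityMeasure P]
    {V : ℤ → Ω → ℝ} (hV : ∀ x, Measurable (V x)) (hW1 : HolderContinuousCDF P V)
    {U : ℕ → ℝ} {r₀ : ℕ} (hU : ∀ r, r₀ ≤ r → U r = 0) (N L : ℕ) {m : ℝ} (hm : 0 ≤ m)
    {ε : ℝ} (hε : 0 < ε) :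
    ∃ g₀ : ℝ, 0 < g₀ ∧ ∀ g : ℝ, g₀ ≤ |g| → ∀ u : Conf N,
      P.real {ω | ¬ IsLocalized U g (fun x => V x ω) m u L} ≤ ε := by
  classical
  obtain ⟨κ, hκ, C, hC⟩ := hW1
  obtain ⟨W, hW⟩ := exists_bound_of_finite_range hU
  have hW0 : 0 ≤ W := (abs_nonneg _).trans (hW 0)
  set C₁ := max C 0 with hC₁
  have hC' : ∀ s : ℝ, 0 < s → ∀ᵐ ω ∂P, ∀ x : ℤ, ∀ a : ℝ,
      (condDistrib (V x) (fun ω' (y : {y : ℤ // y ≠ x}) => V y.1 ω') P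
        (fun y => V y.1 ω)).real (Set.Ioc a (a + s)) ≤ C₁ * s ^ κ := by
    intro s hs
    filter_upwards [hC s hs] with ω hω x a
    exact (hω x a).trans (mul_le_mul_of_nonneg_right (le_max_left _ _) (by positivity))
  set n : ℝ := (((2 * L + 1) ^ N : ℕ) : ℝ) with hn
  obtain ⟨δ, hδ, hsmall⟩ : ∃ δ : ℝ, 0 < δ ∧ n * n * (C₁ * (3 * δ) ^ κ) ≤ ε := by
    have hcont : Filter.Tendsto (fun δ : ℝ => n * n * (C₁ * (3 * δ) ^ κ))
        (nhdsWithin 0 (Set.Ioi 0)) (nhds (n * n * (C₁ * (3 * 0) ^ κ))) := by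
      refine Filter.Tendsto.mono_left ?_ nhdsWithin_le_nhds
      have : Continuous fun δ : ℝ => n * n * (C₁ * (3 * δ) ^ κ) :=
        continuous_const.mul (continuous_const.mul
          ((continuous_const.mul continuous_id).rpow_const fun _ => Or.inr hκ.le))
      exact this.tendsto 0
    rw [mul_zero, Real.zero_rpow hκ.ne', mul_zero, mul_zero] at hcont
    obtain ⟨δ, h1, h2⟩ := ((hcont.eventually (gt_mem_nhds hε)).and
      self_mem_nhdsWithin).exists
    exact ⟨δ, h2, h1.le⟩
  set Γ := gammaExp m L with hΓ
  have hΓ0 : 0 ≤ Γ := by rw [hΓ]; unfold gammaExp; positivity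
  set K := n * Real.exp Γ + 1 with hK
  have hK0 : 0 < K := by positivity
  refine ⟨(2 * K + 2 * (3 ^ N + N * (N * W))) / δ, by positivity, fun g hg u => ?_⟩
  rw [div_le_iff₀ hδ] at hg
  have hcard : ((ball u L).card : ℝ) ≤ n := by rw [hn]; exact_mod_cast card_ball_le u L
  have hsub : {ω | ¬ IsLocalized U g (fun x => V x ω) m u L} ⊆
      ⋃ p ∈ (ball u L ×ˢ ball u L).filter (fun p => p.1 ≠ p.2),
        {ω | |extPotential (fun z => V z ω) p.1 - extPotential (fun z => V z ω) p.2| ≤ δ} := by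
    intro ω hω
    by_contra hcon
    simp only [Set.mem_iUnion, Finset.mem_filter, Finset.mem_product, Set.mem_ofPred_eq,
      not_exists, not_le] at hcon
    refine hω (isLocalized_of_separated hΓ0 hcard (lt_add_one _) fun x hx y hy hxy => ?_)
    have h1 := hcon (x, y) ⟨⟨hx, hy⟩, hxy⟩
    rw [kern_diag, kern_diag]
    have d1 : ((confGraph N).degree x : ℝ) ≤ 3 ^ N := by exact_mod_cast degree_le x
    have d2 : ((confGraph N).degree y : ℝ) ≤ 3 ^ N := by exact_mod_cast degree_le y
    have d3 : (0 : ℝ) ≤ (confGraph N).degree x := Nat.cast_nonneg _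
    have d4 : (0 : ℝ) ≤ (confGraph N).degree y := Nat.cast_nonneg _
    have i1 := abs_le.1 (abs_interaction_le hW x)
    have i2 := abs_le.1 (abs_interaction_le hW y)
    set e := extPotential (fun z => V z ω) x - extPotential (fun z => V z ω) y with he
    have h2 : 2 * K + 2 * (3 ^ N + N * (N * W)) ≤ |g * e| := by
      rw [abs_mul]
      exact hg.trans (mul_le_mul_of_nonneg_left h1.le (abs_nonneg _))
    have h3 : |g * e| ≤ |((confGraph N).degree x : ℝ) + g * extPotential (fun z => V z ω) x
        + interaction U x - (((confGraph N).degree y : ℝ)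
        + g * extPotential (fun z => V z ω) y + interaction U y)|
        + |((confGraph N).degree y : ℝ) - (confGraph N).degree x
          + (interaction U y - interaction U x)| := by
      refine le_of_eq_of_le (congrArg abs ?_) (abs_add_le _ _)
      rw [he]; ring
    have h4 : |((confGraph N).degree y : ℝ) - (confGraph N).degree x
          + (interaction U y - interaction U x)| ≤ 2 * (3 ^ N + N * (N * W)) := by
      rw [abs_le]
      constructor <;> linarith
    linarith
  refine (measureReal_mono hsub (measure_ne_top _ _)).trans
    ((measureReal_biUnion_finset_le _ _).trans ?_)
  refine (Finset.sum_le_card_nsmul _ _ (C₁ * (3 * δ) ^ κ) fun p hp => ?_).trans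
    (le_trans ?_ hsmall)
  · exact real_extPotential_close_le hV (le_max_right _ _) hC' (Finset.mem_filter.1 hp).2 hδ
  · rw [nsmul_eq_mul]
    refine mul_le_mul_of_nonneg_right ?_ (by positivity)
    have : (((ball u L ×ˢ ball u L).filter fun p => p.1 ≠ p.2).card : ℝ)
        ≤ (ball u L).card * (ball u L).card := by
      exact_mod_cast (Finset.card_filter_le _ _).trans (Finset.card_product _ _).le
    exact this.trans (mul_le_mul hcard hcard (Nat.cast_nonneg _) (by positivity))

end Initial

/-! ### Probability estimate in the next scale -/

section Step

theorem real_not_decayBasis_le {Ω : Type*} [MeasurableSpace Ω] {P : Measure Ω}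
    [IsProbabilityMeasure P] {U : ℕ → ℝ} {r₀ : ℕ} (hU : ∀ r, r₀ ≤ r → U r = 0)
    {V : ℤ → Ω → ℝ} {g m : ℝ} {N l : ℕ} {ε : ℝ}
    (hsmall : ∀ n, 1 ≤ n → n < N → ∀ c : Conf n,
      P.real {ω | ¬ IsLocalized U g (fun x => V x ω) m c l} ≤ ε)
    {c : Conf N} (hc : ¬ Tight (r₀ + 2 + 2 * l) c) :
    P.real {ω | ¬ DecayBasis (kern U g fun x => V x ω) (ball c l) (gammaExp m l)
      ((l : ℝ) ^ (7 / 8 : ℝ))} ≤ 2 * ε := by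
  obtain ⟨a, b, ha, hb, rfl, hgap⟩ := not_tight hc
  have hG : Gapped (r₀ + 2 + 2 * l) c := fun i j => hgap _ _ (by simp) (by simp)
  have hsub : {ω | ¬ DecayBasis (kern U g fun x => V x ω) (ball c l) (gammaExp m l)
      ((l : ℝ) ^ (7 / 8 : ℝ))} ⊆
      {ω | ¬ IsLocalized U g (fun x => V x ω) m (left c) l} ∪
      {ω | ¬ IsLocalized U g (fun x => V x ω) m (right c) l} := by
    intro ω hω
    by_contra hcon
    simp only [Set.mem_union, Set.mem_ofPred_eq, not_or, not_not] at hcon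
    exact hω (hG.decayBasis hU hcon.1.decayBasis hcon.2.decayBasis)
  refine (measureReal_mono hsub (measure_ne_top _ _)).trans ((measureReal_union_le _ _).trans ?_)
  linarith [hsmall a (by omega) (by omega) (left c), hsmall b (by omega) (by omega) (right c)]

/-- The event that the spectra in two balls are closer than `2 s`. -/
def spectraClose {Ω : Type*} {N : ℕ} (U : ℕ → ℝ) (g : ℝ) (V : ℤ → Ω → ℝ) (s : ℝ)
    (c₁ : Conf N) (r₁ : ℕ) (c₂ : Conf N) (r₂ : ℕ) : Set Ω :=
  {ω | ∃ E₁ f₁ E₂ f₂, UnitEig (kern U g fun z => V z ω) (ball c₁ r₁) E₁ f₁ ∧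
      UnitEig (kern U g fun z => V z ω) (ball c₂ r₂) E₂ f₂ ∧ |E₁ - E₂| ≤ 2 * s}

/-- Outside of three families of unlikely events, the ball of radius `L` is localized. -/
theorem not_isLocalized_subset {Ω : Type*} {U : ℕ → ℝ} {V : ℤ → Ω → ℝ} {g m : ℝ} {N : ℕ}
    {G l L q D d : ℕ} (hlq : l ≤ q) (hqL : q ≤ L) (hDq : D + l ≤ q) (hd : 4 * N * q + q ≤ d)
    {u : Conf N} {s n γ' : ℝ} (hn : ((ball u L).card : ℝ) ≤ n) (hn1 : 1 ≤ n)
    (hs : 0 < s) (hs1 : s ≤ 1) (hγ' : 0 ≤ γ') (hγ : γ' ≤ gammaExp m l)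
    (hsmall : (n ^ 3 * s⁻¹) ^ 2 *
      Real.exp (-((gammaExp m l - γ') * (l + 1)) + gammaExp m l) ≤ 1 / 2)
    (hrate : ∀ r : ℝ, (L : ℝ) ^ (7 / 8 : ℝ) ≤ r →
      gammaExp m L * r ≤ γ' * (r - 2 * (d + 6 * q + 3))) :
    {ω | ¬ IsLocalized U g (fun x => V x ω) m u L} ⊆
      {ω | ∃ c ∈ ball u L, ¬ Tight G c ∧ ¬ DecayBasis (kern U g fun x => V x ω) (ball c l)
          (gammaExp m l) ((l : ℝ) ^ (7 / 8 : ℝ))} ∪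
      {ω | ∃ c₁ ∈ ball u L, ∃ c₂ ∈ ball u L, Tight G c₁ ∧ Tight G c₂ ∧ D < rho c₁ c₂ ∧
          ω ∈ {ω | ¬ IsLocalized U g (fun x => V x ω) m c₁ l} ∩
            {ω | ¬ IsLocalized U g (fun x => V x ω) m c₂ l}} ∪
      {ω | ∃ c₁ ∈ ball u L, ∃ c₂ ∈ ball u L, 4 * N * q < rho c₁ c₂ ∧
          ∃ r₁ ∈ ({l, q} : Finset ℕ), ∃ r₂ ∈ ({l, q} : Finset ℕ),
            ω ∈ spectraClose U g V s c₁ r₁ c₂ r₂} := by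
  intro ω hω
  by_contra hcon
  simp only [Set.mem_union, Set.mem_ofPred_eq, not_or, Set.mem_inter_iff] at hcon
  obtain ⟨⟨h1, h2⟩, h3⟩ := hcon
  push Not at h1 h2 h3
  have hlL : l ≤ L := hlq.trans hqL
  have hself : ∀ (c : Conf N) (r : ℕ), c ∈ ball c r := fun c r =>
    mem_ball.2 (by rw [rho_self]; exact Nat.zero_le _)
  have hcl : ∀ x, ∀ r ≤ L, clamp u (L - r) x ∈ ball u L := fun x r hr =>
    ball_clamp_subset u hr x (hself _ _)
  have hxc : ∀ x ∈ ball u L, ∀ r ≤ L, rho x (clamp u (L - r) x) ≤ r := by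
    intro x hx r hr
    rw [rho_comm]
    exact mem_ball.1 (mem_ball_clamp hr hx hx (by rw [rho_self]; exact Nat.zero_le _))
  set Dec : Conf N → Prop := fun c => DecayBasis (kern U g fun x => V x ω) (ball c l)
    (gammaExp m l) ((l : ℝ) ^ (7 / 8 : ℝ)) with hDec
  have hnotdec : ∀ c ∈ ball u L, ¬ Dec c →
      Tight G c ∧ ¬ IsLocalized U g (fun x => V x ω) m c l := by
    intro c hc hdec
    refine ⟨?_, fun hloc => hdec hloc.decayBasis⟩
    by_contra ht
    exact hdec (h1 c hc ht)
  obtain ⟨w, hw, hsing⟩ : ∃ w ∈ ball u L, ∀ x ∈ ball u L, ¬ Dec (clamp u (L - l) x) →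
      rho w x ≤ q := by
    by_cases hex : ∃ x₀ ∈ ball u L, ¬ Dec (clamp u (L - l) x₀)
    · obtain ⟨x₀, hx₀, hdec₀⟩ := hex
      refine ⟨clamp u (L - l) x₀, hcl _ _ hlL, fun x hx hdec => ?_⟩
      obtain ⟨t₀, n₀⟩ := hnotdec _ (hcl x₀ l hlL) hdec₀
      obtain ⟨t, n'⟩ := hnotdec _ (hcl x l hlL) hdec
      have hle : rho (clamp u (L - l) x₀) (clamp u (L - l) x) ≤ D := by
        by_contra! hlt
        exact n' (h2 _ (hcl _ _ hlL) _ (hcl _ _ hlL) t₀ t hlt n₀)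
      have e1 := rho_triangle (clamp u (L - l) x₀) (clamp u (L - l) x) x
      have e2 := hxc x hx l hlL
      rw [rho_comm] at e2
      omega
    · push Not at hex
      exact ⟨u, hself _ _, fun x hx hdec => absurd (hex x hx) hdec⟩
  refine hω (isLocalized_of_clusters hlL hqL hn hn1 hs hs1 hγ' hγ hsmall hrate hw hsing
    fun E => ?_)
  set Res := Resonant (kern U g fun x => V x ω) s E with hRes
  have hclose : ∀ c₁ ∈ ball u L, ∀ c₂ ∈ ball u L, ∀ r₁ ∈ ({l, q} : Finset ℕ),
      ∀ r₂ ∈ ({l, q} : Finset ℕ), Res c₁ r₁ → Res c₂ r₂ → rho c₁ c₂ ≤ 4 * N * q := by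
    rintro c₁ hc₁ c₂ hc₂ r₁ hr₁ r₂ hr₂ ⟨E₁, f₁, hf₁, hE₁⟩ ⟨E₂, f₂, hf₂, hE₂⟩
    by_contra! hlt
    refine h3 c₁ hc₁ c₂ hc₂ hlt r₁ hr₁ r₂ hr₂ ⟨E₁, f₁, E₂, f₂, hf₁, hf₂, ?_⟩
    have := abs_sub_le E₁ E E₂
    rw [abs_sub_comm E E₂] at this
    linarith
  by_cases hex : ∃ c ∈ ball u L, ∃ r ∈ ({l, q} : Finset ℕ), Res c r
  · obtain ⟨c, hc, r, hr, hcr⟩ := hex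
    refine ⟨c, fun x hx hx' => ?_, fun hw' => ?_⟩
    · have e1 := hclose _ (hcl x l hlL) c hc l (by simp) r hr hx' hcr
      have e2 := rho_triangle x (clamp u (L - l) x) c
      have e3 := hxc x hx l hlL
      omega
    · have e1 := hclose _ (hcl w q hqL) c hc q (by simp) r hr hw' hcr
      have e2 := rho_triangle w (clamp u (L - q) w) c
      have e3 := hxc w hw q hqL
      omega
  · push Not at hex
    exact ⟨w, fun x hx hx' => absurd hx' (hex _ (hcl x l hlL) l (by simp)),
      fun hw' => absurd hw' (hex _ (hcl w q hqL) q (by simp))⟩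

/-- The inductive step in the scale: the three families of events are bounded by the localization
estimates for fewer particles, by the asymptotic independence of distant tight balls, and by
eigenvalue concentration. -/
theorem real_not_isLocalized_le {Ω : Type*} [MeasurableSpace Ω] {P : Measure Ω}
    [IsProbabilityMeasure P] {V : ℤ → Ω → ℝ} (hV : ∀ x, Measurable (V x))
    {U : ℕ → ℝ} {r₀ : ℕ} (hU : ∀ r, r₀ ≤ r → U r = 0) {C : ℝ}
    (hmix : ∀ (L : ℕ) (A B : Set ℤ), (∀ a ∈ A, ∀ b ∈ B, (L : ℤ) ≤ |a - b|) →
      ∀ S T : Set Ω, MeasurableSet[fieldSigma V A] S → MeasurableSet[fieldSigma V B] T →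
        |P.real (S ∩ T) - P.real S * P.real T| ≤ Real.exp (-C * Real.log L ^ 2))
    {g m : ℝ} (hg : 1 ≤ |g|) {N : ℕ}
    {l L q D d : ℕ} (hlq : l ≤ q) (hqL : q ≤ L) (hDq : D + l ≤ q) (hd : 4 * N * q + q ≤ d)
    (hD : 2 * (N * (r₀ + 2 + 2 * l)) + 2 * l + l ≤ D)
    {u : Conf N} {s n γ' : ℝ} (hnL : (((2 * L + 1) ^ N : ℕ) : ℝ) ≤ n) (hn1 : 1 ≤ n)
    (hs : 0 < s) (hs1 : s ≤ 1) (hγ' : 0 ≤ γ') (hγ : γ' ≤ gammaExp m l)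
    (hsmall : (n ^ 3 * s⁻¹) ^ 2 *
      Real.exp (-((gammaExp m l - γ') * (l + 1)) + gammaExp m l) ≤ 1 / 2)
    (hrate : ∀ r : ℝ, (L : ℝ) ^ (7 / 8 : ℝ) ≤ r →
      gammaExp m L * r ≤ γ' * (r - 2 * (d + 6 * q + 3)))
    {ε ε' η K : ℝ} (hε0 : 0 ≤ ε') (hK : 0 ≤ K)
    (hε : ∀ c : Conf N, P.real {ω | ¬ IsLocalized U g (fun x => V x ω) m c l} ≤ ε)
    (hε' : ∀ n, 1 ≤ n → n < N → ∀ c : Conf n,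
      P.real {ω | ¬ IsLocalized U g (fun x => V x ω) m c l} ≤ ε')
    (hreg : ∀ a b : ℤ, a ≤ b → b - a ≤ ((2 * N * (L + q) : ℕ) : ℤ) →
      P.real {ω | K ≤ meanModulus P V (Finset.Icc a b) (3 * (2 * s)) ω} ≤ η) :
    P.real {ω | ¬ IsLocalized U g (fun x => V x ω) m u L}
      ≤ n * (2 * ε') + n ^ 2 * (ε ^ 2 + Real.exp (-C * Real.log l ^ 2))
        + 4 * n ^ 2 * (n ^ 2 * K + η) := by
  classical
  set B := ball u L with hB
  have hη : 0 ≤ η := measureReal_nonneg.trans (hreg 0 0 le_rfl (by push_cast; positivity))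
  have hn0 : 0 ≤ n := by linarith
  have hn : ((ball u L).card : ℝ) ≤ n :=
    le_trans (by exact_mod_cast card_ball_le u L) hnL
  have hcardBB : ((B ×ˢ B).card : ℝ) ≤ n ^ 2 := by
    rw [Finset.card_product, pow_two]
    push_cast
    gcongr
  refine (measureReal_mono (not_isLocalized_subset (G := r₀ + 2 + 2 * l) hlq hqL hDq hd hn hn1 hs
    hs1 hγ' hγ hsmall hrate) (measure_ne_top _ _)).trans ?_
  refine (measureReal_union_le _ _).trans (add_le_add ((measureReal_union_le _ _).trans
    (add_le_add ?_ ?_)) ?_)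
  · refine (measureReal_mono (s₂ := ⋃ c ∈ B.filter (fun c => ¬ Tight (r₀ + 2 + 2 * l) c),
      {ω | ¬ DecayBasis (kern U g fun x => V x ω) (ball c l) (gammaExp m l)
        ((l : ℝ) ^ (7 / 8 : ℝ))}) ?_ (measure_ne_top _ _)).trans ?_
    · rintro ω ⟨c, hc, ht, hω⟩
      exact Set.mem_iUnion₂.2 ⟨c, Finset.mem_filter.2 ⟨hc, ht⟩, hω⟩
    · refine (measureReal_biUnion_finset_le _ _).trans ((Finset.sum_le_card_nsmul _ _ (2 * ε')
        fun c hc => real_not_decayBasis_le hU hε' (Finset.mem_filter.1 hc).2).trans ?_)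
      rw [nsmul_eq_mul]
      refine mul_le_mul_of_nonneg_right (le_trans ?_ hn) (by positivity)
      exact_mod_cast Finset.card_filter_le _ _
  · refine (measureReal_mono (s₂ := ⋃ c ∈ (B ×ˢ B).filter (fun c =>
      Tight (r₀ + 2 + 2 * l) c.1 ∧ Tight (r₀ + 2 + 2 * l) c.2 ∧ D < rho c.1 c.2),
      {ω | ¬ IsLocalized U g (fun x => V x ω) m c.1 l} ∩
        {ω | ¬ IsLocalized U g (fun x => V x ω) m c.2 l}) ?_ (measure_ne_top _ _)).trans ?_
    · rintro ω ⟨c₁, hc₁, c₂, hc₂, t₁, t₂, hlt, hω⟩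
      exact Set.mem_iUnion₂.2 ⟨(c₁, c₂), Finset.mem_filter.2
        ⟨Finset.mem_product.2 ⟨hc₁, hc₂⟩, t₁, t₂, hlt⟩, hω⟩
    · refine (measureReal_biUnion_finset_le _ _).trans ((Finset.sum_le_card_nsmul _ _
        (ε ^ 2 + Real.exp (-C * Real.log l ^ 2)) fun c hc => ?_).trans ?_)
      · obtain ⟨-, t₁, t₂, hlt⟩ := Finset.mem_filter.1 hc
        exact real_inter_not_isLocalized_le hmix U g m t₁ t₂ hD hlt (hε _) (hε _)
      · rw [nsmul_eq_mul]
        refine mul_le_mul_of_nonneg_right (le_trans ?_ hcardBB) (by positivity)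
        exact_mod_cast Finset.card_filter_le _ _
  · refine (measureReal_mono (s₂ := ⋃ c ∈ ((B ×ˢ B).filter (fun c => 4 * N * q < rho c.1 c.2)) ×ˢ
      (({l, q} : Finset ℕ) ×ˢ ({l, q} : Finset ℕ)),
      spectraClose U g V s c.1.1 c.2.1 c.1.2 c.2.2) ?_ (measure_ne_top _ _)).trans ?_
    · rintro ω ⟨c₁, hc₁, c₂, hc₂, hlt, r₁, hr₁, r₂, hr₂, hω⟩
      exact Set.mem_iUnion₂.2 ⟨((c₁, c₂), (r₁, r₂)), Finset.mem_product.2 ⟨Finset.mem_filter.2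
        ⟨Finset.mem_product.2 ⟨hc₁, hc₂⟩, hlt⟩, Finset.mem_product.2 ⟨hr₁, hr₂⟩⟩, hω⟩
    · refine (measureReal_biUnion_finset_le _ _).trans ((Finset.sum_le_card_nsmul _ _
        (n ^ 2 * K + η) fun c hc => ?_).trans ?_)
      · obtain ⟨hc1, hc2⟩ := Finset.mem_product.1 hc
        obtain ⟨hc1, hlt⟩ := Finset.mem_filter.1 hc1
        obtain ⟨hcB1, hcB2⟩ := Finset.mem_product.1 hc1
        obtain ⟨hr1, hr2⟩ := Finset.mem_product.1 hc2
        obtain ⟨a, b, n₁, n₂, hab, hR, hne, ho₁, ho₂⟩ := exists_interval hcB1 hcB2 hlt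
        have hle : ∀ r ∈ ({l, q} : Finset ℕ), r ≤ q := by
          intro r hr
          rcases Finset.mem_insert.1 hr with h | h
          · omega
          · rw [Finset.mem_singleton.1 h]
        have hball : ∀ (c : Conf N), ∀ r ∈ ({l, q} : Finset ℕ), ball c r ⊆ ball c q := by
          intro c r hr x hx
          rw [mem_ball] at hx ⊢
          exact hx.trans (hle r hr)
        have hcardn : ∀ c : Conf N, ∀ r ∈ ({l, q} : Finset ℕ), ((ball c r).card : ℝ) ≤ n := by
          intro c r hr
          refine le_trans ?_ hnL
          refine Nat.cast_le.2 ((card_ball_le c r).trans (Nat.pow_le_pow_left ?_ N))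
          have := hle r hr
          omega
        refine (real_eigenvalues_close_le hV U hg hne (fun x hx => ho₁ x (hball _ _ hr1 hx))
          (fun x hx => ho₂ x (hball _ _ hr2 hx)) (by positivity) hK (hreg a b hab hR)).trans ?_
        gcongr
        rw [pow_two]
        exact mul_le_mul (hcardn _ _ hr1) (hcardn _ _ hr2) (Nat.cast_nonneg _) hn0
      · rw [nsmul_eq_mul]
        refine mul_le_mul_of_nonneg_right ?_ (by positivity)
        rw [Finset.card_product, Finset.card_product]
        push_cast
        have e1 : (({l, q} : Finset ℕ).card : ℝ) ≤ 2 := by exact_mod_cast Finset.card_le_two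
        have e2 : (((B ×ˢ B).filter fun c => 4 * N * q < rho c.1 c.2).card : ℝ) ≤ n ^ 2 :=
          le_trans (by exact_mod_cast Finset.card_filter_le _ _) hcardBB
        have e3 : (({l, q} : Finset ℕ).card : ℝ) * (({l, q} : Finset ℕ).card : ℝ) ≤ 2 * 2 :=
          mul_le_mul e1 e1 (Nat.cast_nonneg _) (by norm_num)
        calc _ ≤ n ^ 2 * (2 * 2) := mul_le_mul e2 e3 (by positivity) (by positivity)
          _ = 4 * n ^ 2 := by ring

end Step

/-! ### Comparison of scales -/

section Numerics

open Filter

theorem eventually_log_le (A B D : ℝ) {c β : ℝ} (hc : 0 < c) (hβ : 0 < β) :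
    ∀ᶠ x : ℝ in atTop, A + B * Real.log x + D * Real.log x ^ 2 ≤ c * x ^ β := by
  have h1 : (fun _ : ℝ => A) =o[atTop] fun x : ℝ => x ^ β :=
    Asymptotics.isLittleO_const_left.2
      (Or.inr (tendsto_norm_atTop_atTop.comp (tendsto_rpow_atTop hβ)))
  have h2 : (fun x : ℝ => B * Real.log x) =o[atTop] fun x : ℝ => x ^ β :=
    (isLittleO_log_rpow_atTop hβ).const_mul_left B
  have h3 : (fun x : ℝ => D * Real.log x ^ 2) =o[atTop] fun x : ℝ => x ^ β := by
    have := (isLittleO_log_rpow_rpow_atTop (s := β) 2 hβ).const_mul_left D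
    simpa using this
  filter_upwards [((h1.add h2).add h3).bound hc, eventually_ge_atTop 0] with x hx hx0
  rw [Real.norm_eq_abs, Real.norm_eq_abs, abs_of_nonneg (Real.rpow_nonneg hx0 β)] at hx
  exact (le_abs_self _).trans hx

theorem exp_neg_le {z w : ℝ} (hw : 0 < w) (h : w ≤ 1 + z) : Real.exp (-z) ≤ 1 / w := by
  rw [Real.exp_neg, one_div]
  exact inv_anti₀ hw (h.trans (by linarith [Real.add_one_le_exp z]))

/-- The contribution of eigenvalue concentration is negligible in comparison with the localization
bounds: stretched exponentials against `exp (O (log² x))`. -/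
theorem eventually_concentration_le (M p : ℝ) {C A b : ℝ} (hC : 0 < C) (hA : 0 < A) (hb : 0 < b) :
    ∀ᶠ x : ℝ in atTop, ∀ R t : ℝ, 0 ≤ R → R ≤ x ^ 3 → t ≤ p * Real.log x →
      4 * Real.exp (M * Real.log x) * (C * R ^ A * (6 * Real.exp (-x ^ (1 / 2 : ℝ))) ^ b)
        ≤ 1 / 32 * Real.exp (-(3 / 2 * t * Real.log x)) := by
  filter_upwards [eventually_log_le (Real.log 128 + Real.log C + b * Real.log 6) (M + 3 * A)
    (3 / 2 * p) hb (by norm_num : (0 : ℝ) < 1 / 2), eventually_ge_atTop 1] with x hx hx1 R t hR0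
      hR ht
  have hx0 : 0 < x := by linarith
  have hlog : 0 ≤ Real.log x := Real.log_nonneg hx1
  set y := Real.log x with hy
  have e1 : R ^ A ≤ Real.exp (3 * A * y) := by
    calc R ^ A ≤ (x ^ 3) ^ A := Real.rpow_le_rpow hR0 hR hA.le
      _ = Real.exp (3 * A * y) := by
        rw [Real.rpow_def_of_pos (by positivity), Real.log_pow, hy]; push_cast; ring_nf
  have e2 : (6 * Real.exp (-x ^ (1 / 2 : ℝ))) ^ b
      = Real.exp (b * Real.log 6 - b * x ^ (1 / 2 : ℝ)) := by
    rw [Real.rpow_def_of_pos (by positivity), Real.log_mul (by norm_num) (Real.exp_pos _).ne',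
      Real.log_exp]
    ring_nf
  have e3 : C = Real.exp (Real.log C) := (Real.exp_log hC).symm
  have e4 : (128 : ℝ) = Real.exp (Real.log 128) := (Real.exp_log (by norm_num)).symm
  have h1 : t * y ≤ p * y * y := mul_le_mul_of_nonneg_right ht hlog
  suffices h : 128 * (Real.exp (M * y) * (C * Real.exp (3 * A * y) *
      Real.exp (b * Real.log 6 - b * x ^ (1 / 2 : ℝ)))) ≤ Real.exp (-(3 / 2 * t * y)) by
    have h2 : C * R ^ A * (6 * Real.exp (-x ^ (1 / 2 : ℝ))) ^ b ≤ C * Real.exp (3 * A * y) *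
      Real.exp (b * Real.log 6 - b * x ^ (1 / 2 : ℝ)) := by
      rw [e2]; gcongr
    have h3 := mul_le_mul_of_nonneg_left h2 (Real.exp_pos (M * y)).le
    linarith
  rw [e4]
  nth_rewrite 1 [e3]
  rw [← Real.exp_add, ← Real.exp_add, ← Real.exp_add, ← Real.exp_add]
  refine Real.exp_le_exp.2 ?_
  nlinarith

/-- The successor `⌈l ^ α⌉` of the radius `l` in the sequence of scales. -/
def nextScale (l : ℕ) : ℕ := ⌈(l : ℝ) ^ alpha⌉₊

theorem rpow_le_nextScale (l : ℕ) : (l : ℝ) ^ (4 / 3 : ℝ) ≤ nextScale l := Nat.le_ceil _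

theorem nextScale_le (l : ℕ) : (nextScale l : ℝ) ≤ (l : ℝ) ^ (4 / 3 : ℝ) + 1 :=
  (Nat.ceil_lt_add_one (by unfold alpha; positivity)).le

/-- Polynomial relations between consecutive scales, for large radii. The proofs use the variable
`y = l ^ (1 / 24)`, of which all powers of `l` in question are natural powers. -/
theorem eventually_scales (N r₀ : ℕ) : ∀ᶠ l : ℕ in atTop,
    1 ≤ l ∧ r₀ + 2 ≤ l ∧ (6 * N + 4) * l ≤ nextScale l ∧
    (((2 * nextScale l + 1) ^ N : ℕ) : ℝ) ≤ Real.exp (2 * N * Real.log l) ∧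
    Real.log (nextScale l) ≤ 17 / 12 * Real.log l ∧
    ((2 * N * (nextScale l + (6 * N + 4) * l) : ℕ) : ℝ) ≤ (l : ℝ) ^ 3 ∧
    6 * Real.exp (-(l : ℝ) ^ (1 / 2 : ℝ)) ≤ 1 ∧
    2 * (l : ℝ) ^ (1 / 2 : ℝ) ≤ 1 / 8 * (l : ℝ) ^ (7 / 8 : ℝ) := by
  have htend : Tendsto (fun l : ℕ => (l : ℝ) ^ (1 / 24 : ℝ)) atTop atTop :=
    (tendsto_rpow_atTop (by norm_num)).comp tendsto_natCast_atTop_atTop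
  filter_upwards [eventually_ge_atTop (r₀ + 2),
    htend.eventually_ge_atTop ((6 * N + 4 : ℕ) + 10 : ℝ)] with l hl hy
  have hl1 : 1 ≤ l := by omega
  have hx1 : (1 : ℝ) ≤ l := by exact_mod_cast hl1
  have hx0 : (0 : ℝ) < l := by linarith
  set y := (l : ℝ) ^ (1 / 24 : ℝ) with hydef
  have hpow : ∀ j : ℕ, (l : ℝ) ^ ((j : ℝ) / 24) = y ^ j := by
    intro j
    rw [hydef, ← Real.rpow_natCast, ← Real.rpow_mul hx0.le]
    ring_nf
  have h43 : (l : ℝ) ^ (4 / 3 : ℝ) = y ^ 32 := by rw [← hpow]; norm_num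
  have h12 : (l : ℝ) ^ (1 / 2 : ℝ) = y ^ 12 := by rw [← hpow]; norm_num
  have h78 : (l : ℝ) ^ (7 / 8 : ℝ) = y ^ 21 := by rw [← hpow]; norm_num
  have hl24 : (l : ℝ) = y ^ 24 := by rw [← hpow]; norm_num
  push_cast at hy
  have hN0 : (0 : ℝ) ≤ N := Nat.cast_nonneg _
  have hy10 : 10 ≤ y := by linarith
  have hyN : (6 * N + 4 : ℝ) ≤ y := by linarith
  have hy1 : 1 ≤ y := by linarith
  have hy0 : 0 < y := by linarith
  have hpm : ∀ i j : ℕ, i ≤ j → y ^ i ≤ y ^ j := fun i j h => pow_le_pow_right₀ hy1 h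
  have hLle := nextScale_le l
  rw [h43] at hLle
  have hLge := rpow_le_nextScale l
  rw [h43] at hLge
  have h32 : 1 ≤ y ^ 32 := one_le_pow₀ hy1
  refine ⟨hl1, hl, ?_, ?_, ?_, ?_, ?_, ?_⟩
  · have : ((6 * N + 4) * l : ℝ) ≤ nextScale l := by
      rw [hl24]
      calc (6 * N + 4 : ℝ) * y ^ 24 ≤ y * y ^ 24 := by gcongr
        _ = y ^ 25 := by ring
        _ ≤ y ^ 32 := hpm _ _ (by norm_num)
        _ ≤ _ := hLge
    exact_mod_cast this
  · have h1 : (2 * nextScale l + 1 : ℝ) ≤ (l : ℝ) ^ 2 := by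
      rw [hl24]
      calc (2 * nextScale l + 1 : ℝ) ≤ 10 * y ^ 32 := by linarith
        _ ≤ y * y ^ 32 := by gcongr
        _ = y ^ 33 := by ring
        _ ≤ y ^ 48 := hpm _ _ (by norm_num)
        _ = (y ^ 24) ^ 2 := by ring
    push_cast
    calc (2 * (nextScale l : ℝ) + 1) ^ N ≤ ((l : ℝ) ^ 2) ^ N := by gcongr
      _ = Real.exp (2 * N * Real.log l) := by
        rw [← pow_mul, ← Real.exp_log (pow_pos hx0 (2 * N)), Real.log_pow]
        push_cast; rfl
  · have hLpos : (0 : ℝ) < nextScale l := by linarith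
    have : Real.log (l : ℝ) = 24 * Real.log y := by rw [hl24, Real.log_pow]; norm_num
    rw [this]
    calc Real.log (nextScale l) ≤ Real.log (y ^ 34) := by
          refine Real.log_le_log hLpos ?_
          calc (nextScale l : ℝ) ≤ 10 * y ^ 32 := by linarith
            _ ≤ y * y ^ 32 := by gcongr
            _ = y ^ 33 := by ring
            _ ≤ y ^ 34 := hpm _ _ (by norm_num)
      _ = 17 / 12 * (24 * Real.log y) := by rw [Real.log_pow]; push_cast; ring
  · push_cast
    rw [hl24]
    have e1 : (6 * N + 4 : ℝ) * y ^ 24 ≤ y ^ 32 := by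
      calc (6 * N + 4 : ℝ) * y ^ 24 ≤ y * y ^ 24 := by gcongr
        _ = y ^ 25 := by ring
        _ ≤ y ^ 32 := hpm _ _ (by norm_num)
    have e2 : (2 * N : ℝ) ≤ y := by linarith
    calc (2 * N : ℝ) * (nextScale l + (6 * N + 4) * y ^ 24) ≤ y * (10 * y ^ 32) := by
          gcongr; linarith
      _ ≤ y * (y * y ^ 32) := by gcongr
      _ = y ^ 34 := by ring
      _ ≤ y ^ 72 := hpm _ _ (by norm_num)
      _ = (y ^ 24) ^ 3 := by ring
  · have : Real.exp (-(l : ℝ) ^ (1 / 2 : ℝ)) ≤ 1 / 6 := by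
      refine exp_neg_le (by norm_num) ?_
      rw [h12]
      have := hpm 1 12 (by norm_num)
      linarith [pow_one y]
    linarith
  · rw [h12, h78]
    have e3 : 100 * 1 ≤ y * y * y ^ 7 := by
      have : 1 ≤ y ^ 7 := one_le_pow₀ hy1
      have : 100 ≤ y * y := by nlinarith
      nlinarith
    have e4 : y ^ 21 = y ^ 12 * (y * y * y ^ 7) := by ring
    have e5 : 0 < y ^ 12 := by positivity
    rw [e4]
    nlinarith

/-- The rate of decay is allowed to drop from one scale to the next by the difference of
`l ^ (-1/8)` and `l ^ (-1/6)`, which compensates for a number of excluded regions of size `O(l)`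
since `l / L ^ (7/8)` is of the order `l ^ (-1/6)`. -/
theorem eventually_rate (c : ℕ) : ∀ᶠ l : ℕ in atTop, ∀ m : ℝ, 1 ≤ m → ∀ r : ℝ,
    (nextScale l : ℝ) ^ (7 / 8 : ℝ) ≤ r →
      gammaExp m (nextScale l) * r
        ≤ m * (1 + 1 / 2 * (l : ℝ) ^ (-(1 / 8) : ℝ)) * (r - 2 * (c * l)) := by
  have htend : Tendsto (fun l : ℕ => (l : ℝ) ^ (1 / 24 : ℝ)) atTop atTop :=
    (tendsto_rpow_atTop (by norm_num)).comp tendsto_natCast_atTop_atTop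
  filter_upwards [eventually_ge_atTop 1,
    htend.eventually_ge_atTop (2 * (3 * c + 1) : ℝ)] with l hl1 hy m hm r hr
  have hx1 : (1 : ℝ) ≤ l := by exact_mod_cast hl1
  have hx0 : (0 : ℝ) < l := by linarith
  set y := (l : ℝ) ^ (1 / 24 : ℝ) with hydef
  have hy0 : 0 < y := Real.rpow_pos_of_pos hx0 _
  have hy1 : 1 ≤ y := Real.one_le_rpow hx1 (by norm_num)
  have hpow : ∀ j : ℕ, (l : ℝ) ^ ((j : ℝ) / 24) = y ^ j := by
    intro j
    rw [hydef, ← Real.rpow_natCast, ← Real.rpow_mul hx0.le]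
    ring_nf
  have hl24 : (l : ℝ) = y ^ 24 := by rw [← hpow]; norm_num
  have h8 : (l : ℝ) ^ (-(1 / 8) : ℝ) = (y ^ 3)⁻¹ := by
    rw [Real.rpow_neg hx0.le, ← hpow]; norm_num
  have hL : (l : ℝ) ^ (4 / 3 : ℝ) ≤ nextScale l := rpow_le_nextScale l
  have hL8 : (nextScale l : ℝ) ^ (-(1 / 8) : ℝ) ≤ (y ^ 4)⁻¹ := by
    have : (y ^ 4)⁻¹ = ((l : ℝ) ^ (4 / 3 : ℝ)) ^ (-(1 / 8) : ℝ) := by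
      rw [← Real.rpow_mul hx0.le, ← hpow, ← Real.rpow_neg hx0.le]; norm_num
    rw [this]
    exact Real.rpow_le_rpow_of_nonpos (by positivity) hL (by norm_num)
  have hr28 : y ^ 28 ≤ r := by
    refine le_trans ?_ hr
    have : y ^ 28 = ((l : ℝ) ^ (4 / 3 : ℝ)) ^ (7 / 8 : ℝ) := by
      rw [← Real.rpow_mul hx0.le, ← hpow]; norm_num
    rw [this]
    exact Real.rpow_le_rpow (by positivity) hL (by norm_num)
  have hr0 : 0 < r := lt_of_lt_of_le (by positivity) hr28
  set z := y⁻¹ with hz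
  have hz0 : 0 < z := inv_pos.2 hy0
  have hz1 : z ≤ 1 := inv_le_one_of_one_le₀ hy1
  have hyz : y * z = 1 := mul_inv_cancel₀ hy0.ne'
  rw [← inv_pow, ← hz] at h8 hL8
  have hlr : (l : ℝ) ≤ z ^ 4 * r := by
    calc (l : ℝ) = z ^ 4 * y ^ 28 := by
          rw [hl24]
          calc y ^ 24 = y ^ 24 * (y * z) ^ 4 := by rw [hyz]; ring
            _ = z ^ 4 * y ^ 28 := by ring
      _ ≤ _ := by gcongr
  have hcz : (3 * c + 1 : ℝ) * z ^ 4 ≤ 1 / 2 * z ^ 3 := by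
    have : (3 * c + 1 : ℝ) * z ≤ 1 / 2 := by
      have := mul_le_mul_of_nonneg_right hy hz0.le
      linarith
    calc (3 * c + 1 : ℝ) * z ^ 4 = ((3 * c + 1 : ℝ) * z) * z ^ 3 := by ring
      _ ≤ _ := by gcongr
  unfold gammaExp
  rw [h8, mul_assoc, mul_assoc]
  refine mul_le_mul_of_nonneg_left ?_ (by linarith)
  have hz31 : z ^ 3 ≤ 1 := pow_le_one₀ hz0.le hz1
  have hc0 : (0 : ℝ) ≤ c := Nat.cast_nonneg _
  calc (1 + (nextScale l : ℝ) ^ (-(1 / 8) : ℝ)) * r ≤ (1 + z ^ 4) * r := by gcongr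
    _ ≤ (1 + 1 / 2 * z ^ 3 - 3 * c * z ^ 4) * r := by
        refine mul_le_mul_of_nonneg_right ?_ hr0.le
        linarith
    _ = (1 + 1 / 2 * z ^ 3) * r - 3 / 2 * (2 * (c * (z ^ 4 * r))) := by ring
    _ ≤ (1 + 1 / 2 * z ^ 3) * r - 3 / 2 * (2 * (c * l)) := by gcongr
    _ ≤ (1 + 1 / 2 * z ^ 3) * r - (1 + 1 / 2 * z ^ 3) * (2 * (c * l)) := by
        gcongr
        linarith
    _ = _ := by ring

/-- The gain `exp (-(γ - γ') l)` in a non-resonant localized ball beats the polynomial volume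
factors and two small denominators. -/
theorem eventually_gain (N : ℕ) : ∀ᶠ l : ℕ in atTop,
    2 * (l : ℝ) ^ (1 / 2 : ℝ) ≤ 1 / 8 * (l : ℝ) ^ (7 / 8 : ℝ) → ∀ m : ℝ, 1 ≤ m →
    (Real.exp (2 * N * Real.log l) ^ 3 * (Real.exp (-(l : ℝ) ^ (1 / 2 : ℝ)))⁻¹) ^ 2 *
      Real.exp (-((gammaExp m l - m * (1 + 1 / 2 * (l : ℝ) ^ (-(1 / 8) : ℝ))) * (l + 1))
        + gammaExp m l) ≤ 1 / 2 := by
  filter_upwards [eventually_ge_atTop 1, tendsto_natCast_atTop_atTop.eventually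
    (eventually_log_le 3 (12 * N) 0 (by norm_num : (0 : ℝ) < 1 / 8)
      (by norm_num : (0 : ℝ) < 7 / 8))] with l hl1 hlog hhalf m hm
  have hx1 : (1 : ℝ) ≤ l := by exact_mod_cast hl1
  have hx0 : (0 : ℝ) < l := by linarith
  have h0 : 0 ≤ Real.log (l : ℝ) := Real.log_nonneg hx1
  have hz0 : 0 < (l : ℝ) ^ (-(1 / 8) : ℝ) := by positivity
  have hz1 : (l : ℝ) ^ (-(1 / 8) : ℝ) ≤ 1 := Real.rpow_le_one_of_one_le_of_nonpos hx1 (by norm_num)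
  have hzl : (l : ℝ) ^ (-(1 / 8) : ℝ) * l = (l : ℝ) ^ (7 / 8 : ℝ) := by
    nth_rewrite 2 [← Real.rpow_one (l : ℝ)]
    rw [← Real.rpow_add hx0]; norm_num
  set z := (l : ℝ) ^ (-(1 / 8) : ℝ) with hz
  set w := (l : ℝ) ^ (7 / 8 : ℝ) with hw
  set v := (l : ℝ) ^ (1 / 2 : ℝ) with hv
  set lam := Real.log (l : ℝ) with hlam
  have hNl : 0 ≤ (12 * N : ℝ) * lam := by positivity
  have hw24 : 24 ≤ w := by linarith
  have hexp : -((gammaExp m l - m * (1 + 1 / 2 * z)) * (l + 1)) + gammaExp m l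
      ≤ -(1 / 2 * w - 2) := by
    unfold gammaExp
    rw [← hz]
    have e : -((m * (1 + z) - m * (1 + 1 / 2 * z)) * ((l : ℝ) + 1)) + m * (1 + z)
        = -(m * (1 / 2 * (z * l) - 1 - 1 / 2 * z)) := by ring
    rw [e, hzl]
    have : 1 * (1 / 2 * w - 2) ≤ m * (1 / 2 * w - 1 - 1 / 2 * z) :=
      mul_le_mul hm (by linarith) (by linarith) (by linarith)
    linarith
  have e1 : (Real.exp (2 * N * lam) ^ 3 * (Real.exp (-v))⁻¹) ^ 2
      = Real.exp (12 * N * lam + 2 * v) := by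
    rw [← Real.exp_neg, neg_neg, ← Real.exp_nat_mul, ← Real.exp_add, ← Real.exp_nat_mul]
    push_cast; ring_nf
  rw [e1]
  calc _ ≤ Real.exp (12 * N * lam + 2 * v) * Real.exp (-(1 / 2 * w - 2)) := by gcongr
    _ = Real.exp (-(1 / 2 * w - 2 - (12 * N * lam + 2 * v))) := by
        rw [← Real.exp_add]; ring_nf
    _ ≤ 1 / 2 := exp_neg_le (by norm_num) (by linarith)

/-- The probability bounds reproduce themselves in the next scale. -/
theorem eventually_probability {N : ℕ} (hN : 1 ≤ N) (p : ℝ) {C C' C'' A' A'' b' b'' : ℝ}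
    (hC : 0 < C)
    (hC' : 0 < C') (hC'' : 0 < C'') (hA' : 0 < A') (hA'' : 0 < A'') (hb' : 0 < b')
    (hb'' : 0 < b'') : ∀ᶠ l : ℕ in atTop, ∀ R t b L : ℝ, 0 ≤ R → R ≤ (l : ℝ) ^ 3 →
      16 * (N : ℝ) ≤ t → t ≤ p * Real.log l → 7 / 4 * t ≤ C / 2 * Real.log l → 0 < L →
      Real.log L ≤ 17 / 12 * Real.log l → 0 ≤ b → b ≤ 1 / 24 →
      Real.exp (2 * N * Real.log l) * (2 * (1 / 4 * (l : ℝ) ^ (-(3 * t))))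
        + Real.exp (2 * N * Real.log l) ^ 2 *
          ((1 / 4 * (l : ℝ) ^ (-t)) ^ 2 + Real.exp (-C * Real.log l ^ 2))
        + 4 * Real.exp (2 * N * Real.log l) ^ 2 * (Real.exp (2 * N * Real.log l) ^ 2 *
            (C' * R ^ A' * (6 * Real.exp (-(l : ℝ) ^ (1 / 2 : ℝ))) ^ b')
          + C'' * R ^ A'' * (6 * Real.exp (-(l : ℝ) ^ (1 / 2 : ℝ))) ^ b'')
        ≤ 1 / 4 * L ^ (-(t * (1 + b))) := by
  have htl : Tendsto (fun l : ℕ => Real.log (l : ℝ)) atTop atTop :=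
    Real.tendsto_log_atTop.comp tendsto_natCast_atTop_atTop
  filter_upwards [eventually_ge_atTop 1, tendsto_natCast_atTop_atTop.eventually
      (eventually_concentration_le (8 * N) p hC' hA' hb'),
    tendsto_natCast_atTop_atTop.eventually (eventually_concentration_le (4 * N) p hC'' hA'' hb''),
    htl.eventually_ge_atTop (1 + 30 / C)] with l hl1 hc1 hc2 hlog R t b L hR0 hR htN htp htC hL0
      hL hb0 hb
  have hx1 : (1 : ℝ) ≤ l := by exact_mod_cast hl1
  have hx0 : (0 : ℝ) < l := by linarith
  have hk1 := hc1 R t hR0 hR htp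
  have hk2 := hc2 R t hR0 hR htp
  set y := Real.log (l : ℝ) with hy
  have hN' : (1 : ℝ) ≤ N := by exact_mod_cast hN
  have ht16 : 16 ≤ t := by linarith
  have hC30 : 0 < 30 / C := by positivity
  have hy1 : 1 ≤ y := by linarith
  have hty : 16 ≤ t * y := by nlinarith
  have hNy : 16 * N * y ≤ t * y := mul_le_mul_of_nonneg_right htN (by linarith)
  set e := Real.exp (-(3 / 2 * t * y)) with he
  have he0 : 0 < e := Real.exp_pos _
  have htarget : 1 / 4 * e ≤ 1 / 4 * L ^ (-(t * (1 + b))) := by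
    refine mul_le_mul_of_nonneg_left ?_ (by norm_num)
    rw [Real.rpow_def_of_pos hL0, he]
    refine Real.exp_le_exp.2 ?_
    have h1 : Real.log L * (t * (1 + b)) ≤ 17 / 12 * y * (t * (1 + b)) :=
      mul_le_mul_of_nonneg_right hL (by positivity)
    have h2 : t * y * (1 + b) ≤ t * y * (25 / 24) :=
      mul_le_mul_of_nonneg_left (by linarith) (by linarith)
    nlinarith
  have hrp : ∀ a : ℝ, (l : ℝ) ^ a = Real.exp (y * a) := fun a => Real.rpow_def_of_pos hx0 a
  have hsq : Real.exp (2 * N * y) ^ 2 = Real.exp (4 * N * y) := by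
    rw [← Real.exp_nat_mul]; push_cast; ring_nf
  have t1 : Real.exp (2 * N * y) * (2 * (1 / 4 * (l : ℝ) ^ (-(3 * t)))) ≤ 1 / 16 * e := by
    rw [hrp]
    have e1 : Real.exp (2 * N * y) * (2 * (1 / 4 * Real.exp (y * -(3 * t))))
        = 1 / 2 * e * Real.exp (-(3 / 2 * (t * y) - 2 * N * y)) := by
      have : Real.exp (2 * N * y) * Real.exp (y * -(3 * t))
          = e * Real.exp (-(3 / 2 * (t * y) - 2 * N * y)) := by
        rw [he, ← Real.exp_add, ← Real.exp_add]; ring_nf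
      linear_combination 1 / 2 * this
    rw [e1]
    have e2 : Real.exp (-(3 / 2 * (t * y) - 2 * N * y)) ≤ 1 / 8 :=
      exp_neg_le (by norm_num) (by linarith)
    linarith [mul_le_mul_of_nonneg_left e2 he0.le]
  have t2 : Real.exp (4 * N * y) * (1 / 4 * (l : ℝ) ^ (-t)) ^ 2 ≤ 1 / 16 * e := by
    have : Real.exp (4 * N * y) * Real.exp (y * -t) ^ 2 ≤ e := by
      rw [← Real.exp_nat_mul]
      rw [← Real.exp_add, he]
      refine Real.exp_le_exp.2 ?_
      push_cast
      linarith
    rw [hrp, mul_pow]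
    linarith
  have t3 : Real.exp (4 * N * y) * Real.exp (-C * y ^ 2) ≤ 1 / 16 * e := by
    have e1 : Real.exp (4 * N * y) * Real.exp (-C * y ^ 2)
        = e * Real.exp (-(C * y ^ 2 - 4 * N * y - 3 / 2 * (t * y))) := by
      rw [he, ← Real.exp_add, ← Real.exp_add]; ring_nf
    rw [e1]
    have e2 : Real.exp (-(C * y ^ 2 - 4 * N * y - 3 / 2 * (t * y))) ≤ 1 / 16 := by
      refine exp_neg_le (by norm_num) ?_
      have h1 : 7 / 4 * t * y ≤ C / 2 * y * y := mul_le_mul_of_nonneg_right htC (by linarith)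
      have h2 : 30 ≤ C * y := by
        have := mul_le_mul_of_nonneg_left (show 30 / C ≤ y by linarith) hC.le
        rwa [mul_div_cancel₀ _ hC.ne'] at this
      have h3 : C * y * 1 ≤ C * y * y := mul_le_mul_of_nonneg_left hy1 (by linarith)
      linarith
    linarith [mul_le_mul_of_nonneg_left e2 he0.le]
  have hq : Real.exp (4 * N * y) * Real.exp (4 * N * y) = Real.exp (8 * N * y) := by
    rw [← Real.exp_add]; ring_nf
  refine le_trans ?_ htarget
  rw [hsq]
  rw [← hq] at hk1
  generalize C' * R ^ A' * (6 * Real.exp (-(l : ℝ) ^ (1 / 2 : ℝ))) ^ b' = X at *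
  generalize C'' * R ^ A'' * (6 * Real.exp (-(l : ℝ) ^ (1 / 2 : ℝ))) ^ b'' = Y at *
  generalize Real.exp (4 * N * y) = F at *
  linarith

end Numerics

/-! ### Induction in the scale and in the number of particles -/

section Induction

open Filter

theorem scale_succ (L₀ k : ℕ) : scale L₀ (k + 1) = nextScale (scale L₀ k) := rfl

theorem le_nextScale (l : ℕ) : l ≤ nextScale l := by
  rcases Nat.eq_zero_or_pos l with h | h
  · rw [h]; exact Nat.zero_le _
  · have h1 : (1 : ℝ) ≤ l := by exact_mod_cast h
    have : (l : ℝ) ≤ nextScale l :=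
      calc (l : ℝ) = (l : ℝ) ^ (1 : ℝ) := (Real.rpow_one _).symm
        _ ≤ (l : ℝ) ^ (4 / 3 : ℝ) := Real.rpow_le_rpow_of_exponent_le h1 (by norm_num)
        _ ≤ _ := rpow_le_nextScale l
    exact_mod_cast this

theorem le_scale (L₀ k : ℕ) : L₀ ≤ scale L₀ k := by
  induction k with
  | zero => exact le_rfl
  | succ k ih => exact ih.trans (le_nextScale _)

theorem pow_mul_log_le_log_scale {L₀ : ℕ} (h : 1 ≤ L₀) (k : ℕ) :
    (4 / 3 : ℝ) ^ k * Real.log L₀ ≤ Real.log (scale L₀ k) := by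
  induction k with
  | zero => rw [pow_zero, one_mul]; exact le_rfl
  | succ k ih =>
    have h1 : (0 : ℝ) < scale L₀ k := by
      exact_mod_cast lt_of_lt_of_le (by omega : 0 < L₀) (le_scale L₀ k)
    rw [scale_succ]
    calc (4 / 3 : ℝ) ^ (k + 1) * Real.log L₀ = 4 / 3 * ((4 / 3 : ℝ) ^ k * Real.log L₀) := by ring
      _ ≤ 4 / 3 * Real.log (scale L₀ k) := by gcongr
      _ = Real.log ((scale L₀ k : ℝ) ^ (4 / 3 : ℝ)) := (Real.log_rpow h1 _).symm
      _ ≤ _ := Real.log_le_log (by positivity) (rpow_le_nextScale _)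

/-- The localization bounds at all scales. The exponent `p` is arbitrary in the induction in the
number of particles: the bounds for fewer particles enter with the exponent `3 p`. -/
theorem eventually_localized {Ω : Type*} [MeasurableSpace Ω] {P : Measure Ω}
    [IsProbabilityMeasure P] {V : ℤ → Ω → ℝ} (hV : ∀ x, Measurable (V x))
    (hW1 : HolderContinuousCDF P V) (hW2 : StrongMixing P V) (hW3 : RegularSampleMean P V)
    {U : ℕ → ℝ} {r₀ : ℕ} (hU : ∀ r, r₀ ≤ r → U r = 0) (N : ℕ) :
    1 ≤ N → ∀ p : ℝ, 16 * (N : ℝ) < p → ∀ᶠ L₀ : ℕ in atTop, ∀ m : ℝ, 1 ≤ m →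
      ∀ᶠ g : ℝ in comap (fun g => |g|) atTop, ∀ b : ℝ, 0 < b → b ≤ 1 / 24 →
        ∀ (k : ℕ) (u : Conf N), P.real {ω | ¬ IsLocalized U g (fun x => V x ω) m u (scale L₀ k)}
          ≤ 1 / 4 * (scale L₀ k : ℝ) ^ (-(p * (1 + b) ^ k)) := by
  induction N using Nat.strong_induction_on with
  | _ N ih =>
  intro hN p hp
  obtain ⟨C, hC, hmix⟩ := hW2
  obtain ⟨C', C'', A', A'', b', b'', hC', hC'', hA', hA'', hb', hb'', hreg⟩ := hW3
  have hN1 : (1 : ℝ) ≤ N := by exact_mod_cast hN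
  have hp0 : 0 < p := by linarith
  have hIH : ∀ᶠ L₀ : ℕ in atTop, ∀ n ∈ Finset.range N, 1 ≤ n → ∀ m : ℝ, 1 ≤ m →
      ∀ᶠ g : ℝ in comap (fun g => |g|) atTop, ∀ b : ℝ, 0 < b → b ≤ 1 / 24 →
        ∀ (k : ℕ) (u : Conf n), P.real {ω | ¬ IsLocalized U g (fun x => V x ω) m u (scale L₀ k)}
          ≤ 1 / 4 * (scale L₀ k : ℝ) ^ (-(3 * p * (1 + b) ^ k)) := by
    refine (eventually_all_finset _).2 fun n hn => ?_
    by_cases hn1 : 1 ≤ n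
    · have hnN : (n : ℝ) ≤ N := by exact_mod_cast (Finset.mem_range.1 hn).le
      filter_upwards [ih n (Finset.mem_range.1 hn) hn1 (3 * p) (by linarith)] with L₀ h _
      exact h
    · exact Eventually.of_forall fun _ h => absurd h hn1
  set c : ℕ := (4 * N + 1) * (6 * N + 4) + 6 * (6 * N + 4) + 3 with hc
  have htl : Tendsto (fun l : ℕ => Real.log (l : ℝ)) atTop atTop :=
    Real.tendsto_log_atTop.comp tendsto_natCast_atTop_atTop
  filter_upwards [hIH, eventually_forall_ge_atTop.2 (eventually_scales N r₀),
    eventually_forall_ge_atTop.2 (eventually_rate c),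
    eventually_forall_ge_atTop.2 (eventually_gain N),
    eventually_forall_ge_atTop.2
      (eventually_probability hN p hC hC' hC'' hA' hA'' hb' hb''),
    htl.eventually_ge_atTop (1 + 7 / 4 * p / (C / 2))] with L₀ hIH hscales hrate hgain hprob
      hlog m hm
  have hq0 : 0 ≤ 7 / 4 * p / (C / 2) := by positivity
  have hL₀ : 1 ≤ L₀ := (hscales L₀ le_rfl).1
  have hinit : ∀ᶠ g : ℝ in comap (fun g => |g|) atTop, ∀ u : Conf N,
      P.real {ω | ¬ IsLocalized U g (fun x => V x ω) m u L₀} ≤ 1 / 4 * (L₀ : ℝ) ^ (-p) := by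
    have hL0 : (0 : ℝ) < L₀ := by exact_mod_cast hL₀
    obtain ⟨g₀, -, hg₀⟩ := exists_disorder hV hW1 hU N L₀ (m := m) (by linarith)
      (show 0 < 1 / 4 * (L₀ : ℝ) ^ (-p) by positivity)
    exact (tendsto_comap.eventually_ge_atTop g₀).mono fun g hg => hg₀ g hg
  have hIH' : ∀ᶠ g : ℝ in comap (fun g => |g|) atTop, ∀ n ∈ Finset.range N, 1 ≤ n →
      ∀ b : ℝ, 0 < b → b ≤ 1 / 24 →
        ∀ (k : ℕ) (u : Conf n), P.real {ω | ¬ IsLocalized U g (fun x => V x ω) m u (scale L₀ k)}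
          ≤ 1 / 4 * (scale L₀ k : ℝ) ^ (-(3 * p * (1 + b) ^ k)) := by
    refine (eventually_all_finset _).2 fun n hn => ?_
    by_cases hn1 : 1 ≤ n
    · filter_upwards [hIH n hn hn1 m hm] with g h _
      exact h
    · exact Eventually.of_forall fun _ h => absurd h hn1
  filter_upwards [hinit, hIH', tendsto_comap.eventually_ge_atTop (1 : ℝ)] with g hinit hIH' hg b
    hb0 hb k
  induction k with
  | zero => intro u; rw [pow_zero, mul_one]; exact hinit u
  | succ k ihk =>
  intro u
  set l := scale L₀ k with hl
  have hlL₀ : L₀ ≤ l := le_scale L₀ k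
  obtain ⟨hl1, hr₀, hqL, hcard, hlogL, hR, hs, hhalf⟩ := hscales l hlL₀
  rw [scale_succ, ← hl]
  set L := nextScale l with hLdef
  set q := (6 * N + 4) * l with hq
  set t := p * (1 + b) ^ k with ht
  have hx1 : (1 : ℝ) ≤ l := by exact_mod_cast hl1
  have hlogl := pow_mul_log_le_log_scale hL₀ k
  rw [← hl] at hlogl
  have hbk : (1 + b) ^ k ≤ (4 / 3 : ℝ) ^ k := pow_le_pow_left₀ (by linarith) (by linarith) k
  have hbk1 : 1 ≤ (1 + b) ^ k := one_le_pow₀ (by linarith)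
  have htN : 16 * (N : ℝ) ≤ t := by nlinarith
  -- `(1 + b) ^ k` is at most `log L_k / log L₀`, so that `l ^ (-t)` is at least
  -- `exp (-p (log l) ^ 2 / log L₀)`, which dominates the mixing error if `L₀` is large.
  have hbklog : (1 + b) ^ k * Real.log L₀ ≤ Real.log l :=
    (mul_le_mul_of_nonneg_right hbk (by linarith)).trans hlogl
  have htp : t ≤ p * Real.log l := by
    rw [ht]
    refine mul_le_mul_of_nonneg_left (le_trans ?_ hbklog) hp0.le
    exact le_mul_of_one_le_right (by linarith) (by linarith)
  have htC : 7 / 4 * t ≤ C / 2 * Real.log l := by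
    have h1 : 7 / 4 * p ≤ C / 2 * Real.log L₀ := by
      rw [mul_comm (C / 2), ← div_le_iff₀ (by positivity)]
      linarith
    calc 7 / 4 * t = 7 / 4 * p * (1 + b) ^ k := by rw [ht]; ring
      _ ≤ C / 2 * Real.log L₀ * (1 + b) ^ k := by gcongr
      _ = C / 2 * ((1 + b) ^ k * Real.log L₀) := by ring
      _ ≤ _ := by gcongr
  have hL1 : 1 ≤ L := hl1.trans (le_nextScale l)
  have hL0 : (0 : ℝ) < L := by exact_mod_cast hL1
  set s := Real.exp (-(l : ℝ) ^ (1 / 2 : ℝ)) with hsdef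
  have hs0 : 0 < s := Real.exp_pos _
  set γ' := m * (1 + 1 / 2 * (l : ℝ) ^ (-(1 / 8) : ℝ)) with hγ'
  have hγ'0 : 0 ≤ γ' := by positivity
  have hz0 : 0 ≤ (l : ℝ) ^ (-(1 / 8) : ℝ) := by positivity
  set R : ℕ := 2 * N * (L + q) with hRdef
  have hR1 : 1 ≤ R := by
    rw [hRdef]
    exact Nat.one_le_iff_ne_zero.2 (by positivity)
  have hexp1 : (1 : ℝ) ≤ Real.exp (2 * N * Real.log l) :=
    Real.one_le_exp (mul_nonneg (by positivity) (Real.log_nonneg hx1))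
  have hlq : l ≤ q := by rw [hq]; nlinarith
  refine (real_not_isLocalized_le hV hU hmix (l := l) (q := q) (D := (6 * N + 3) * l)
    (d := (4 * N + 1) * q) (n := Real.exp (2 * N * Real.log l)) (s := s) (γ' := γ')
    (ε := 1 / 4 * (l : ℝ) ^ (-t)) (ε' := 1 / 4 * (l : ℝ) ^ (-(3 * t)))
    (K := C' * (R : ℝ) ^ A' * (6 * s) ^ b') (η := C'' * (R : ℝ) ^ A'' * (6 * s) ^ b'')
    hg hlq hqL ?_ ?_ ?_ hcard hexp1 hs0 ?_ hγ'0 ?_ (hgain l hlL₀ hhalf m hm) ?_ (by positivity)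
    (by positivity) ihk ?_ ?_).trans ?_
  · rw [hq]; exact le_of_eq (by ring)
  · exact le_of_eq (by ring)
  · have : 2 * (N * (r₀ + 2 + 2 * l)) ≤ 2 * (N * (l + 2 * l)) := by gcongr
    linarith
  · linarith
  · rw [hγ']
    unfold gammaExp
    have : 0 ≤ m * (l : ℝ) ^ (-(1 / 8) : ℝ) := by positivity
    linarith
  · intro r hr
    refine (hrate l hlL₀ m hm r hr).trans (mul_le_mul_of_nonneg_left ?_ hγ'0)
    have : ((c : ℕ) : ℝ) * l ≥ ((4 * N + 1) * q : ℕ) + 6 * (q : ℝ) + 3 := by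
      rw [hc, hq]
      push_cast
      linarith
    linarith
  · intro n hn1 hn c
    have := hIH' n (Finset.mem_range.2 hn) hn1 b hb0 hb k c
    rw [mul_assoc] at this
    exact this
  · intro a d hab hba
    have := hreg R hR1 a d hab hba (6 * s) (by positivity) hs
    rw [show 3 * (2 * s) = 6 * s by ring]
    exact this
  · have := hprob l hlL₀ R t b L (Nat.cast_nonneg _) hR htN htp htC hL0 hlogL hb0.le hb
    rw [show p * (1 + b) ^ (k + 1) = t * (1 + b) by rw [ht]; ring]
    exact this

end Induction

end FermionLoc

end

theorem mainTheorem2 {Ω : Type*} [MeasurableSpace Ω] (P : Measure Ω) [IsProbabilityMeasure P]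
    (V : ℤ → Ω → ℝ) (hV : ∀ x, Measurable (V x))
    (hW1 : FermionLoc.HolderContinuousCDF P V)
    (hW2 : FermionLoc.StrongMixing P V)
    (hW3 : FermionLoc.RegularSampleMean P V)
    (U : ℕ → ℝ) (hU : ∃ r₀ : ℕ, ∀ r : ℕ, r₀ ≤ r → U r = 0)
    (N : ℕ) (hN : 1 ≤ N) (p : ℝ)
    (hp : 2 * FermionLoc.alpha ^ 2 / (2 - FermionLoc.alpha ^ 2) * (N : ℝ) < p) :
    ∃ Lmin : ℕ, ∀ L₀ : ℕ, Lmin ≤ L₀ → ∀ m : ℝ, 1 ≤ m →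
      ∃ g₀ : ℝ, 0 < g₀ ∧ ∀ g : ℝ, g₀ ≤ |g| →
        ∀ b : ℝ, 0 < b →
          3 * b ≤ min ((2 - FermionLoc.alpha ^ 2) / FermionLoc.alpha ^ 2 - 2 * (N : ℝ) / p)
            (Real.sqrt 2 - 1) →
          ∀ (k : ℕ) (u : FermionLoc.Conf N),
            P {ω | ¬ FermionLoc.IsLocalized U g (fun x => V x ω) m u (FermionLoc.scale L₀ k)}
              ≤ ENNReal.ofReal
                  (1 / 4 * (FermionLoc.scale L₀ k : ℝ) ^ (-(p * (1 + b) ^ k))) := by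
  obtain ⟨r₀, hU⟩ := hU
  have hp16 : 16 * (N : ℝ) < p := by
    refine lt_of_eq_of_lt ?_ hp
    norm_num [FermionLoc.alpha]
  obtain ⟨Lmin, hLmin⟩ := Filter.eventually_atTop.1
    (FermionLoc.eventually_localized hV hW1 hW2 hW3 hU N hN p hp16)
  refine ⟨Lmin, fun L₀ hL₀ m hm => ?_⟩
  obtain ⟨g₀, hg₀⟩ := Filter.eventually_atTop.1 (Filter.eventually_comap.1 (hLmin L₀ hL₀ m hm))
  refine ⟨max g₀ 1, by positivity, fun g hg b hb0 hb k u => ?_⟩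
  have hb24 : b ≤ 1 / 24 := by
    have h1 := hb.trans (min_le_left _ _)
    have h2 : (2 - FermionLoc.alpha ^ 2) / FermionLoc.alpha ^ 2 = 1 / 8 := by
      norm_num [FermionLoc.alpha]
    have h3 : 0 ≤ 2 * (N : ℝ) / p := by
      have : 0 ≤ (N : ℝ) := Nat.cast_nonneg _
      exact div_nonneg (by linarith) (by linarith)
    linarith
  have := hg₀ |g| ((le_max_left _ _).trans hg) g rfl b hb0 hb24 k u
  rw [← ofReal_measureReal]
  exact ENNReal.ofReal_le_ofReal this
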